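/- **Setting.** For probability laws $P,Q$ let $T(P,Q)(\alpha)=\inf_\phi\{1-\mathbb E_Q[\phi]:\mathbb E_P[\phi]\le\alpha\}$, $\alpha\in[0,1]$, where $\phi$ ranges over measurable tests with values in $[0,1]$. Functions of the form $T(P,Q)$ are called trade-off functions. Put $T(P,Q)\otimes T(P',Q')=T(P\times P',Q\times Q')$ and $G(\mu)(\alpha)=G_\mu(\alpha)=\Phi(\Phi^{-1}(1-\alpha)-\mu)$ with $\Phi$ the standard normal distribution function. For $0<p\le1$ and a trade-off function $f$ put $f_p(x)=pf(x)+(1-p)(1-x)$ and $C_p(f)=(\min\{f_p,f_p^{-1}\})^{**}$, with $f_p^{-1}(\alpha)=\inf\{x\in[0,1]:f_p(x)\le\alpha\}$ and $^{**}$ the double convex conjugate on $[0,1]$. Inequalities between trade-off functions are pointwise on $[0,1]$. *Decentralized DP-SGD.* A model in $\mathbb R^d$ performs a random walk with Markov transition matrix $W$ on a finite set $V$ of users; user $v$ holds $m_v\ge b$ records. In each round the current user $v$ performs $K\ge1$ steps $\theta\leftarrow\Pi_{\mathcal K}\big(\theta-\eta(g+N)\big)$, where $g=\frac1b\sum_{z\in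 S}\nabla\ell_{v,z}(\theta)$ for a fresh uniformly random set $S$ of $b\ge1$ of the records of $v$, $N\sim\mathcal N(0,\sigma^2I_d)$ is fresh, $\eta,\sigma>0$, and $\Pi_{\mathcal K}$ is the projection onto a nonempty closed convex set $\mathcal K$ ($\mathcal K=\mathbb R^d$ is allowed). Then the model is sent to the next user of the walk. The losses are differentiable and have gradient sensitivity $\Delta$: replacing one record of a mini-batch changes the mini-batch gradient of a user by at most $\Delta$ in norm, at every $\theta$. Let $i,j\in V$, $t\ge1$, and let $\tau_{ij}$ be the first time $s\ge1$ at which the walk started at $i$ at time $0$ is at $j$; assume $\mathbb P[\tau_{ij}=t]>0$. Let $\mathcal A_j^t(D)$ be the law, given $\tau_{ij}=t$, of the model received by $j$ at time $t$, started from an arbitrary fixed initial law. Let $D\approx_iD'$, i.e. the collections of datasets $D$ and $D'$ differ only in one record, held by user $i$, and let $\widetilde f_{ij}^t=T(\mathcal A_j^t(D),\mathcal A_j^t(D'))$. Here only the current pass through $i$ is accounted for: the two runs use $D$, respectively $D'$, in round $0$, and one and the same arbitrary collection of datasets $E$ in the rounds $1,\dots,t-1$ (if the walk cannot return to $i$ before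 reaching $j$, taking $E=D$ gives the algorithm run on $D$ and on $D'$). **Lemma.** (1) Suppose that each loss $\ell_{v,z}$ is $m$-strongly convex ($m>0$) and $M$-smooth, that $\eta\in(0,2/M)$, and that $t>1$. Let $c=\max\{|1-\eta m|,|1-\eta M|\}$, let $0<\gamma_k<1$ be arbitrary, $b_0=0$, and $$b_{k+1}=\max\{c\,b_k,\ (1-\gamma_{k+1})(c\,b_k+\eta\Delta)\},\qquad a_{k+1}=\gamma_{k+1}(c\,b_k+\eta\Delta).$$ Then $$\widetilde f_{ij}^t\ \ge\ G\Big(\frac{2\sqrt2\,c^{(t-1)K}b_K}{\eta\sigma}\Big)\otimes\bigotimes_{k=1}^K C_{b/m_i}\Big(G\Big(\frac{2a_k}{\eta\sigma}\Big)\Big).$$ (2) Without any convexity or smoothness assumption on the losses beyond differentiability, for every $\eta>0$ and $t\ge1$, $$\widetilde f_{ij}^t\ \ge\ \bigotimes_{k=1}^K C_{b/m_i}\big(G_{\Delta/\sigma}\big),\qquad\text{and, if }\eta\le1,\qquad \widetilde f_{ij}^t\ \ge\ \bigotimes_{k=1}^K C_{b/m_i}\big(G_{\Delta/(\eta\sigma)}\big).$$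 -/

import Mathlib

open MeasureTheory ProbabilityTheory

/-! ### Trade-off functions -/

/-- The trade-off function `T(P,Q)`: the infimum of the type II errors `1 - E_Q[φ]` over the
(randomized) rejection rules `φ : Ω → [0,1]` whose type I error `E_P[φ]` is at most `α`.
Trade-off functions are only used on `[0,1]`. -/
noncomputable def tradeOff {Ω : Type*} [MeasurableSpace Ω] (P Q : Measure Ω) (α : ℝ) : ℝ :=
  sInf {β : ℝ | ∃ φ : Ω → ℝ, Measurable φ ∧ (∀ x, φ x ∈ Set.Icc (0 : ℝ) 1) ∧
    ∫ x, φ x ∂P ≤ α ∧ β = 1 - ∫ x, φ x ∂Q}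

/-- `h` is the tensor product `f₁ ⊗ ⋯ ⊗ fₙ` of trade-off functions: `f_k = T(P_k,Q_k)` on `[0,1]`
for probability measures `P_k, Q_k`, and `h = T(P₁ × ⋯ × Pₙ, Q₁ × ⋯ × Qₙ)` on `[0,1]`.
(Every trade-off function is of the form `T(P,Q)` for laws on `ℝ`, and `h` does not depend on the
representing pairs, so that this determines `h` on `[0,1]`.) -/
def IsTradeOffTensor {n : ℕ} (f : Fin n → ℝ → ℝ) (h : ℝ → ℝ) : Prop :=
  ∃ P Q : Fin n → ProbabilityMeasure ℝ,
    (∀ k, Set.EqOn (tradeOff (P k : Measure ℝ) (Q k : Measure ℝ)) (f k) (Set.Icc 0 1)) ∧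
    Set.EqOn h (tradeOff (Measure.pi fun k => (P k : Measure ℝ))
      (Measure.pi fun k => (Q k : Measure ℝ))) (Set.Icc 0 1)

/-- The distribution function `Φ` of the standard normal law on `ℝ`. -/
noncomputable def stdNormalCDF (x : ℝ) : ℝ := cdf (gaussianReal 0 1) x

/-- The quantile function `Φ⁻¹` on `(0,1)`. -/
noncomputable def stdNormalQuantile (p : ℝ) : ℝ := sInf {z : ℝ | p ≤ stdNormalCDF z}

/-- The Gaussian trade-off function `G_μ(α) = Φ(Φ⁻¹(1 - α) - μ)`, with `Φ⁻¹(1) = ∞` and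
`Φ⁻¹(0) = -∞`, that is, `G_μ(0) = 1` and `G_μ(1) = 0`. -/
noncomputable def gaussianTradeOff (μ α : ℝ) : ℝ :=
  if α ≤ 0 then 1
  else if 1 ≤ α then 0
  else stdNormalCDF (stdNormalQuantile (1 - α) - μ)

/-- The convex conjugate `f*(y) = sup_{x ∈ [0,1]} (y x - f(x))` of a function on `[0,1]`
(extended by `+∞` outside `[0,1]`). -/
noncomputable def conjOn01 (f : ℝ → ℝ) (y : ℝ) : ℝ :=
  sSup ((fun x => y * x - f x) '' Set.Icc (0 : ℝ) 1)

/-- The double convex conjugate `f**(x) = sup_{y ∈ ℝ} (x y - f*(y))`, used at `x ∈ [0,1]`. -/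
noncomputable def biconjOn01 (f : ℝ → ℝ) (x : ℝ) : ℝ := ⨆ y : ℝ, (x * y - conjOn01 f y)

/-- The left inverse `f⁻¹(α) = inf {x ∈ [0,1] : f(x) ≤ α}` of a non-increasing function. -/
noncomputable def leftInv01 (f : ℝ → ℝ) (α : ℝ) : ℝ := sInf {x : ℝ | x ∈ Set.Icc (0 : ℝ) 1 ∧ f x ≤ α}

/-- `f_p = p f + (1 - p) Id`, where `Id(x) = 1 - x`. -/
def mixId (p : ℝ) (f : ℝ → ℝ) (x : ℝ) : ℝ := p * f x + (1 - p) * (1 - x)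

/-- The `p`-sampling operator `C_p(f) = (min {f_p, f_p⁻¹})**`. -/
noncomputable def samplingOp (p : ℝ) (f : ℝ → ℝ) : ℝ → ℝ :=
  biconjOn01 fun x => min (mixId p f x) (leftInv01 (mixId p f) x)

/-! ### Decentralized DP-SGD -/

/-- An instance of decentralized DP-SGD with users `V`, records in `Z` and models in `ℝᵈ`.
The dataset of user `v` has `sz v` records. -/
structure DecSGD (V Z : Type*) [Fintype V] [DecidableEq V] (d : ℕ) where
  /-- the transition matrix of the random walk of the model -/
  W : Matrix V V ℝ
  W_stoch : W ∈ Matrix.rowStochastic ℝ V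
  /-- the number of local steps per round -/
  K : ℕ
  K_pos : 1 ≤ K
  /-- the sample size of each user -/
  sz : V → ℕ
  /-- the size of the mini-batches -/
  b : ℕ
  b_pos : 1 ≤ b
  b_le : ∀ v, b ≤ sz v
  /-- the step size -/
  η : ℝ
  η_pos : 0 < η
  /-- the noise level -/
  σ : ℝ
  σ_pos : 0 < σ
  /-- the constraint set (`Set.univ` in the unconstrained case) -/
  constr : Set (EuclideanSpace ℝ (Fin d))
  constr_nonempty : constr.Nonempty
  constr_closed : IsClosed constr
  constr_convex : Convex ℝ constr
  /-- the metric projection onto the constraint set -/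
  proj : EuclideanSpace ℝ (Fin d) → EuclideanSpace ℝ (Fin d)
  proj_mem : ∀ x, proj x ∈ constr
  proj_le : ∀ x, ∀ y ∈ constr, dist x (proj x) ≤ dist x y
  /-- the loss of user `v` at a record and a model -/
  loss : V → Z → EuclideanSpace ℝ (Fin d) → ℝ
  /-- the law of the model with which the first round starts (a point mass for a fixed model) -/
  init : Measure (EuclideanSpace ℝ (Fin d))
  init_prob : IsProbabilityMeasure init

namespace DecSGD

variable {V Z : Type*} [Fintype V] [DecidableEq V] {d : ℕ} (A : DecSGD V Z d)

/-- The local datasets `(D_v)_v` of all users. -/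
abbrev Dataset : Type _ := ∀ v : V, Fin (A.sz v) → Z

/-- Record-level neighbours: `D` and `D'` differ only in one record, and user `i` holds it. -/
def RecordNeighbours (i : V) (D D' : A.Dataset) : Prop :=
  (∀ v, v ≠ i → D v = D' v) ∧ ∃ r, ∀ r', r' ≠ r → D i r' = D' i r'

/-- The mini-batch gradient of user `v` at the records indexed by `S`. -/
noncomputable def batchGrad (v : V) (data : Fin (A.sz v) → Z) (S : Finset (Fin (A.sz v)))
    (θ : EuclideanSpace ℝ (Fin d)) : EuclideanSpace ℝ (Fin d) :=
  (A.b : ℝ)⁻¹ • ∑ r ∈ S, gradient (A.loss v (data r)) θ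

/-- The law of one local step of user `v` from the model `θ`: the mini-batch is a uniformly
random `b`-subset of the records, and the new model is `Π(θ - η (g + N))` with
`N ∼ 𝓝(0, σ² I_d)`. -/
noncomputable def stepLaw (v : V) (data : Fin (A.sz v) → Z) (θ : EuclideanSpace ℝ (Fin d)) :
    Measure (EuclideanSpace ℝ (Fin d)) :=
  ∑ S ∈ (Finset.univ : Finset (Fin (A.sz v))).powersetCard A.b,
    (((A.sz v).choose A.b : ℕ) : ENNReal)⁻¹ •
      (stdGaussian (EuclideanSpace ℝ (Fin d))).map
        (fun N => A.proj (θ - A.η • (A.batchGrad v data S θ + A.σ • N)))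

/-- The law of the model after the `K` local steps of user `v`, if it has law `μ` before. -/
noncomputable def roundLaw (v : V) (data : Fin (A.sz v) → Z)
    (μ : Measure (EuclideanSpace ℝ (Fin d))) : Measure (EuclideanSpace ℝ (Fin d)) :=
  (fun ρ => ρ.bind (A.stepLaw v data))^[A.K] μ

/-- The law of the model after it has been processed by the users `p 0, …, p (t - 1)` in rounds
`0, …, t - 1` and is received by user `p t`, if the datasets in use in round `s` are `𝔻 s`. -/
noncomputable def pathLaw {t : ℕ} (𝔻 : ℕ → A.Dataset) (p : Fin (t + 1) → V) :
    Measure (EuclideanSpace ℝ (Fin d)) :=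
  Fin.foldl t (fun μ s => A.roundLaw (p s.castSucc) (𝔻 s (p s.castSucc)) μ) A.init

/-- The walks from `i` that reach `j` for the first time (after time `0`) at time `t`. -/
def firstHitPaths (i j : V) (t : ℕ) : Finset (Fin (t + 1) → V) :=
  Finset.univ.filter fun p => p 0 = i ∧ p (Fin.last t) = j ∧
    ∀ s : Fin (t + 1), 0 < s → s < Fin.last t → p s ≠ j

/-- The probability that the random walk started at `p 0` follows `p`. -/
def pathWeight {t : ℕ} (p : Fin (t + 1) → V) : ℝ :=
  ∏ s : Fin t, A.W (p s.castSucc) (p s.succ)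

/-- `w_{ij}^t = ℙ[τ_{ij} = t]`, for the hitting time `τ_{ij}` of `j` from `i`. -/
def hitProb (i j : V) (t : ℕ) : ℝ := ∑ p ∈ firstHitPaths i j t, A.pathWeight p

/-- The law of the model that user `j` observes at time `t` for the first time after it started
at user `i` at time `0` (the law given `τ_{ij} = t`), if the datasets in use in round `s` are
`𝔻 s`. The algorithm run on `D` throughout is `𝔻 = fun _ => D`. -/
noncomputable def viewLaw (i j : V) (t : ℕ) (𝔻 : ℕ → A.Dataset) :
    Measure (EuclideanSpace ℝ (Fin d)) :=
  ∑ p ∈ firstHitPaths i j t,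
    ENNReal.ofReal (A.pathWeight p / A.hitProb i j t) • A.pathLaw 𝔻 p

/-- The datasets for the analysis of a single pass through user `i`: the pass itself (round `0`)
uses `D`, all later rounds use `E`. Two runs that are compared have the same `E`, so that only the
current pass is accounted for, even if the walk returns to `i`. If the walk does not return to `i`
and `E` agrees with `D` outside `i`, this is the algorithm on `D`. -/
def singlePass (D E : A.Dataset) : ℕ → A.Dataset := fun s => if s = 0 then D else E

/-- Gradient sensitivity `Δ`: if one record of a mini-batch is replaced, then the mini-batch
gradient of a user changes by at most `Δ`. -/
def GradSensitivity (Δ : ℝ) : Prop :=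
  ∀ (v : V) (z z' : Fin A.b → Z) (k₀ : Fin A.b), (∀ k, k ≠ k₀ → z k = z' k) →
    ∀ θ : EuclideanSpace ℝ (Fin d),
      ‖(A.b : ℝ)⁻¹ • ∑ k, gradient (A.loss v (z k)) θ
        - (A.b : ℝ)⁻¹ • ∑ k, gradient (A.loss v (z' k)) θ‖ ≤ Δ

end DecSGD

/-- A differentiable function with `M`-Lipschitz gradient. -/
def IsSmoothLoss {d : ℕ} (M : ℝ) (f : EuclideanSpace ℝ (Fin d) → ℝ) : Prop :=
  Differentiable ℝ f ∧ ∀ x y, ‖gradient f x - gradient f y‖ ≤ M * ‖x - y‖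

/-- The sequence `b_k`: `b_0 = 0` and
`b_{k+1} = max {c b_k, (1 - γ_{k+1}) (c b_k + s)}`. -/
noncomputable def shiftB (c s : ℝ) (γ : ℕ → ℝ) : ℕ → ℝ
  | 0 => 0
  | k + 1 => max (c * shiftB c s γ k) ((1 - γ (k + 1)) * (c * shiftB c s γ k + s))

/-- The sequence `a_k`, indexed from `1`: `a_{k+1} = γ_{k+1} (c b_k + s)`, given here as a
function of `k`. -/
noncomputable def shiftASucc (c s : ℝ) (γ : ℕ → ℝ) (k : ℕ) : ℝ :=
  γ (k + 1) * (c * shiftB c s γ k + s)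

/-! The bounds are proved by domination of tests: every test of the two views is turned into a test
of the two product laws whose type I error is no larger and whose power is no smaller.

One step. Conditionally on the current model, the uniform mini-batches for the two datasets are
coupled by exchanging one record (`sum_powersetCard_eq_exchange`). Both step laws become averages,
over one index set, of mixtures: with probability 1 - b/m_i the same gradient step ψ₀ is made,
otherwise ψ₁ or ψ₁', and the three centers are pairwise within ηΔ (`StepSplit`). Gaussian noise
makes each such pair a Gaussian trade-off, and `samplingDom_mix` places the resulting error pair
above every affine minorant of min{G_p, G_p⁻¹}. As C_p(G) is the supremum of these minorants and
they are linear in the error pair, the bound survives averaging over the index.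

Composition. `Dominated` speaks of measurably parametrized families of tests, which makes it stable
under adaptive composition: given the current model, the conditional test is replaced by the optimal
test of the same level for a one-dimensional pair, selected measurably in the level
(`IsTradeOffPair`). Such pairs exist because a convex continuous f on [0,1] with f ≥ 0, f(1) = 0 and
f(0) ≤ 1 compares the uniform law with the law of distribution function f(1 - x). The later rounds
and the random path are the same for both runs, so they are absorbed into the test
(`exists_test_viewLaw`). This proves the part without convexity.

Contracting steps. Each run is coupled, through common noise, with a reference run. When the changed
record may matter, the reference center moves by a fraction γ of its displacement from the model, at
most a_k; otherwise the reference makes the same step. Started from one reference model, the two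
reference runs thus have centers at most 2a_k apart, which yields the factors C_p(G(2a_k/(ησ))),
while model and reference stay within b_k (`Mixture.pairLaw_farPairs`). After the pass the two
models are displacements of size at most b_K of a reference model, to be compared for the same
reference value. The remaining (t - 1)K steps contract their difference and the noise of the very
last one hides it (`SmoothTest`), which yields the Gaussian factor. -/

/-! ### Randomized tests -/

/-- A measurable function with values in `[0,1]`. -/
structure IsTest {Ω : Type*} [MeasurableSpace Ω] (φ : Ω → ℝ) : Prop where
  measurable : Measurable φ
  nonneg : ∀ x, 0 ≤ φ x
  le_one : ∀ x, φ x ≤ 1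

namespace IsTest

variable {Ω Ω' Y : Type*} [MeasurableSpace Ω] [MeasurableSpace Ω'] [MeasurableSpace Y]

theorem comp {φ : Ω → ℝ} (h : IsTest φ) {g : Ω' → Ω} (hg : Measurable g) :
    IsTest fun x => φ (g x) :=
  ⟨h.measurable.comp hg, fun _ => h.nonneg _, fun _ => h.le_one _⟩

theorem one_sub {φ : Ω → ℝ} (h : IsTest φ) : IsTest fun x => 1 - φ x :=
  ⟨measurable_const.sub h.measurable, fun x => sub_nonneg.2 (h.le_one x),
    fun x => sub_le_self _ (h.nonneg x)⟩

theorem indicator {s : Set Ω} (hs : MeasurableSet s) : IsTest (s.indicator fun _ => (1 : ℝ)) :=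
  ⟨measurable_const.indicator hs, fun x => Set.indicator_nonneg (fun _ _ => zero_le_one) x,
    fun x => Set.indicator_le_self' (fun _ _ => zero_le_one) x⟩

theorem integrable {φ : Ω → ℝ} (h : IsTest φ) (μ : Measure Ω) [IsFiniteMeasure μ] :
    Integrable φ μ :=
  Integrable.of_bound h.measurable.aestronglyMeasurable 1
    (Filter.Eventually.of_forall fun x => by
      rw [Real.norm_eq_abs, abs_of_nonneg (h.nonneg x)]; exact h.le_one x)

theorem integral_nonneg {φ : Ω → ℝ} (h : IsTest φ) (μ : Measure Ω) : 0 ≤ ∫ x, φ x ∂μ :=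
  MeasureTheory.integral_nonneg h.nonneg

theorem integral_le_one {φ : Ω → ℝ} (h : IsTest φ) (μ : Measure Ω) [IsProbabilityMeasure μ] :
    ∫ x, φ x ∂μ ≤ 1 := by
  have := integral_mono (h.integrable μ) (integrable_const (1 : ℝ)) h.le_one
  simpa using this

theorem integral_one_sub {φ : Ω → ℝ} (h : IsTest φ) (μ : Measure Ω) [IsProbabilityMeasure μ] :
    ∫ x, (1 - φ x) ∂μ = 1 - ∫ x, φ x ∂μ := by
  rw [integral_sub (integrable_const _) (h.integrable μ)]; simp

/-- The conditional rejection probability, given the current state, is again a test, jointly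
measurable in the state and the parameter. This keeps adaptive composition within measurable
families. -/
theorem integral_kernel {φ : Ω' × Y → ℝ} (h : IsTest φ) {κ : Ω → Measure Ω'} (hκ : Measurable κ)
    [∀ ω, IsProbabilityMeasure (κ ω)] :
    IsTest fun p : Ω × Y => ∫ x, φ (x, p.2) ∂κ p.1 := by
  let K : Kernel (Ω × Y) Ω' := ⟨fun p => κ p.1, hκ.comp measurable_fst⟩
  have : IsMarkovKernel K := ⟨fun p => inferInstanceAs (IsProbabilityMeasure (κ p.1))⟩
  refine ⟨?_, fun p => MeasureTheory.integral_nonneg fun x => h.nonneg _, fun p =>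
    (h.comp (measurable_id.prodMk measurable_const)).integral_le_one _⟩
  have : StronglyMeasurable fun q : (Ω × Y) × Ω' => φ (q.2, q.1.2) :=
    (h.measurable.comp (by fun_prop)).stronglyMeasurable
  exact (this.integral_kernel_prod_right' (κ := K)).measurable

theorem integral_kernel' {φ : Ω' → ℝ} (h : IsTest φ) {κ : Ω → Measure Ω'} (hκ : Measurable κ)
    [∀ ω, IsProbabilityMeasure (κ ω)] : IsTest fun ω => ∫ x, φ x ∂κ ω :=
  ((h.comp measurable_fst).integral_kernel (Y := Unit) hκ).comp
    (g := fun ω => (ω, ())) (measurable_id.prodMk measurable_const)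

theorem integral_const_kernel {φ : Ω × Y → ℝ} (h : IsTest φ) (μ : Measure Ω)
    [IsProbabilityMeasure μ] : IsTest fun y => ∫ x, φ (x, y) ∂μ :=
  (h.integral_kernel (Ω := Unit) (κ := fun _ => μ) measurable_const).comp
    (g := fun y => ((), y)) (measurable_const.prodMk measurable_id)

theorem integral_bind {φ : Ω' → ℝ} (h : IsTest φ) {κ : Ω → Measure Ω'} (hκ : Measurable κ)
    [∀ ω, IsProbabilityMeasure (κ ω)] (μ : Measure Ω) [IsProbabilityMeasure μ] :
    ∫ x, φ x ∂(μ.bind κ) = ∫ ω, ∫ x, φ x ∂κ ω ∂μ := by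
  let K : Kernel Ω Ω' := ⟨κ, hκ⟩
  have : IsMarkovKernel K := ⟨fun p => inferInstanceAs (IsProbabilityMeasure (κ p))⟩
  have : IsProbabilityMeasure (μ.bind κ) := inferInstanceAs (IsProbabilityMeasure (K ∘ₘ μ))
  have := Kernel.integral_comp (κ := Kernel.const Unit μ) (η := K) (a := ()) (f := φ)
    (h.integrable _)
  rw [Kernel.comp_apply, Kernel.const_apply] at this
  exact this

theorem integral_prod {φ : Ω × Ω' → ℝ} (h : IsTest φ) (μ : Measure Ω) (ν : Measure Ω')
    [IsProbabilityMeasure μ] [IsProbabilityMeasure ν] :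
    ∫ x, φ x ∂(μ.prod ν) = ∫ x, ∫ y, φ (x, y) ∂ν ∂μ :=
  MeasureTheory.integral_prod _ (h.integrable _)

theorem integral_prod_symm {φ : Ω × Ω' → ℝ} (h : IsTest φ) (μ : Measure Ω) (ν : Measure Ω')
    [IsProbabilityMeasure μ] [IsProbabilityMeasure ν] :
    ∫ x, φ x ∂(μ.prod ν) = ∫ y, ∫ x, φ (x, y) ∂μ ∂ν :=
  MeasureTheory.integral_prod_symm _ (h.integrable _)

end IsTest

theorem isProbabilityMeasure_bind {Ω Ω' : Type*} [MeasurableSpace Ω] [MeasurableSpace Ω']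
    {κ : Ω → Measure Ω'} (hκ : Measurable κ) [∀ ω, IsProbabilityMeasure (κ ω)]
    (μ : Measure Ω) [IsProbabilityMeasure μ] : IsProbabilityMeasure (μ.bind κ) := by
  let K : Kernel Ω Ω' := ⟨κ, hκ⟩
  have : IsMarkovKernel K := ⟨fun p => inferInstanceAs (IsProbabilityMeasure (κ p))⟩
  exact inferInstanceAs (IsProbabilityMeasure (K ∘ₘ μ))

theorem measurable_map_prodMk {Ω Ω' Y : Type*} [MeasurableSpace Ω] [MeasurableSpace Ω']
    [MeasurableSpace Y] {f : Ω → Y → Ω'} (hf : Measurable (Function.uncurry f)) (ν : Measure Y)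
    [SFinite ν] : Measurable fun ω => ν.map (f ω) := by
  refine Measure.measurable_of_measurable_coe _ fun s hs => ?_
  have : (fun ω => ν.map (f ω) s) = fun ω => ν (Prod.mk ω ⁻¹' (Function.uncurry f ⁻¹' s)) := by
    funext ω
    exact Measure.map_apply (hf.comp measurable_prodMk_left) hs
  rw [this]
  exact measurable_measure_prodMk_left (hf hs)

/-! ### Properties of trade-off functions -/

section tradeOff

variable {Ω : Type*} [MeasurableSpace Ω] (P Q : Measure Ω)

theorem tradeOff_le [IsProbabilityMeasure Q] {φ : Ω → ℝ} (h : IsTest φ) {α : ℝ} (hα : ∫ x, φ x ∂P ≤ α) :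
    tradeOff P Q α ≤ 1 - ∫ x, φ x ∂Q := by
  refine csInf_le ⟨0, ?_⟩ ⟨φ, h.measurable, fun x => ⟨h.nonneg x, h.le_one x⟩, hα, rfl⟩
  rintro β ⟨ψ, hψ, hψ', -, rfl⟩
  exact sub_nonneg.2 (IsTest.integral_le_one ⟨hψ, fun x => (hψ' x).1, fun x => (hψ' x).2⟩ Q)

theorem le_tradeOff {α c : ℝ} (hα : 0 ≤ α)
    (h : ∀ φ : Ω → ℝ, IsTest φ → ∫ x, φ x ∂P ≤ α → c ≤ 1 - ∫ x, φ x ∂Q) :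
    c ≤ tradeOff P Q α := by
  refine le_csInf ⟨_, 0, measurable_const, fun x => by simp, by simpa using hα, rfl⟩ ?_
  rintro β ⟨ψ, hψ, hψ', hψα, rfl⟩
  exact h ψ ⟨hψ, fun x => (hψ' x).1, fun x => (hψ' x).2⟩ hψα

end tradeOff

/-! ### The standard normal distribution function -/

theorem stdNormalCDF_nonneg (x : ℝ) : 0 ≤ stdNormalCDF x := cdf_nonneg _ _

theorem stdNormalCDF_le_one (x : ℝ) : stdNormalCDF x ≤ 1 := cdf_le_one _ _

theorem stdNormalCDF_mono : Monotone stdNormalCDF := monotone_cdf _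

theorem stdNormalCDF_eq (x : ℝ) : stdNormalCDF x = (gaussianReal 0 1).real (Set.Iic x) :=
  cdf_eq_real _ _

theorem tendsto_stdNormalCDF_atTop : Filter.Tendsto stdNormalCDF Filter.atTop (nhds 1) :=
  tendsto_cdf_atTop _

theorem tendsto_stdNormalCDF_atBot : Filter.Tendsto stdNormalCDF Filter.atBot (nhds 0) :=
  tendsto_cdf_atBot _

theorem gaussianReal_real_Ioi (μ z : ℝ) :
    (gaussianReal μ 1).real (Set.Ioi z) = 1 - stdNormalCDF (z - μ) := by
  have h : gaussianReal μ 1 = (gaussianReal 0 1).map (fun x => x + μ) := by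
    rw [gaussianReal_map_add_const, zero_add]
  have h2 : (fun x : ℝ => x + μ) ⁻¹' Set.Ioi z = (Set.Iic (z - μ))ᶜ := by
    ext x; simp [sub_lt_iff_lt_add]
  rw [h, map_measureReal_apply (by fun_prop) measurableSet_Ioi, h2,
    probReal_compl_eq_one_sub measurableSet_Iic, stdNormalCDF_eq]

theorem continuous_stdNormalCDF : Continuous stdNormalCDF := by
  have hna := nullSingletonClass_gaussianReal (μ := 0) (v := 1) one_ne_zero
  rw [continuous_iff_continuousAt]
  intro x
  have hr := (cdf (gaussianReal 0 1)).right_continuous x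
  refine (stdNormalCDF_mono.continuousAt_iff_leftLim_eq_rightLim).2 ?_
  have hs := (cdf (gaussianReal 0 1)).measure_singleton x
  rw [measure_cdf, measure_singleton] at hs
  have h1 : stdNormalCDF x - Function.leftLim stdNormalCDF x ≤ 0 := ENNReal.ofReal_eq_zero.1 hs.symm
  have h2 : Function.rightLim stdNormalCDF x = stdNormalCDF x :=
    (cdf (gaussianReal 0 1)).rightLim_eq x
  rw [h2]
  exact le_antisymm (stdNormalCDF_mono.leftLim_le le_rfl) (by linarith)

theorem stdNormalQuantile_set {p : ℝ} (hp : p ∈ Set.Ioo (0 : ℝ) 1) :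
    {z : ℝ | p ≤ stdNormalCDF z}.Nonempty ∧ BddBelow {z : ℝ | p ≤ stdNormalCDF z} := by
  constructor
  · exact ((tendsto_stdNormalCDF_atTop.eventually (lt_mem_nhds hp.2)).exists).imp fun _ h => h.le
  · obtain ⟨z, hz⟩ := (tendsto_stdNormalCDF_atBot.eventually (gt_mem_nhds hp.1)).exists
    exact ⟨z, fun w hw => le_of_not_gt fun h =>
      absurd (lt_of_le_of_lt (hw.trans (stdNormalCDF_mono h.le)) hz) (lt_irrefl _)⟩

theorem stdNormalCDF_quantile {p : ℝ} (hp : p ∈ Set.Ioo (0 : ℝ) 1) :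
    stdNormalCDF (stdNormalQuantile p) = p := by
  obtain ⟨hne, hbb⟩ := stdNormalQuantile_set hp
  have hcl : IsClosed {z : ℝ | p ≤ stdNormalCDF z} :=
    isClosed_le continuous_const continuous_stdNormalCDF
  refine le_antisymm (le_of_forall_pos_lt_add fun ε hε => ?_) (hcl.csInf_mem hne hbb)
  have hc := continuous_stdNormalCDF.continuousAt (x := stdNormalQuantile p)
  obtain ⟨δ, hδ, h⟩ := Metric.continuousAt_iff.1 hc ε hε
  have h1 := h (x := stdNormalQuantile p - δ / 2) (by
    rw [Real.dist_eq]; rw [abs_lt]; constructor <;> linarith)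
  have h2 : stdNormalCDF (stdNormalQuantile p - δ / 2) < p := by
    by_contra hcon
    have : stdNormalQuantile p ≤ stdNormalQuantile p - δ / 2 := csInf_le hbb (not_lt.1 hcon)
    linarith
  rw [Real.dist_eq, abs_lt] at h1
  linarith [h1.1]

theorem stdNormalQuantile_mono : MonotoneOn stdNormalQuantile (Set.Ioo 0 1) := fun _ hp _ hq h =>
  csInf_le_csInf (stdNormalQuantile_set hp).2 (stdNormalQuantile_set hq).1 fun _ hz => h.trans hz

/-! ### Gaussian trade-off functions -/

theorem gaussianTradeOff_of_mem {μ α : ℝ} (hα : α ∈ Set.Ioo (0 : ℝ) 1) :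
    gaussianTradeOff μ α = stdNormalCDF (stdNormalQuantile (1 - α) - μ) := by
  rw [gaussianTradeOff, if_neg (not_le.2 hα.1), if_neg (not_le.2 hα.2)]

theorem gaussianTradeOff_of_nonpos {μ α : ℝ} (hα : α ≤ 0) : gaussianTradeOff μ α = 1 := if_pos hα

theorem gaussianTradeOff_of_one_le {μ α : ℝ} (hα : 1 ≤ α) : gaussianTradeOff μ α = 0 := by
  rw [gaussianTradeOff, if_neg (by linarith), if_pos hα]

theorem one_sub_mem_Ioo {α : ℝ} (hα : α ∈ Set.Ioo (0 : ℝ) 1) : 1 - α ∈ Set.Ioo (0 : ℝ) 1 :=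
  ⟨by linarith [hα.2], by linarith [hα.1]⟩

theorem gaussianTradeOff_nonneg (μ α : ℝ) : 0 ≤ gaussianTradeOff μ α := by
  unfold gaussianTradeOff
  split_ifs
  exacts [zero_le_one, le_rfl, stdNormalCDF_nonneg _]

theorem gaussianTradeOff_le_one (μ α : ℝ) : gaussianTradeOff μ α ≤ 1 := by
  unfold gaussianTradeOff
  split_ifs
  exacts [le_rfl, zero_le_one, stdNormalCDF_le_one _]

theorem gaussianTradeOff_antitone (μ : ℝ) : Antitone (gaussianTradeOff μ) := by
  intro α α' h
  rcases le_or_gt α 0 with h0 | h0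
  · rw [gaussianTradeOff_of_nonpos h0]; exact gaussianTradeOff_le_one _ _
  rcases le_or_gt 1 α' with h1 | h1
  · rw [gaussianTradeOff_of_one_le h1]; exact gaussianTradeOff_nonneg _ _
  have hα : α ∈ Set.Ioo (0 : ℝ) 1 := ⟨h0, by linarith⟩
  have hα' : α' ∈ Set.Ioo (0 : ℝ) 1 := ⟨by linarith, h1⟩
  rw [gaussianTradeOff_of_mem hα, gaussianTradeOff_of_mem hα']
  have := stdNormalQuantile_mono (one_sub_mem_Ioo hα') (one_sub_mem_Ioo hα) (by linarith)
  exact stdNormalCDF_mono (by linarith)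

theorem gaussianTradeOff_antitone_left (α : ℝ) : Antitone fun μ => gaussianTradeOff μ α := by
  intro μ μ' h
  show gaussianTradeOff μ' α ≤ gaussianTradeOff μ α
  unfold gaussianTradeOff
  split_ifs
  · rfl
  · rfl
  · exact stdNormalCDF_mono (by linarith)

theorem gaussianTradeOff_le_one_sub {μ α : ℝ} (hμ : 0 ≤ μ) (h1 : α ≤ 1) (h0 : 0 ≤ α) :
    gaussianTradeOff μ α ≤ 1 - α := by
  rcases h0.eq_or_lt with rfl | h0
  · simpa using gaussianTradeOff_le_one _ _
  rcases h1.eq_or_lt with rfl | h1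
  · simp [gaussianTradeOff_of_one_le]
  rw [gaussianTradeOff_of_mem ⟨h0, h1⟩]
  exact (stdNormalCDF_mono (by linarith)).trans
    (stdNormalCDF_quantile (one_sub_mem_Ioo ⟨h0, h1⟩)).le

/-- The point `(α, 1 - β)` lies above all the supporting lines of `G_μ`. -/
def GaussianDom (μ α β : ℝ) : Prop :=
  ∀ z : ℝ, β - Real.exp (μ * z - μ ^ 2 / 2) * α ≤
    (1 - stdNormalCDF (z - μ)) - Real.exp (μ * z - μ ^ 2 / 2) * (1 - stdNormalCDF z)

/-- The Neyman-Pearson lemma for `𝓝(0, 1)` and `𝓝(μ, 1)`. -/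
theorem gaussianDom_integral {μ : ℝ} (hμ : 0 ≤ μ) {φ : ℝ → ℝ} (h : IsTest φ) :
    GaussianDom μ (∫ x, φ x ∂gaussianReal 0 1) (∫ x, φ x ∂gaussianReal μ 1) := by
  intro z
  set k := Real.exp (μ * z - μ ^ 2 / 2) with hk
  have hpdf : ∀ x, gaussianPDFReal μ 1 x = gaussianPDFReal 0 1 x * Real.exp (μ * x - μ ^ 2 / 2) := by
    intro x
    simp only [gaussianPDFReal_def, mul_assoc, ← Real.exp_add]
    congr 2
    simp; ring
  have hint : ∀ (ν : ℝ) {ψ : ℝ → ℝ}, IsTest ψ → Integrable fun x => gaussianPDFReal ν 1 x * ψ x := by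
    intro ν ψ hψ
    refine (integrable_gaussianPDFReal ν 1).mul_bdd (c := 1) hψ.measurable.aestronglyMeasurable
      (Filter.Eventually.of_forall fun x => ?_)
    rw [Real.norm_eq_abs, abs_of_nonneg (hψ.nonneg x)]; exact hψ.le_one x
  have hlin : ∀ {ψ : ℝ → ℝ}, IsTest ψ → (∫ x, ψ x ∂gaussianReal μ 1) - k * ∫ x, ψ x ∂gaussianReal 0 1
      = ∫ x, ψ x * (gaussianPDFReal 0 1 x * (Real.exp (μ * x - μ ^ 2 / 2) - k)) := by
    intro ψ hψ
    rw [integral_gaussianReal_eq_integral_smul one_ne_zero,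
      integral_gaussianReal_eq_integral_smul one_ne_zero, ← integral_const_mul]
    simp only [smul_eq_mul]
    rw [← integral_sub (hint μ hψ) ((hint 0 hψ).const_mul k)]
    refine integral_congr_ae (Filter.Eventually.of_forall fun x => ?_)
    simp only [hpdf]; ring
  have hB : IsTest ((Set.Ioi z).indicator fun _ => (1 : ℝ)) := IsTest.indicator measurableSet_Ioi
  have hBi : ∀ ν : ℝ, ∫ x, (Set.Ioi z).indicator (fun _ => (1 : ℝ)) x ∂gaussianReal ν 1
      = 1 - stdNormalCDF (z - ν) := by
    intro ν
    rw [integral_indicator_const _ measurableSet_Ioi, gaussianReal_real_Ioi]; simp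
  have hI : ∀ {ψ : ℝ → ℝ}, IsTest ψ → Integrable fun x =>
      ψ x * (gaussianPDFReal 0 1 x * (Real.exp (μ * x - μ ^ 2 / 2) - k)) := by
    intro ψ hψ
    refine ((hint μ hψ).sub ((hint 0 hψ).const_mul k)).congr
      (Filter.Eventually.of_forall fun x => ?_)
    simp only [hpdf, Pi.sub_apply]; ring
  have h1 := hBi μ
  have h0 := hBi 0
  rw [sub_zero] at h0
  rw [← h1, ← h0, hlin h, hlin hB]
  refine integral_mono (hI h) (hI hB) fun x => ?_
  have hp := gaussianPDFReal_nonneg 0 1 x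
  by_cases hx : z < x
  · have : k ≤ Real.exp (μ * x - μ ^ 2 / 2) := Real.exp_le_exp.2 (by nlinarith)
    simp only [Set.indicator, Set.mem_Ioi, hx, if_true]
    exact mul_le_mul_of_nonneg_right (h.le_one x) (mul_nonneg hp (by linarith))
  · have : Real.exp (μ * x - μ ^ 2 / 2) ≤ k := Real.exp_le_exp.2 (by nlinarith [not_lt.1 hx])
    simp only [Set.indicator, Set.mem_Ioi, hx, if_false]
    rw [zero_mul]
    exact mul_nonpos_of_nonneg_of_nonpos (h.nonneg x)
      (mul_nonpos_of_nonneg_of_nonpos hp (by linarith))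

/-- For 0 < α < 1 the supporting line at the threshold z = Φ⁻¹(1 - α) touches the graph at α, so it
suffices. At α = 0 the threshold is sent to infinity. -/
theorem GaussianDom.le_one_sub {μ α β : ℝ} (h : GaussianDom μ α β) (h0 : 0 ≤ α) (hβ : β ≤ 1) :
    gaussianTradeOff μ α ≤ 1 - β := by
  rcases le_or_gt 1 α with h1 | h1
  · rw [gaussianTradeOff_of_one_le h1]; linarith
  rcases h0.eq_or_lt with rfl | h0
  · rw [gaussianTradeOff_of_nonpos le_rfl]
    have hz : ∀ z, β ≤ 1 - stdNormalCDF (z - μ) := fun z => by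
      have := h z
      have h2 : 0 ≤ Real.exp (μ * z - μ ^ 2 / 2) * (1 - stdNormalCDF z) :=
        mul_nonneg (Real.exp_pos _).le (sub_nonneg.2 (stdNormalCDF_le_one _))
      linarith
    have ht : Filter.Tendsto (fun z => 1 - stdNormalCDF (z - μ)) Filter.atTop (nhds (1 - 1)) :=
      tendsto_const_nhds.sub (tendsto_stdNormalCDF_atTop.comp
        (Filter.tendsto_atTop_add_const_right _ (-μ) Filter.tendsto_id))
    have := ge_of_tendsto' ht hz
    linarith
  · have := h (stdNormalQuantile (1 - α))
    rw [gaussianTradeOff_of_mem ⟨h0, h1⟩]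
    rw [stdNormalCDF_quantile (one_sub_mem_Ioo ⟨h0, h1⟩)] at this
    linarith

/-- A most powerful test of `𝓝(0, 1)` against `𝓝(μ, 1)` of level `α`. -/
noncomputable def gaussianTest (α x : ℝ) : ℝ :=
  if α ≤ 0 then 0 else if 1 - α ≤ stdNormalCDF x then 1 else 0

theorem isTest_gaussianTest : IsTest (Function.uncurry gaussianTest) := by
  refine ⟨?_, fun p => ?_, fun p => ?_⟩
  · refine Measurable.ite (measurableSet_le measurable_fst measurable_const) measurable_const
      (Measurable.ite (measurableSet_le (measurable_const.sub measurable_fst)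
        (continuous_stdNormalCDF.measurable.comp measurable_snd)) measurable_const measurable_const)
  all_goals
    simp only [Function.uncurry, gaussianTest]
    split_ifs <;> norm_num

theorem isTest_gaussianTest_right (α : ℝ) : IsTest (gaussianTest α) :=
  isTest_gaussianTest.comp (g := fun x => (α, x)) (measurable_const.prodMk measurable_id)

theorem stdNormalQuantile_le_iff {p x : ℝ} (hp : p ∈ Set.Ioo (0 : ℝ) 1) :
    stdNormalQuantile p ≤ x ↔ p ≤ stdNormalCDF x :=
  ⟨fun h => (stdNormalCDF_quantile hp).symm.le.trans (stdNormalCDF_mono h),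
    fun h => csInf_le (stdNormalQuantile_set hp).2 h⟩

theorem integral_gaussianTest (μ α : ℝ) :
    ∫ x, gaussianTest α x ∂gaussianReal μ 1 = 1 - gaussianTradeOff μ α := by
  rcases le_or_gt α 0 with h0 | h0
  · simp [gaussianTest, gaussianTradeOff_of_nonpos, h0]
  rcases le_or_gt 1 α with h1 | h1
  · have : ∀ x, gaussianTest α x = 1 := fun x => by
      rw [gaussianTest, if_neg (not_le.2 h0), if_pos (by linarith [stdNormalCDF_nonneg x])]
    simp [this, gaussianTradeOff_of_one_le h1]
  have hα : 1 - α ∈ Set.Ioo (0 : ℝ) 1 := one_sub_mem_Ioo ⟨h0, h1⟩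
  have : gaussianTest α = (Set.Ici (stdNormalQuantile (1 - α))).indicator fun _ => (1 : ℝ) := by
    funext x
    simp only [gaussianTest, not_le.2 h0, if_false, Set.indicator, Set.mem_Ici,
      stdNormalQuantile_le_iff hα]
  have hna := nullSingletonClass_gaussianReal (μ := μ) (v := 1) one_ne_zero
  rw [this, integral_indicator_const _ measurableSet_Ici, measureReal_congr Ioi_ae_eq_Ici.symm,
    gaussianReal_real_Ioi, gaussianTradeOff_of_mem ⟨h0, h1⟩]
  simp

theorem gaussianTradeOff_zero {α : ℝ} (h0 : 0 ≤ α) (h1 : α ≤ 1) : gaussianTradeOff 0 α = 1 - α := by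
  rcases h0.eq_or_lt with rfl | h0
  · simp [gaussianTradeOff_of_nonpos]
  rcases h1.eq_or_lt with rfl | h1
  · simp [gaussianTradeOff_of_one_le]
  rw [gaussianTradeOff_of_mem ⟨h0, h1⟩, sub_zero, stdNormalCDF_quantile (one_sub_mem_Ioo ⟨h0, h1⟩)]

theorem integral_gaussianTest_zero {α : ℝ} (h0 : 0 ≤ α) (h1 : α ≤ 1) :
    ∫ x, gaussianTest α x ∂gaussianReal 0 1 = α := by
  rw [integral_gaussianTest, gaussianTradeOff_zero h0 h1]; ring

/-- The optimal test of level α attains (α, 1 - G_μ(α)), which satisfies the linear inequalities by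
Neyman-Pearson, and lowering β preserves them. Together with `GaussianDom.le_one_sub` this replaces
the trade-off inequality by conditions linear in (α, β). -/
theorem gaussianDom_of_le {μ α β : ℝ} (hμ : 0 ≤ μ) (h0 : 0 ≤ α) (h1 : α ≤ 1)
    (h : gaussianTradeOff μ α ≤ 1 - β) : GaussianDom μ α β := by
  intro z
  have := gaussianDom_integral hμ (isTest_gaussianTest_right α) z
  rw [integral_gaussianTest_zero h0 h1, integral_gaussianTest] at this
  linarith

/-- Gaussian trade-off functions are convex: pointwise bounds pass to averages. -/
theorem gaussianTradeOff_integral_le {Ω : Type*} [MeasurableSpace Ω] (ν : Measure Ω)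
    [IsProbabilityMeasure ν] {μ : ℝ} (hμ : 0 ≤ μ) {α β : Ω → ℝ} (hα : IsTest α) (hβ : IsTest β)
    (h : ∀ ω, gaussianTradeOff μ (α ω) ≤ 1 - β ω) :
    gaussianTradeOff μ (∫ ω, α ω ∂ν) ≤ 1 - ∫ ω, β ω ∂ν := by
  refine GaussianDom.le_one_sub (fun z => ?_) (hα.integral_nonneg ν) (hβ.integral_le_one ν)
  rw [← integral_const_mul, ← integral_sub (hβ.integrable ν) ((hα.integrable ν).const_mul _)]
  have := integral_mono ((hβ.integrable ν).sub ((hα.integrable ν).const_mul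
    (Real.exp (μ * z - μ ^ 2 / 2)))) (integrable_const ((1 - stdNormalCDF (z - μ)) -
    Real.exp (μ * z - μ ^ 2 / 2) * (1 - stdNormalCDF z))) fun ω =>
      gaussianDom_of_le hμ (hα.nonneg ω) (hα.le_one ω) (h ω) z
  simpa using this

/-! ### Gaussian shifts in Euclidean space -/

/-- With the other coordinates frozen this is the one-dimensional Neyman-Pearson bound; convexity of
the Gaussian trade-off function lets it be averaged over them. -/
theorem gaussianTradeOff_shift_single {n : ℕ} {r : ℝ} (hr : 0 ≤ r)
    {φ : EuclideanSpace ℝ (Fin (n + 1)) → ℝ} (h : IsTest φ) :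
    gaussianTradeOff r (∫ x, φ x ∂stdGaussian (EuclideanSpace ℝ (Fin (n + 1)))) ≤
      1 - ∫ x, φ (x + EuclideanSpace.single 0 r) ∂stdGaussian (EuclideanSpace ℝ (Fin (n + 1))) := by
  have key : ∀ {ψ : EuclideanSpace ℝ (Fin (n + 1)) → ℝ}, IsTest ψ →
      ∫ x, ψ x ∂stdGaussian (EuclideanSpace ℝ (Fin (n + 1))) =
        ∫ y, ∫ a, ψ (WithLp.toLp 2 (Fin.cons a y)) ∂gaussianReal 0 1
          ∂(Measure.pi fun _ : Fin n => gaussianReal 0 1) := by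
    intro ψ hψ
    have mp := (measurePreserving_piFinSuccAbove
      (fun _ : Fin (n + 1) => gaussianReal 0 1) 0).symm
    have ht : Measurable (WithLp.toLp 2 : (Fin (n + 1) → ℝ) → EuclideanSpace ℝ (Fin (n + 1))) := by
      fun_prop
    rw [← map_pi_eq_stdGaussian, integral_map ht.aemeasurable
      hψ.measurable.aestronglyMeasurable,
      ← mp.integral_comp' (g := fun y => ψ (WithLp.toLp 2 y))]
    have he : ∀ (a : ℝ) (y : Fin n → ℝ),
        (MeasurableEquiv.piFinSuccAbove (fun _ : Fin (n + 1) => ℝ) 0).symm (a, y) = Fin.cons a y :=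
      fun a y => Fin.insertNth_zero' a y
    simp only [← he]
    exact ((hψ.comp ht).comp mp.measurable).integral_prod_symm (gaussianReal 0 1)
      (Measure.pi fun _ : Fin n => gaussianReal 0 1)
  have hs : ∀ a (y : Fin n → ℝ), (WithLp.toLp 2 (Fin.cons a y) : EuclideanSpace ℝ (Fin (n + 1)))
      + EuclideanSpace.single 0 r = WithLp.toLp 2 (Fin.cons (a + r) y) := by
    intro a y
    ext i
    refine Fin.cases ?_ (fun i => ?_) i <;> simp
  have hm : Measurable fun p : (Fin n → ℝ) × ℝ =>
      (WithLp.toLp 2 (Fin.cons p.2 p.1) : EuclideanSpace ℝ (Fin (n + 1))) := by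
    have : Measurable fun p : (Fin n → ℝ) × ℝ => (Fin.cons p.2 p.1 : Fin (n + 1) → ℝ) := by
      refine measurable_pi_lambda _ fun i => ?_
      refine Fin.cases ?_ (fun i => ?_) i
      · exact measurable_snd
      · exact (measurable_pi_apply i).comp measurable_fst
    fun_prop
  have hφ' : IsTest fun x : EuclideanSpace ℝ (Fin (n + 1)) => φ (x + EuclideanSpace.single 0 r) :=
    h.comp (by fun_prop)
  rw [key h, key hφ']
  have hc : ∀ y : Fin n → ℝ, IsTest fun a : ℝ =>
      φ (WithLp.toLp 2 (Fin.cons a y) : EuclideanSpace ℝ (Fin (n + 1))) := fun y =>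
    h.comp (hm.comp (measurable_const.prodMk measurable_id))
  refine gaussianTradeOff_integral_le _ hr ?_ ?_ fun y => ?_
  · exact (h.comp (hm.comp measurable_swap)).integral_const_kernel _
  · exact (hφ'.comp (hm.comp measurable_swap)).integral_const_kernel _
  · simp only [hs]
    have := gaussianDom_integral hr (hc y)
    rw [← zero_add r, ← gaussianReal_map_add_const, integral_map (by fun_prop)
      (hc y).measurable.aestronglyMeasurable, zero_add] at this
    exact this.le_one_sub ((hc y).integral_nonneg _)
      ((hc y).comp (by fun_prop : Measurable fun a : ℝ => a + r) |>.integral_le_one _)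

/-- The standard Gaussian law is invariant under the reflection that carries ‖h‖ e₀ to h, so the
shift may be assumed to lie along the first axis. -/
theorem gaussianTradeOff_shift {d : ℕ} (h : EuclideanSpace ℝ (Fin d))
    {φ : EuclideanSpace ℝ (Fin d) → ℝ} (hφ : IsTest φ) :
    gaussianTradeOff ‖h‖ (∫ x, φ x ∂stdGaussian (EuclideanSpace ℝ (Fin d))) ≤
      1 - ∫ x, φ (x + h) ∂stdGaussian (EuclideanSpace ℝ (Fin d)) := by
  cases d with
  | zero =>
    have hz : h = 0 := Subsingleton.elim _ _
    subst hz
    simp only [add_zero, norm_zero]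
    exact (gaussianTradeOff_zero (hφ.integral_nonneg _) (hφ.integral_le_one _)).le
  | succ n =>
    have hn : ‖(EuclideanSpace.single 0 ‖h‖ : EuclideanSpace ℝ (Fin (n + 1)))‖ = ‖h‖ := by simp
    set R := ((ℝ ∙ ((EuclideanSpace.single 0 ‖h‖ : EuclideanSpace ℝ (Fin (n + 1))) - h))ᗮ).reflection
    have hR : R (EuclideanSpace.single 0 ‖h‖) = h := Submodule.reflection_sub hn
    have hRm : Measurable R := R.continuous.measurable
    have := gaussianTradeOff_shift_single (norm_nonneg h) (hφ.comp hRm)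
    have e1 : ∀ {ψ : EuclideanSpace ℝ (Fin (n + 1)) → ℝ}, IsTest ψ →
        ∫ x, ψ (R x) ∂stdGaussian (EuclideanSpace ℝ (Fin (n + 1))) =
          ∫ x, ψ x ∂stdGaussian (EuclideanSpace ℝ (Fin (n + 1))) := by
      intro ψ hψ
      conv_rhs => rw [← stdGaussian_map R, integral_map hRm.aemeasurable
        hψ.measurable.aestronglyMeasurable]
    simp only [map_add, hR] at this
    rwa [e1 hφ, e1 (hφ.comp (by fun_prop : Measurable fun x => x + h))] at this

/-- Two Gaussian laws with covariance `s² I` and centers at distance at most `s r`. -/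
theorem gaussianTradeOff_le_of_dist {d : ℕ} {s r : ℝ} (hs : 0 < s) {u u' : EuclideanSpace ℝ (Fin d)}
    (hu : ‖u - u'‖ ≤ s * r) {φ : EuclideanSpace ℝ (Fin d) → ℝ} (hφ : IsTest φ) :
    gaussianTradeOff r (∫ x, φ (u - s • x) ∂stdGaussian (EuclideanSpace ℝ (Fin d))) ≤
      1 - ∫ x, φ (u' - s • x) ∂stdGaussian (EuclideanSpace ℝ (Fin d)) := by
  have := gaussianTradeOff_shift (s⁻¹ • (u - u')) (hφ.comp (by fun_prop : Measurable
    fun x : EuclideanSpace ℝ (Fin d) => u - s • x))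
  have e : ∀ x : EuclideanSpace ℝ (Fin d), u - s • (x + s⁻¹ • (u - u')) = u' - s • x := by
    intro x
    rw [smul_add, smul_smul, mul_inv_cancel₀ hs.ne', one_smul]; abel
  simp only [e] at this
  refine (gaussianTradeOff_antitone_left _ ?_).trans this
  rw [norm_smul, Real.norm_eq_abs, abs_of_pos (inv_pos.2 hs), inv_mul_le_iff₀ hs]
  exact hu

/-! ### Pairs of laws with a prescribed trade-off function -/

/-- `f = T(P, Q)` on `[0,1]`, where optimal tests of all levels can be chosen measurably. -/
def IsTradeOffPair (f : ℝ → ℝ) (P Q : ProbabilityMeasure ℝ) : Prop :=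
  Set.EqOn (tradeOff (P : Measure ℝ) (Q : Measure ℝ)) f (Set.Icc 0 1) ∧
  ∃ Ψ : ℝ → ℝ → ℝ, IsTest (Function.uncurry Ψ) ∧ ∀ α ∈ Set.Icc (0 : ℝ) 1,
    ∫ x, Ψ α x ∂(P : Measure ℝ) ≤ α ∧ 1 - f α ≤ ∫ x, Ψ α x ∂(Q : Measure ℝ)

/-- The family Ψ bounds the trade-off function from above. The bound for arbitrary tests is stated
at their exact level, and monotonicity of f transfers it to every larger α. -/
theorem isTradeOffPair_of_tests {f : ℝ → ℝ} (hf : AntitoneOn f (Set.Icc 0 1))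
    {P Q : ProbabilityMeasure ℝ} {Ψ : ℝ → ℝ → ℝ} (hΨ : IsTest (Function.uncurry Ψ))
    (h1 : ∀ α ∈ Set.Icc (0 : ℝ) 1,
      ∫ x, Ψ α x ∂(P : Measure ℝ) ≤ α ∧ 1 - f α ≤ ∫ x, Ψ α x ∂(Q : Measure ℝ))
    (h2 : ∀ φ : ℝ → ℝ, IsTest φ →
      f (∫ x, φ x ∂(P : Measure ℝ)) ≤ 1 - ∫ x, φ x ∂(Q : Measure ℝ)) :
    IsTradeOffPair f P Q := by
  refine ⟨fun α hα => le_antisymm ?_ ?_, Ψ, hΨ, h1⟩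
  · have hT : IsTest (Ψ α) :=
      hΨ.comp (g := fun x => (α, x)) (measurable_const.prodMk measurable_id)
    exact (tradeOff_le _ _ hT (h1 α hα).1).trans (by linarith [(h1 α hα).2])
  · refine le_tradeOff _ _ hα.1 fun φ hφ hφα => (hf ?_ hα hφα).trans (h2 φ hφ)
    exact ⟨hφ.integral_nonneg _, hφ.integral_le_one _⟩

theorem isTradeOffPair_gaussian {μ : ℝ} (hμ : 0 ≤ μ) :
    IsTradeOffPair (gaussianTradeOff μ) ⟨gaussianReal 0 1, inferInstance⟩
      ⟨gaussianReal μ 1, inferInstance⟩ := by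
  refine isTradeOffPair_of_tests ((gaussianTradeOff_antitone μ).antitoneOn _) isTest_gaussianTest
    (fun α hα => ⟨(integral_gaussianTest_zero hα.1 hα.2).le, (integral_gaussianTest μ α).ge⟩)
    fun φ hφ => ?_
  exact (gaussianDom_integral hμ hφ).le_one_sub (hφ.integral_nonneg _) (hφ.integral_le_one _)

/-- The Stieltjes function `x ↦ x` on `[0,1]`, constant outside. -/
noncomputable def uniformStieltjes : StieltjesFunction ℝ where
  toFun x := max 0 (min x 1)
  mono' := fun _ _ h => max_le_max le_rfl (min_le_min h le_rfl)
  right_continuous' x := (by fun_prop : Continuous fun x : ℝ => max 0 (min x 1)).continuousWithinAt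

theorem clamp_mem (x : ℝ) : max 0 (min x 1) ∈ Set.Icc (0 : ℝ) 1 :=
  ⟨le_max_left _ _, max_le zero_le_one (min_le_right _ _)⟩

theorem clamp_eq {x : ℝ} (hx : x ∈ Set.Icc (0 : ℝ) 1) : max 0 (min x 1) = x := by
  rw [min_eq_left hx.2, max_eq_right hx.1]

theorem tendsto_clamp_atTop {f : ℝ → ℝ} :
    Filter.Tendsto (fun x => f (max 0 (min x 1))) Filter.atTop (nhds (f 1)) :=
  tendsto_const_nhds.congr' ((Filter.eventually_ge_atTop 1).mono fun x hx => by simp [min_eq_right hx])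

theorem tendsto_clamp_atBot {f : ℝ → ℝ} :
    Filter.Tendsto (fun x => f (max 0 (min x 1))) Filter.atBot (nhds (f 0)) :=
  tendsto_const_nhds.congr' ((Filter.eventually_le_atBot 0).mono fun x hx => by
    simp only [max_eq_left ((min_le_left x 1).trans hx)])

/-! ### Convex functions realized as trade-off functions -/

section convex

variable {f : ℝ → ℝ}

theorem antitoneOn_of_convexOn (hc : ConvexOn ℝ (Set.Icc 0 1) f)
    (h0 : ∀ x ∈ Set.Icc (0 : ℝ) 1, 0 ≤ f x) (h1 : f 1 = 0) : AntitoneOn f (Set.Icc 0 1) := by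
  intro x hx y hy hxy
  have := hc.le_max_of_mem_Icc hx (Set.right_mem_Icc.2 zero_le_one) (z := y) ⟨hxy, hy.2⟩
  rwa [h1, max_eq_left (h0 x hx)] at this

/-- The distribution function `x ↦ f(1 - x)` of the alternative, without the atom at `1`. -/
noncomputable def tradeOffStieltjes (hf : ContinuousOn f (Set.Icc 0 1))
    (ha : AntitoneOn f (Set.Icc 0 1)) : StieltjesFunction ℝ where
  toFun x := f (1 - max 0 (min x 1))
  mono' := fun x y h => by
    have hx := clamp_mem x
    have hy := clamp_mem y
    refine ha ⟨by linarith [hy.2], by linarith [hy.1]⟩ ⟨by linarith [hx.2], by linarith [hx.1]⟩ ?_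
    exact sub_le_sub_left (max_le_max le_rfl (min_le_min h le_rfl)) _
  right_continuous' x := by
    have : Continuous fun x : ℝ => f (1 - max 0 (min x 1)) := by
      refine hf.comp_continuous (by fun_prop) fun x => ?_
      have hx := clamp_mem x
      exact ⟨by linarith [hx.2], by linarith [hx.1]⟩
    exact this.continuousWithinAt

theorem unimodal_of_convexOn {h : ℝ → ℝ} (hc : ConvexOn ℝ (Set.Icc 0 1) h) {x₀ : ℝ}
    (hx₀ : x₀ ∈ Set.Icc (0 : ℝ) 1) (hmin : ∀ x ∈ Set.Icc (0 : ℝ) 1, h x₀ ≤ h x) :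
    AntitoneOn h (Set.Icc 0 x₀) ∧ MonotoneOn h (Set.Icc x₀ 1) := by
  constructor
  · intro x hx y hy hxy
    have hx' : x ∈ Set.Icc (0 : ℝ) 1 := ⟨hx.1, hx.2.trans hx₀.2⟩
    have := hc.le_max_of_mem_Icc hx' hx₀ (z := y) ⟨hxy, hy.2⟩
    rwa [max_eq_left (hmin x hx')] at this
  · intro x hx y hy hxy
    have hy' : y ∈ Set.Icc (0 : ℝ) 1 := ⟨hx₀.1.trans hy.1, hy.2⟩
    have := hc.le_max_of_mem_Icc hx₀ hy' (z := x) ⟨hx.1, hxy⟩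
    rwa [max_eq_right (hmin y hy')] at this

/-- The Neyman-Pearson lemma for the uniform law and the law with distribution function
`x ↦ f(1 - x)` on `[0,1]`. -/
theorem integral_tradeOffStieltjes_le (hc : ConvexOn ℝ (Set.Icc 0 1) f)
    (hf : ContinuousOn f (Set.Icc 0 1)) (ha : AntitoneOn f (Set.Icc 0 1)) {φ : ℝ → ℝ}
    (hφ : IsTest φ) {l c : ℝ} (hl : 0 ≤ l) (hlc : ∀ x ∈ Set.Icc (0 : ℝ) 1, c - l * x ≤ f x) :
    ∫ x, φ x ∂(tradeOffStieltjes hf ha).measure ≤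
      l * (∫ x, φ x ∂uniformStieltjes.measure) + f 0 - c := by
  set F := tradeOffStieltjes hf ha with hF
  have hFx : ∀ x, F x = f (1 - max 0 (min x 1)) := fun x => rfl
  have hUx : ∀ x, uniformStieltjes x = max 0 (min x 1) := fun x => rfl
  have hrefl : ∀ x ∈ Set.Icc (0 : ℝ) 1, 1 - x ∈ Set.Icc (0 : ℝ) 1 := fun x hx =>
    ⟨by linarith [hx.2], by linarith [hx.1]⟩
  -- the function whose minimum separates acceptance and rejection
  set h₀ : ℝ → ℝ := fun x => f (1 - x) - l * x with hh₀
  have hh₀c : ContinuousOn h₀ (Set.Icc 0 1) :=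
    (hf.comp (by fun_prop) hrefl).sub (by fun_prop)
  have hh₀v : ConvexOn ℝ (Set.Icc 0 1) h₀ := by
    refine ⟨convex_Icc _ _, fun x hx y hy a b ha hb hab => ?_⟩
    have := hc.2 (hrefl x hx) (hrefl y hy) ha hb hab
    simp only [smul_eq_mul, hh₀] at this ⊢
    have e : a * (1 - x) + b * (1 - y) = 1 - (a * x + b * y) := by linear_combination hab
    rw [e] at this
    linarith
  obtain ⟨x₀, hx₀, hmin⟩ := isCompact_Icc.exists_isMinOn (Set.nonempty_Icc.2 zero_le_one) hh₀c
  obtain ⟨hanti, hmono⟩ := unimodal_of_convexOn hh₀v hx₀ fun x hx => hmin hx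
  have hcont : Continuous fun x : ℝ => h₀ (max 0 (min x 1)) :=
    hh₀c.comp_continuous (by fun_prop) clamp_mem
  have hcx₀ := clamp_eq hx₀
  have hle : ∀ x, max 0 (min (min x x₀) 1) ≤ x₀ := fun x =>
    (max_le_max le_rfl (min_le_min (min_le_right _ _) le_rfl)).trans hcx₀.le
  have hge : ∀ x, x₀ ≤ max 0 (min (max x x₀) 1) := fun x =>
    hcx₀.ge.trans (max_le_max le_rfl (min_le_min (le_max_right _ _) le_rfl))
  let A : StieltjesFunction ℝ :=
    { toFun := fun x => -h₀ (max 0 (min (min x x₀) 1))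
      mono' := fun x y hxy => neg_le_neg (hanti
        ⟨le_max_left _ _, hle _⟩
        ⟨le_max_left _ _, hle _⟩ (by gcongr))
      right_continuous' := fun x => (hcont.comp (g := fun y => h₀ (max 0 (min y 1)))
        (by fun_prop : Continuous fun x : ℝ => min x x₀)).neg.continuousWithinAt }
  let B : StieltjesFunction ℝ :=
    { toFun := fun x => h₀ (max 0 (min (max x x₀) 1))
      mono' := fun x y hxy => hmono
        ⟨hge _, (clamp_mem _).2⟩
        ⟨hge _, (clamp_mem _).2⟩ (by gcongr)
      right_continuous' := fun x => (hcont.comp (g := fun y => h₀ (max 0 (min y 1)))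
        (by fun_prop : Continuous fun x : ℝ => max x x₀)).continuousWithinAt }
  -- `h₀` is the distribution function of the signed measure F - l·U, with U uniform. It decreases
  -- up to x₀ and increases afterwards, so B - A is its Jordan-type splitting: A carries the
  -- decrease, B the increase. A test collects at most the mass h₀(1) - h₀(x₀) of B.
  have hsum : F + A = Real.toNNReal l • uniformStieltjes +
      (B + StieltjesFunction.const ℝ (-h₀ x₀)) := by
    ext x
    show F x + A x = (Real.toNNReal l : ℝ) * uniformStieltjes x + (B x + -h₀ x₀)
    have e : F x - l * uniformStieltjes x = h₀ (max 0 (min x 1)) := rfl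
    rw [Real.coe_toNNReal _ hl]
    show F x + -h₀ (max 0 (min (min x x₀) 1)) = _ + (h₀ (max 0 (min (max x x₀) 1)) + _)
    rcases le_total x x₀ with h | h
    · rw [min_eq_left h, max_eq_right h, hcx₀]; linarith
    · rw [min_eq_right h, max_eq_left h, hcx₀]; linarith
  have hmeas : F.measure + A.measure = Real.toNNReal l • uniformStieltjes.measure + B.measure := by
    have := congrArg (fun G : StieltjesFunction ℝ => G.measure) hsum
    rwa [StieltjesFunction.measure_add, StieltjesFunction.measure_add,
      StieltjesFunction.measure_smul, StieltjesFunction.measure_add,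
      StieltjesFunction.measure_const, add_zero] at this
  have hBtop : Filter.Tendsto B Filter.atTop (nhds (h₀ 1)) :=
    tendsto_const_nhds.congr' ((Filter.eventually_ge_atTop 1).mono fun x hx => by
      show h₀ 1 = h₀ (max 0 (min (max x x₀) 1))
      rw [min_eq_right (hx.trans (le_max_left _ _)), max_eq_right zero_le_one])
  have hBbot : Filter.Tendsto B Filter.atBot (nhds (h₀ x₀)) :=
    tendsto_const_nhds.congr' ((Filter.eventually_le_atBot x₀).mono fun x hx => by
      show h₀ x₀ = h₀ (max 0 (min (max x x₀) 1))
      rw [max_eq_right hx, hcx₀])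
  have hBu := B.measure_univ hBbot hBtop
  have fB : IsFiniteMeasure B.measure := ⟨by rw [hBu]; exact ENNReal.ofReal_lt_top⟩
  have fU : IsFiniteMeasure uniformStieltjes.measure :=
    uniformStieltjes.isFiniteMeasure (tendsto_clamp_atBot (f := id)) (tendsto_clamp_atTop (f := id))
  have fF : IsFiniteMeasure F.measure :=
    F.isFiniteMeasure (tendsto_clamp_atBot (f := fun x => f (1 - x)))
      (tendsto_clamp_atTop (f := fun x => f (1 - x)))
  have fA : IsFiniteMeasure A.measure := by
    refine A.isFiniteMeasure_of_forall_abs_le (C := |h₀ 0| + |h₀ x₀|) fun x => ?_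
    have h1 : h₀ (max 0 (min (min x x₀) 1)) ≤ h₀ 0 := hanti ⟨le_rfl, hx₀.1⟩
      ⟨le_max_left _ _, hle _⟩ (le_max_left _ _)
    have h2 : h₀ x₀ ≤ h₀ (max 0 (min (min x x₀) 1)) := hmin (clamp_mem _)
    show |-h₀ (max 0 (min (min x x₀) 1))| ≤ _
    rw [abs_neg, abs_le]
    constructor
    · linarith [neg_abs_le (h₀ x₀), abs_nonneg (h₀ 0)]
    · linarith [le_abs_self (h₀ 0), abs_nonneg (h₀ x₀)]
  have hint : (∫ x, φ x ∂F.measure) + ∫ x, φ x ∂A.measure =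
      l * (∫ x, φ x ∂uniformStieltjes.measure) + ∫ x, φ x ∂B.measure := by
    have := congrArg (fun μ => ∫ x, φ x ∂μ) hmeas
    rw [integral_add_measure (hφ.integrable _) (hφ.integrable _),
      integral_add_measure (hφ.integrable _) (hφ.integrable _), integral_smul_nnreal_measure] at this
    rw [this]
    simp [NNReal.smul_def, Real.coe_toNNReal _ hl]
  have hB1 : ∫ x, φ x ∂B.measure ≤ h₀ 1 - h₀ x₀ := by
    have := integral_mono (hφ.integrable B.measure) (integrable_const (1 : ℝ)) hφ.le_one
    rw [integral_const, measureReal_def, hBu, ENNReal.toReal_ofReal (sub_nonneg.2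
      (hmin (Set.right_mem_Icc.2 zero_le_one)))] at this
    simpa using this
  have hA0 := hφ.integral_nonneg A.measure
  have hx₀c := hlc (1 - x₀) (hrefl x₀ hx₀)
  simp only [hh₀, sub_self, mul_one] at hB1
  linarith

/-- The null law is uniform on [0,1]; the alternative has distribution function f(1 - x) on [0,1)
and an atom of mass 1 - f(0) at 1. Rejecting on [1 - α, 1] has level α and power 1 - f(α), and
optimality is checked against affine minorants of f. -/
theorem exists_isTradeOffPair_of_convexOn (hc : ConvexOn ℝ (Set.Icc 0 1) f)
    (hf : ContinuousOn f (Set.Icc 0 1)) (h0 : ∀ x ∈ Set.Icc (0 : ℝ) 1, 0 ≤ f x)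
    (h1 : f 1 = 0) (hle : f 0 ≤ 1) : ∃ P Q : ProbabilityMeasure ℝ, IsTradeOffPair f P Q := by
  have ha := antitoneOn_of_convexOn hc h0 h1
  set F := tradeOffStieltjes hf ha with hF
  have hFx : ∀ x, F x = f (1 - max 0 (min x 1)) := fun x => rfl
  have hUb := tendsto_clamp_atBot (f := id)
  have hUt := tendsto_clamp_atTop (f := id)
  have hFb : Filter.Tendsto F Filter.atBot (nhds 0) := by
    have := tendsto_clamp_atBot (f := fun x => f (1 - x))
    rw [sub_zero, h1] at this
    exact this
  have hFt : Filter.Tendsto F Filter.atTop (nhds (f 0)) := by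
    have := tendsto_clamp_atTop (f := fun x => f (1 - x))
    rw [sub_self] at this
    exact this
  have hP : IsProbabilityMeasure uniformStieltjes.measure :=
    uniformStieltjes.isProbabilityMeasure hUb hUt
  have h00 := h0 0 (Set.left_mem_Icc.2 zero_le_one)
  have fF : IsFiniteMeasure F.measure := F.isFiniteMeasure hFb hFt
  have hQ : IsProbabilityMeasure (F.measure + ENNReal.ofReal (1 - f 0) • Measure.dirac 1) := by
    constructor
    rw [Measure.add_apply, F.measure_univ hFb hFt, Measure.smul_apply, measure_univ, smul_eq_mul,
      mul_one, sub_zero, ← ENNReal.ofReal_add h00 (by linarith)]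
    simp
  have hTm : IsTest (Function.uncurry fun α x : ℝ => if 1 - α ≤ x then (1 : ℝ) else 0) := by
    refine ⟨Measurable.ite (measurableSet_le (measurable_const.sub measurable_fst) measurable_snd)
      measurable_const measurable_const, fun p => ?_, fun p => ?_⟩
    all_goals simp only [Function.uncurry]; split_ifs <;> norm_num
  have hTi : ∀ α : ℝ, (fun x : ℝ => if 1 - α ≤ x then (1 : ℝ) else 0) =
      (Set.Ici (1 - α)).indicator fun _ => (1 : ℝ) := fun α => by
    funext x; simp [Set.indicator]
  have hQint : ∀ {φ : ℝ → ℝ}, IsTest φ →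
      ∫ x, φ x ∂(F.measure + ENNReal.ofReal (1 - f 0) • Measure.dirac 1) =
        (∫ x, φ x ∂F.measure) + (1 - f 0) * φ 1 := by
    intro φ hφ
    rw [integral_add_measure (hφ.integrable _) ((hφ.integrable _).smul_measure
      ENNReal.ofReal_ne_top), integral_smul_measure, integral_dirac,
      ENNReal.toReal_ofReal (by linarith), smul_eq_mul]
  have hlim : ∀ (G : StieltjesFunction ℝ), Continuous G → ∀ x, Function.leftLim G x = G x :=
    fun G hG x => ((G.mono.continuousAt_iff_leftLim_eq_rightLim).1 hG.continuousAt).trans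
      (G.rightLim_eq x)
  have hUc : Continuous uniformStieltjes :=
    (by fun_prop : Continuous fun x : ℝ => max 0 (min x 1))
  have hFc : Continuous F := by
    refine hf.comp_continuous (f := fun x : ℝ => 1 - max 0 (min x 1)) (by fun_prop) fun x => ?_
    have hx := clamp_mem x
    exact ⟨by linarith [hx.2], by linarith [hx.1]⟩
  refine ⟨⟨uniformStieltjes.measure, hP⟩, ⟨_, hQ⟩, isTradeOffPair_of_tests ha hTm
    (fun α hα => ?_) fun φ hφ => ?_⟩
  · have hα' : 1 - α ∈ Set.Icc (0 : ℝ) 1 := ⟨by linarith [hα.2], by linarith [hα.1]⟩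
    have hTα : IsTest fun x : ℝ => if 1 - α ≤ x then (1 : ℝ) else 0 :=
      hTm.comp (g := fun x => (α, x)) (measurable_const.prodMk measurable_id)
    constructor
    · show ∫ x, (if 1 - α ≤ x then (1 : ℝ) else 0) ∂uniformStieltjes.measure ≤ α
      rw [hTi, integral_indicator_const _ measurableSet_Ici, measureReal_def,
        uniformStieltjes.measure_Ici hUt, hlim _ hUc]
      have : uniformStieltjes (1 - α) = 1 - α := clamp_eq hα'
      rw [this]; simp [hα.1]
    · show _ ≤ ∫ x, (if 1 - α ≤ x then (1 : ℝ) else 0) ∂(F.measure +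
        ENNReal.ofReal (1 - f 0) • Measure.dirac 1)
      rw [hQint hTα, hTi, integral_indicator_const _ measurableSet_Ici, measureReal_def,
        F.measure_Ici hFt, hlim _ hFc, hFx, clamp_eq hα', sub_sub_cancel, ENNReal.toReal_ofReal]
      · simp [hα.1]
      · exact sub_nonneg.2 (ha (Set.left_mem_Icc.2 zero_le_one) hα hα.1)
  · show f (∫ x, φ x ∂uniformStieltjes.measure) ≤ 1 - ∫ x, φ x ∂(F.measure +
        ENNReal.ofReal (1 - f 0) • Measure.dirac 1)
    rw [hQint hφ]
    set α := ∫ x, φ x ∂uniformStieltjes.measure with hα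
    have hαm : α ∈ Set.Icc (0 : ℝ) 1 := ⟨hφ.integral_nonneg _, hφ.integral_le_one _⟩
    have hφ1 : (1 - f 0) * φ 1 ≤ 1 - f 0 :=
      mul_le_of_le_one_right (by linarith) (hφ.le_one 1)
    refine le_of_forall_pos_sub_le fun ε hε => ?_
    obtain ⟨l, c, hl, hlα⟩ := ConvexOn.exists_affine_le_of_lt_real hαm (sub_lt_self (f α) hε)
      isClosed_Icc hf.lowerSemicontinuousOn hc
    -- A decreasing minorant is a Neyman-Pearson multiplier. An increasing one is at most f(1) = 0
    -- on [0,1], so only 1 - β ≥ 0 is needed; this is the case of multiplier 0 and constant 0.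
    rcases le_total l 0 with hl0 | hl0
    · have := integral_tradeOffStieltjes_le hc hf ha hφ (l := -l) (c := c) (by linarith)
        fun x hx => by linarith [hl x hx]
      rw [← hF, ← hα] at this
      linarith
    · have h2 := hl 1 (Set.right_mem_Icc.2 zero_le_one)
      have h3 := mul_le_mul_of_nonneg_left hαm.2 hl0
      have := integral_tradeOffStieltjes_le hc hf ha hφ (l := 0) (c := 0) le_rfl
        fun x hx => by linarith [h0 x hx]
      rw [← hF] at this
      linarith

end convex

/-! ### The double convex conjugate -/

section biconj

variable {g : ℝ → ℝ}

theorem le_conjOn01 (h0 : ∀ x ∈ Set.Icc (0 : ℝ) 1, 0 ≤ g x) {x : ℝ} (hx : x ∈ Set.Icc (0 : ℝ) 1)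
    (y : ℝ) : y * x - g x ≤ conjOn01 g y := by
  refine le_csSup ⟨|y|, ?_⟩ (Set.mem_image_of_mem _ hx)
  rintro _ ⟨z, hz, rfl⟩
  have h1 : y * z ≤ |y| * 1 := by
    refine (le_abs_self _).trans ?_
    rw [abs_mul, abs_of_nonneg hz.1]
    exact mul_le_mul_of_nonneg_left hz.2 (abs_nonneg y)
  show y * z - g z ≤ |y|
  linarith [h0 z hz]

theorem conjOn01_le {y c : ℝ} (h : ∀ x ∈ Set.Icc (0 : ℝ) 1, y * x - g x ≤ c) :
    conjOn01 g y ≤ c := by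
  refine csSup_le ((Set.nonempty_Icc.2 zero_le_one).image _) ?_
  rintro _ ⟨x, hx, rfl⟩
  exact h x hx

theorem biconjOn01_le {x c : ℝ} (h : ∀ y, x * y - conjOn01 g y ≤ c) : biconjOn01 g x ≤ c :=
  ciSup_le h

theorem le_biconjOn01 (h0 : ∀ x ∈ Set.Icc (0 : ℝ) 1, 0 ≤ g x) {x : ℝ} (hx : x ∈ Set.Icc (0 : ℝ) 1)
    (y : ℝ) : x * y - conjOn01 g y ≤ biconjOn01 g x := by
  refine le_ciSup (f := fun y => x * y - conjOn01 g y) ⟨g x, ?_⟩ y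
  rintro _ ⟨z, rfl⟩
  have := le_conjOn01 h0 hx z
  show x * z - conjOn01 g z ≤ g x
  linarith

theorem biconjOn01_le_self (h0 : ∀ x ∈ Set.Icc (0 : ℝ) 1, 0 ≤ g x) {x : ℝ}
    (hx : x ∈ Set.Icc (0 : ℝ) 1) : biconjOn01 g x ≤ g x :=
  biconjOn01_le fun y => by linarith [le_conjOn01 h0 hx y]

theorem biconjOn01_nonneg (h0 : ∀ x ∈ Set.Icc (0 : ℝ) 1, 0 ≤ g x) {x : ℝ}
    (hx : x ∈ Set.Icc (0 : ℝ) 1) : 0 ≤ biconjOn01 g x := by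
  refine le_trans ?_ (le_biconjOn01 h0 hx 0)
  have : conjOn01 g 0 ≤ 0 := conjOn01_le fun z hz => by linarith [h0 z hz]
  linarith

theorem convexOn_biconjOn01 (h0 : ∀ x ∈ Set.Icc (0 : ℝ) 1, 0 ≤ g x) :
    ConvexOn ℝ (Set.Icc 0 1) (biconjOn01 g) := by
  refine ⟨convex_Icc _ _, fun x hx y hy a b ha hb hab => biconjOn01_le fun z => ?_⟩
  have h1 := mul_le_mul_of_nonneg_left (le_biconjOn01 h0 hx z) ha
  have h2 := mul_le_mul_of_nonneg_left (le_biconjOn01 h0 hy z) hb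
  simp only [smul_eq_mul]
  linear_combination h1 + h2 + conjOn01 g z * hab

/-- Convexity gives continuity in the interior. At 0, a supremum of affine functions is lower
semicontinuous and monotonicity gives the upper bound; at 1 the function is squeezed between 0 and 1
- x. -/
theorem continuousOn_biconjOn01 (h0 : ∀ x ∈ Set.Icc (0 : ℝ) 1, 0 ≤ g x)
    (h1 : ∀ x ∈ Set.Icc (0 : ℝ) 1, g x ≤ 1 - x) : ContinuousOn (biconjOn01 g) (Set.Icc 0 1) := by
  have hc := convexOn_biconjOn01 h0
  have hle : ∀ x ∈ Set.Icc (0 : ℝ) 1, biconjOn01 g x ≤ 1 - x := fun x hx =>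
    (biconjOn01_le_self h0 hx).trans (h1 x hx)
  have hg1 : biconjOn01 g 1 = 0 :=
    le_antisymm (by simpa using hle 1 (by simp)) (biconjOn01_nonneg h0 (by simp))
  have ha := antitoneOn_of_convexOn hc (fun x hx => biconjOn01_nonneg h0 hx) hg1
  intro x hx
  rcases hx.1.eq_or_lt with rfl | hx0
  · refine tendsto_order.2 ⟨fun c hlt => ?_, fun c hlt => ?_⟩
    · obtain ⟨y, hy⟩ := exists_lt_of_lt_ciSup hlt
      have hcont : ContinuousWithinAt (fun x : ℝ => x * y - conjOn01 g y) (Set.Icc 0 1) 0 := by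
        fun_prop
      filter_upwards [hcont.eventually (lt_mem_nhds hy), self_mem_nhdsWithin] with z hz hz'
      exact lt_of_lt_of_le hz (le_biconjOn01 h0 hz' y)
    · filter_upwards [self_mem_nhdsWithin] with z hz
      exact (ha hx hz hz.1).trans_lt hlt
  rcases hx.2.eq_or_lt with rfl | hx1
  · rw [ContinuousWithinAt, hg1]
    have ht : Filter.Tendsto (fun x : ℝ => 1 - x) (nhdsWithin 1 (Set.Icc 0 1)) (nhds 0) := by
      have : ContinuousWithinAt (fun x : ℝ => 1 - x) (Set.Icc 0 1) 1 := by fun_prop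
      simpa [ContinuousWithinAt] using this
    refine tendsto_of_tendsto_of_tendsto_of_le_of_le' tendsto_const_nhds ht ?_ ?_
    · filter_upwards [self_mem_nhdsWithin] with z hz using biconjOn01_nonneg h0 hz
    · filter_upwards [self_mem_nhdsWithin] with z hz using hle z hz
  · have := (hc.subset Set.Ioo_subset_Icc_self (convex_Ioo _ _)).continuousOn isOpen_Ioo
    exact (this.continuousAt (isOpen_Ioo.mem_nhds ⟨hx0, hx1⟩)).continuousWithinAt

theorem exists_isTradeOffPair_biconjOn01 (h0 : ∀ x ∈ Set.Icc (0 : ℝ) 1, 0 ≤ g x)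
    (h1 : ∀ x ∈ Set.Icc (0 : ℝ) 1, g x ≤ 1 - x) :
    ∃ P Q : ProbabilityMeasure ℝ, IsTradeOffPair (biconjOn01 g) P Q := by
  have hle : ∀ x ∈ Set.Icc (0 : ℝ) 1, biconjOn01 g x ≤ 1 - x := fun x hx =>
    (biconjOn01_le_self h0 hx).trans (h1 x hx)
  exact exists_isTradeOffPair_of_convexOn (convexOn_biconjOn01 h0) (continuousOn_biconjOn01 h0 h1)
    (fun x hx => biconjOn01_nonneg h0 hx)
    (le_antisymm (by simpa using hle 1 (by simp)) (biconjOn01_nonneg h0 (by simp)))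
    (by simpa using hle 0 (by simp))

end biconj

/-! ### The sampling operator -/

section sampling

variable {p : ℝ} {G : ℝ → ℝ}

theorem mixId_nonneg (hp0 : 0 ≤ p) (hp1 : p ≤ 1) (h0 : ∀ x ∈ Set.Icc (0 : ℝ) 1, 0 ≤ G x) {x : ℝ}
    (hx : x ∈ Set.Icc (0 : ℝ) 1) : 0 ≤ mixId p G x :=
  add_nonneg (mul_nonneg hp0 (h0 x hx)) (mul_nonneg (sub_nonneg.2 hp1) (sub_nonneg.2 hx.2))

theorem mixId_le (hp0 : 0 ≤ p) (h1 : ∀ x ∈ Set.Icc (0 : ℝ) 1, G x ≤ 1 - x) {x : ℝ}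
    (hx : x ∈ Set.Icc (0 : ℝ) 1) : mixId p G x ≤ 1 - x := by
  have := mul_le_mul_of_nonneg_left (h1 x hx) hp0
  unfold mixId
  linarith

theorem leftInv01_nonneg (f : ℝ → ℝ) (α : ℝ) : 0 ≤ leftInv01 f α :=
  Real.sInf_nonneg fun _ hx => hx.1.1

theorem leftInv01_le {f : ℝ → ℝ} {x : ℝ} (hx : x ∈ Set.Icc (0 : ℝ) 1) : leftInv01 f (f x) ≤ x :=
  csInf_le ⟨0, fun _ hy => hy.1.1⟩ ⟨hx, le_rfl⟩

theorem samplingOp_aux_nonneg (hp0 : 0 ≤ p) (hp1 : p ≤ 1) (h0 : ∀ x ∈ Set.Icc (0 : ℝ) 1, 0 ≤ G x) :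
    ∀ x ∈ Set.Icc (0 : ℝ) 1, 0 ≤ min (mixId p G x) (leftInv01 (mixId p G) x) := fun _ hx =>
  le_min (mixId_nonneg hp0 hp1 h0 hx) (leftInv01_nonneg _ _)

theorem exists_isTradeOffPair_samplingOp (hp0 : 0 ≤ p) (hp1 : p ≤ 1)
    (h0 : ∀ x ∈ Set.Icc (0 : ℝ) 1, 0 ≤ G x) (h1 : ∀ x ∈ Set.Icc (0 : ℝ) 1, G x ≤ 1 - x) :
    ∃ P Q : ProbabilityMeasure ℝ, IsTradeOffPair (samplingOp p G) P Q :=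
  exists_isTradeOffPair_biconjOn01 (samplingOp_aux_nonneg hp0 hp1 h0)
    fun _ hx => (min_le_left _ _).trans (mixId_le hp0 h1 hx)

/-- The point `(α, 1 - β)` lies above all affine minorants of `min {G_p, G_p⁻¹}`. -/
def SamplingDom (p : ℝ) (G : ℝ → ℝ) (α β : ℝ) : Prop :=
  ∀ y, y * α - (1 - β) ≤ conjOn01 (fun x => min (mixId p G x) (leftInv01 (mixId p G) x)) y

theorem SamplingDom.le_one_sub {α β : ℝ} (h : SamplingDom p G α β) : samplingOp p G α ≤ 1 - β :=
  biconjOn01_le fun y => by linarith [h y]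

/-- Each condition is affine in (α, β) with a bound that does not depend on the index, so it passes
to convex combinations. -/
theorem SamplingDom.sum {ι : Type*} {s : Finset ι} {w α β : ι → ℝ} (hw : ∀ i ∈ s, 0 ≤ w i)
    (hw1 : ∑ i ∈ s, w i = 1) (h : ∀ i ∈ s, SamplingDom p G (α i) (β i)) :
    SamplingDom p G (∑ i ∈ s, w i * α i) (∑ i ∈ s, w i * β i) := by
  intro y
  set c := conjOn01 (fun x => min (mixId p G x) (leftInv01 (mixId p G) x)) y
  have := Finset.sum_le_sum fun i hi => mul_le_mul_of_nonneg_left (h i hi y) (hw i hi)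
  rw [← Finset.sum_mul, hw1, one_mul] at this
  refine le_trans (le_of_eq ?_) this
  have e : ∀ i ∈ s, w i * (y * α i - (1 - β i)) = y * (w i * α i) - w i + w i * β i :=
    fun i _ => by ring
  rw [Finset.sum_congr rfl e, Finset.sum_add_distrib, Finset.sum_sub_distrib, hw1, Finset.mul_sum]
  ring

/-- Privacy amplification by subsampling: `a₀` is the common part of the rejection probabilities,
`a₁` and `a₁'` are the parts in which the two laws differ. -/
theorem samplingDom_mix (hp0 : 0 ≤ p) (hp1 : p ≤ 1) (h0 : ∀ x ∈ Set.Icc (0 : ℝ) 1, 0 ≤ G x)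
    (h1 : ∀ x ∈ Set.Icc (0 : ℝ) 1, G x ≤ 1 - x) {a₀ a₁ a₁' : ℝ} (ha₀ : a₀ ∈ Set.Icc (0 : ℝ) 1)
    (ha₁ : a₁ ∈ Set.Icc (0 : ℝ) 1) (ha₁' : a₁' ∈ Set.Icc (0 : ℝ) 1)
    (hG1 : G a₀ ≤ 1 - a₁') (hG2 : G a₁ ≤ 1 - a₁') (hG3 : G (1 - a₀) ≤ a₁)
    (hG4 : G (1 - a₁') ≤ a₁) :
    SamplingDom p G ((1 - p) * a₀ + p * a₁) ((1 - p) * a₀ + p * a₁') := by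
  intro y
  have hnn := samplingOp_aux_nonneg hp0 hp1 h0
  have hq : 0 ≤ 1 - p := sub_nonneg.2 hp1
  have hα1 : (1 - p) * a₀ + p * a₁ ≤ 1 := by nlinarith [ha₀.2, ha₁.2]
  have hβ1 : (1 - p) * a₀ + p * a₁' ≤ 1 := by nlinarith [ha₀.2, ha₁'.2]
  rcases le_or_gt 0 y with hy | hy
  -- For nonnegative slope the endpoint x = 1 suffices, where the minimum is at most 0.
  · have h := le_conjOn01 hnn (Set.right_mem_Icc.2 zero_le_one) y
    have hm := min_le_left (mixId p G 1) (leftInv01 (mixId p G) 1)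
    have hm' := mixId_le hp0 h1 (Set.right_mem_Icc.2 zero_le_one)
    have := mul_le_mul_of_nonneg_left hα1 hy
    linarith
  obtain ⟨l, rfl⟩ : ∃ l, y = -l := ⟨-y, by ring⟩
  rcases le_total 1 l with hl | hl
  -- For slope -l with l ≥ 1 the branch G_p is used at x = min(a₀, a₁). There G(x) ≤ 1 - a₁', and
  -- the difference of the two sides splits into (l - 1)(1 - p)(a₀ - x) and l p (a₁ - x), both
  -- nonnegative exactly because l ≥ 1.
  · have hx : min a₀ a₁ ∈ Set.Icc (0 : ℝ) 1 :=
      ⟨le_min ha₀.1 ha₁.1, (min_le_left _ _).trans ha₀.2⟩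
    have hGx : G (min a₀ a₁) ≤ 1 - a₁' := by
      rcases min_choice a₀ a₁ with h | h <;> rw [h] <;> assumption
    have h := le_conjOn01 hnn hx (-l)
    have hm := min_le_left (mixId p G (min a₀ a₁)) (leftInv01 (mixId p G) (min a₀ a₁))
    have e1 := mul_le_mul_of_nonneg_left hGx hp0
    have e2 := mul_le_mul_of_nonneg_left (min_le_left a₀ a₁) (mul_nonneg (sub_nonneg.2 hl) hq)
    have e3 := mul_le_mul_of_nonneg_left (min_le_right a₀ a₁)
      (mul_nonneg (zero_le_one.trans hl) hp0)
    refine le_trans ?_ h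
    unfold mixId at hm ⊢
    linarith
  -- For l ≤ 1 the roles of the two error types are exchanged: the branch G_p⁻¹ is used at x =
  -- G_p(z), where it is at most z.
  · have hz : min (1 - a₀) (1 - a₁') ∈ Set.Icc (0 : ℝ) 1 :=
      ⟨le_min (by linarith [ha₀.2]) (by linarith [ha₁'.2]), (min_le_left _ _).trans
        (by linarith [ha₀.1])⟩
    set z := min (1 - a₀) (1 - a₁') with hzdef
    have hGz : G z ≤ a₁ := by
      rcases min_choice (1 - a₀) (1 - a₁') with h | h <;> rw [hzdef, h] <;> assumption
    have hx : mixId p G z ∈ Set.Icc (0 : ℝ) 1 :=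
      ⟨mixId_nonneg hp0 hp1 h0 hz, (mixId_le hp0 h1 hz).trans (by linarith [hz.1])⟩
    have h := le_conjOn01 hnn hx (-l)
    have hm := (min_le_right (mixId p G (mixId p G z)) (leftInv01 (mixId p G) (mixId p G z))).trans
      (leftInv01_le hz)
    have hl0 : 0 ≤ l := by linarith
    have e1 := mul_le_mul_of_nonneg_left hGz (mul_nonneg hl0 hp0)
    have e2 := mul_le_mul_of_nonneg_left (min_le_left (1 - a₀) (1 - a₁'))
      (mul_nonneg (sub_nonneg.2 hl) hq)
    have e3 := mul_le_mul_of_nonneg_left (min_le_right (1 - a₀) (1 - a₁')) hp0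
    rw [← hzdef] at e2 e3
    have e4 : l * mixId p G z = l * p * G z + l * (1 - p) * (1 - z) := by unfold mixId; ring
    refine le_trans ?_ h
    linarith

end sampling

/-! ### Composition -/

/-- Every measurably parametrized family of tests of `ρ` against `ρ'` is dominated by a family of
tests of `P` against `Q`. -/
def Dominated {Ω Ω₀ : Type*} [MeasurableSpace Ω] [MeasurableSpace Ω₀] (ρ ρ' : Measure Ω)
    (P Q : Measure Ω₀) : Prop :=
  ∀ (Y : Type) [MeasurableSpace Y] (φ : Ω × Y → ℝ), IsTest φ →
    ∃ φ₀ : Ω₀ × Y → ℝ, IsTest φ₀ ∧ ∀ y, ∫ x, φ₀ (x, y) ∂P ≤ ∫ x, φ (x, y) ∂ρ ∧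
      ∫ x, φ (x, y) ∂ρ' ≤ ∫ x, φ₀ (x, y) ∂Q

section composition

variable {Ω Ω₁ Ω₀ : Type*} [MeasurableSpace Ω] [MeasurableSpace Ω₁] [MeasurableSpace Ω₀]
  {ρ ρ' : Measure Ω} [IsProbabilityMeasure ρ] [IsProbabilityMeasure ρ']

/-- With equal laws the test is replaced by its rejection probability, as a constant randomized
decision that ignores the observation. -/
theorem Dominated.refl (P Q : Measure Ω₀) [IsProbabilityMeasure P] [IsProbabilityMeasure Q] :
    Dominated ρ ρ P Q := fun _ _ φ hφ =>
  ⟨fun p => ∫ x, φ (x, p.2) ∂ρ, (hφ.integral_const_kernel ρ).comp measurable_snd, fun y => by simp⟩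

/-- Here α and α' are the conditional rejection probabilities of the next step given ω. The optimal
test of level α(ω, y) has size at most α and power at least 1 - f(α) ≥ α', so the next step may be
replaced by an observation of the pair (P, Q); Fubini then lets the domination act on ω. -/
theorem Dominated.prod {P₀ Q₀ : Measure Ω₀} [IsProbabilityMeasure P₀] [IsProbabilityMeasure Q₀]
    (h : Dominated ρ ρ' P₀ Q₀) {f : ℝ → ℝ} {P Q : ProbabilityMeasure ℝ} (hf : IsTradeOffPair f P Q)
    {Y : Type} [MeasurableSpace Y] {α α' : Ω × Y → ℝ} (hα : IsTest α) (hα' : IsTest α')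
    (hαα' : ∀ p, f (α p) ≤ 1 - α' p) :
    ∃ Φ : (ℝ × Ω₀) × Y → ℝ, IsTest Φ ∧ ∀ y,
      ∫ x, Φ (x, y) ∂((P : Measure ℝ).prod P₀) ≤ ∫ ω, α (ω, y) ∂ρ ∧
      ∫ ω, α' (ω, y) ∂ρ' ≤ ∫ x, Φ (x, y) ∂((Q : Measure ℝ).prod Q₀) := by
  obtain ⟨-, Ψ, hΨ, hPQ⟩ := hf
  have hφ : IsTest fun q : Ω × (Y × ℝ) => Ψ (α (q.1, q.2.1)) q.2.2 :=
    hΨ.comp (g := fun q : Ω × (Y × ℝ) => (α (q.1, q.2.1), q.2.2))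
      ((hα.measurable.comp (by fun_prop)).prodMk (by fun_prop))
  have hφ' : ∀ y, IsTest fun q : Ω × ℝ => Ψ (α (q.1, y)) q.2 := fun y =>
    hφ.comp (g := fun q : Ω × ℝ => (q.1, (y, q.2))) (by fun_prop)
  -- The new real observation is held fixed as part of the parameter while ω is replaced. This is
  -- why domination is required for parametrized families.
  obtain ⟨φ₀, hφ₀, hy⟩ := h (Y × ℝ) _ hφ
  have hΦ : IsTest fun q : (ℝ × Ω₀) × Y => φ₀ (q.1.2, (q.2, q.1.1)) := hφ₀.comp (by fun_prop)
  have hΦy : ∀ y, IsTest fun q : ℝ × Ω₀ => φ₀ (q.2, (y, q.1)) := fun y =>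
    hφ₀.comp (by fun_prop)
  have hφ₀y : ∀ (y : Y) (μ : Measure Ω₀) [IsProbabilityMeasure μ],
      IsTest fun x : ℝ => ∫ ω, φ₀ (ω, (y, x)) ∂μ := fun y μ _ =>
    (hφ₀.integral_const_kernel μ).comp (g := fun x : ℝ => (y, x)) (by fun_prop)
  have hφy : ∀ (y : Y) (μ : Measure Ω) [IsProbabilityMeasure μ],
      IsTest fun x : ℝ => ∫ ω, Ψ (α (ω, y)) x ∂μ := fun y μ _ =>
    (hφ.integral_const_kernel μ).comp (g := fun x : ℝ => (y, x)) (by fun_prop)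
  have hΨy : ∀ (y : Y) (μ : Measure ℝ) [IsProbabilityMeasure μ],
      IsTest fun ω : Ω => ∫ x, Ψ (α (ω, y)) x ∂μ := fun y μ _ =>
    ((hφ' y).comp measurable_swap).integral_const_kernel μ
  have hαm : ∀ p, α p ∈ Set.Icc (0 : ℝ) 1 := fun p => ⟨hα.nonneg p, hα.le_one p⟩
  refine ⟨_, hΦ, fun y => ⟨?_, ?_⟩⟩
  · rw [(hΦy y).integral_prod]
    calc ∫ x, ∫ ω, φ₀ (ω, (y, x)) ∂P₀ ∂(P : Measure ℝ)
        ≤ ∫ x, ∫ ω, Ψ (α (ω, y)) x ∂ρ ∂(P : Measure ℝ) :=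
          integral_mono ((hφ₀y y P₀).integrable _) ((hφy y ρ).integrable _) fun x => (hy (y, x)).1
      _ = ∫ ω, ∫ x, Ψ (α (ω, y)) x ∂(P : Measure ℝ) ∂ρ := by
          rw [← (hφ' y).integral_prod, (hφ' y).integral_prod_symm]
      _ ≤ ∫ ω, α (ω, y) ∂ρ :=
          integral_mono ((hΨy y _).integrable _)
            ((hα.comp (g := fun ω => (ω, y)) (by fun_prop)).integrable _)
            fun ω => (hPQ _ (hαm _)).1
  · rw [(hΦy y).integral_prod]
    calc ∫ ω, α' (ω, y) ∂ρ' ≤ ∫ ω, ∫ x, Ψ (α (ω, y)) x ∂(Q : Measure ℝ) ∂ρ' :=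
          integral_mono ((hα'.comp (g := fun ω => (ω, y)) (by fun_prop)).integrable _)
            ((hΨy y _).integrable _) fun ω => by
              show α' (ω, y) ≤ ∫ x, Ψ (α (ω, y)) x ∂(Q : Measure ℝ)
              linarith [(hPQ _ (hαm (ω, y))).2, hαα' (ω, y)]
      _ = ∫ x, ∫ ω, Ψ (α (ω, y)) x ∂ρ' ∂(Q : Measure ℝ) := by
          rw [← (hφ' y).integral_prod, (hφ' y).integral_prod_symm]
      _ ≤ ∫ x, ∫ ω, φ₀ (ω, (y, x)) ∂Q₀ ∂(Q : Measure ℝ) :=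
          integral_mono ((hφy y ρ').integrable _) ((hφ₀y y Q₀).integrable _) fun x => (hy (y, x)).2

theorem Dominated.pi {n : ℕ} (i : Fin (n + 1)) {P Q : Fin (n + 1) → ProbabilityMeasure ℝ}
    (h : Dominated ρ ρ' (Measure.pi fun j => (P (i.succAbove j) : Measure ℝ))
      (Measure.pi fun j => (Q (i.succAbove j) : Measure ℝ)))
    {f : ℝ → ℝ} (hf : IsTradeOffPair f (P i) (Q i))
    {Y : Type} [MeasurableSpace Y] {α α' : Ω × Y → ℝ} (hα : IsTest α) (hα' : IsTest α')
    (hαα' : ∀ p, f (α p) ≤ 1 - α' p) :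
    ∃ Φ : (Fin (n + 1) → ℝ) × Y → ℝ, IsTest Φ ∧ ∀ y,
      ∫ x, Φ (x, y) ∂(Measure.pi fun j => (P j : Measure ℝ)) ≤ ∫ ω, α (ω, y) ∂ρ ∧
      ∫ ω, α' (ω, y) ∂ρ' ≤ ∫ x, Φ (x, y) ∂(Measure.pi fun j => (Q j : Measure ℝ)) := by
  obtain ⟨Φ, hΦ, hy⟩ := h.prod hf hα hα' hαα'
  let e := MeasurableEquiv.piFinSuccAbove (fun _ : Fin (n + 1) => ℝ) i
  have key : ∀ (R : Fin (n + 1) → ProbabilityMeasure ℝ) (y : Y),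
      ∫ x, Φ (e x, y) ∂(Measure.pi fun j => (R j : Measure ℝ)) =
        ∫ x, Φ (x, y) ∂((R i : Measure ℝ).prod
          (Measure.pi fun j => (R (i.succAbove j) : Measure ℝ))) := fun R y =>
    (measurePreserving_piFinSuccAbove (fun j => (R j : Measure ℝ)) i).integral_comp'
      (g := fun x => Φ (x, y))
  refine ⟨fun q => Φ (e q.1, q.2), hΦ.comp (by fun_prop), fun y => ?_⟩
  simp only [key]
  exact hy y

theorem Dominated.pi_of_forall {n : ℕ} (i : Fin (n + 1)) {P Q : Fin (n + 1) → ProbabilityMeasure ℝ}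
    (h : Dominated ρ ρ' (Measure.pi fun j => (P (i.succAbove j) : Measure ℝ))
      (Measure.pi fun j => (Q (i.succAbove j) : Measure ℝ)))
    {f : ℝ → ℝ} (hf : IsTradeOffPair f (P i) (Q i)) {ρ₁ ρ₁' : Measure Ω₁}
    (h₁ : ∀ (Y : Type) [MeasurableSpace Y] (φ : Ω₁ × Y → ℝ), IsTest φ →
      ∃ α α' : Ω × Y → ℝ, IsTest α ∧ IsTest α' ∧ (∀ p, f (α p) ≤ 1 - α' p) ∧
        ∀ y, ∫ x, φ (x, y) ∂ρ₁ = ∫ ω, α (ω, y) ∂ρ ∧ ∫ x, φ (x, y) ∂ρ₁' = ∫ ω, α' (ω, y) ∂ρ') :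
    Dominated ρ₁ ρ₁' (Measure.pi fun j => (P j : Measure ℝ))
      (Measure.pi fun j => (Q j : Measure ℝ)) := by
  intro Y _ φ hφ
  obtain ⟨α, α', hα, hα', hαα', hy⟩ := h₁ Y φ hφ
  obtain ⟨Φ, hΦ, hΦy⟩ := h.pi i hf hα hα' hαα'
  refine ⟨Φ, hΦ, fun y => ?_⟩
  rw [(hy y).1, (hy y).2]
  exact hΦy y

end composition

theorem tradeOff_le_tradeOff {Ω Ω₀ : Type*} [MeasurableSpace Ω] [MeasurableSpace Ω₀]
    {ρ ρ' : Measure Ω} {P Q : Measure Ω₀} [IsProbabilityMeasure Q]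
    (h : ∀ φ : Ω → ℝ, IsTest φ → ∃ φ₀ : Ω₀ → ℝ, IsTest φ₀ ∧ ∫ x, φ₀ x ∂P ≤ ∫ x, φ x ∂ρ ∧
      ∫ x, φ x ∂ρ' ≤ ∫ x, φ₀ x ∂Q) {a : ℝ} (ha : 0 ≤ a) :
    tradeOff P Q a ≤ tradeOff ρ ρ' a := by
  refine le_tradeOff _ _ ha fun φ hφ hφa => ?_
  obtain ⟨φ₀, hφ₀, h1, h2⟩ := h φ hφ
  exact (tradeOff_le P Q hφ₀ (h1.trans hφa)).trans (by linarith)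

/-! ### Uniformly random subsets -/

section subsets

open Finset

variable {n : ℕ} (r : Fin n) (b : ℕ)

/-- Pairs of a `b`-element set without `r` and a `b + 1`-element set, both containing a common set
`T` of `b` elements: the index is `T` together with the additional element of the first set. -/
def exchangeIndex : Finset (Σ _ : Finset (Fin n), Fin n) :=
  ((univ.erase r).powersetCard b).sigma fun T => univ.erase r \ T

variable {r b}

theorem mem_exchangeIndex {q : Σ _ : Finset (Fin n), Fin n} :
    q ∈ exchangeIndex r b ↔ (r ∉ q.1 ∧ q.1.card = b) ∧ q.2 ≠ r ∧ q.2 ∉ q.1 := by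
  simp [exchangeIndex, mem_powersetCard, subset_erase]

variable {M : Type*} [AddCommMonoid M]

theorem sum_exchangeIndex_insert_fixed (F : Finset (Fin n) → M) :
    ∑ q ∈ exchangeIndex r b, F (insert r q.1) =
      (n - 1 - b) • ∑ T ∈ (univ.erase r).powersetCard b, F (insert r T) := by
  rw [exchangeIndex, sum_sigma, ← sum_nsmul]
  refine sum_congr rfl fun T hT => ?_
  rw [mem_powersetCard] at hT
  show ∑ _s ∈ univ.erase r \ T, F (insert r T) = _
  rw [sum_const, card_sdiff_of_subset hT.1, card_erase_of_mem (mem_univ r), hT.2]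
  simp

/-- Double counting: a pair (T, x) amounts to a (b + 1)-element set S avoiding r with a marked
element x ∈ S, and there are b + 1 ways to mark. -/
theorem sum_exchangeIndex_insert (F : Finset (Fin n) → M) :
    ∑ q ∈ exchangeIndex r b, F (insert q.2 q.1) =
      (b + 1) • ∑ S ∈ (univ.erase r).powersetCard (b + 1), F S := by
  have : (b + 1) • ∑ S ∈ (univ.erase r).powersetCard (b + 1), F S =
      ∑ q ∈ ((univ.erase r).powersetCard (b + 1)).sigma fun S => S, F q.1 := by
    rw [sum_sigma, ← sum_nsmul]
    refine sum_congr rfl fun S hS => ?_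
    show _ = ∑ _s ∈ S, F S
    rw [sum_const, (mem_powersetCard.1 hS).2]
  rw [this]
  refine sum_bij' (fun q _ => ⟨insert q.2 q.1, q.2⟩) (fun q _ => ⟨q.1.erase q.2, q.2⟩) ?_ ?_ ?_ ?_ ?_
  · rintro ⟨T, x⟩ hq
    rw [mem_exchangeIndex] at hq
    simp only [mem_sigma, mem_powersetCard, subset_erase, mem_insert, true_or, and_true]
    refine ⟨⟨subset_univ _, ?_⟩, ?_⟩
    · rw [not_or]; exact ⟨hq.2.1.symm, hq.1.1⟩
    · rw [card_insert_of_notMem hq.2.2, hq.1.2]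
  · rintro ⟨S, x⟩ hq
    simp only [mem_sigma, mem_powersetCard, subset_erase] at hq
    rw [mem_exchangeIndex]
    refine ⟨⟨fun h => hq.1.1.2 (mem_of_mem_erase h), ?_⟩, ?_, by simp⟩
    · rw [card_erase_of_mem hq.2, hq.1.2]; simp
    · rintro rfl; exact hq.1.1.2 hq.2
  · rintro ⟨T, x⟩ hq
    rw [mem_exchangeIndex] at hq
    simp [erase_insert hq.2.2]
  · rintro ⟨S, x⟩ hq
    simp only [mem_sigma] at hq
    simp [insert_erase hq.2]
  · intro q _; rfl

theorem sum_powersetCard_succ_univ (F : Finset (Fin n) → M) :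
    ∑ S ∈ (univ : Finset (Fin n)).powersetCard (b + 1), F S =
      ∑ S ∈ (univ.erase r).powersetCard (b + 1), F S +
        ∑ T ∈ (univ.erase r).powersetCard b, F (insert r T) := by
  conv_lhs => rw [← insert_erase (mem_univ r), powersetCard_succ_insert (notMem_erase r univ)]
  rw [sum_union, sum_image]
  · intro S hS T hT h
    have hS' := (mem_powersetCard.1 hS).1
    have hT' := (mem_powersetCard.1 hT).1
    rw [subset_erase] at hS' hT'
    rw [← erase_insert hS'.2, h, erase_insert hT'.2]
  · rw [disjoint_left]
    intro S hS hS'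
    obtain ⟨T, -, rfl⟩ := mem_image.1 hS'
    have := (mem_powersetCard.1 hS).1
    rw [subset_erase] at this
    exact this.2 (mem_insert_self _ _)

theorem card_exchangeIndex : (exchangeIndex r b).card = (n - 1).choose b * (n - 1 - b) := by
  have := sum_exchangeIndex_insert_fixed (r := r) (b := b) (fun _ => 1)
  simpa [card_powersetCard, mul_comm] using this

/-- For a uniform index (T, x), the set T ∪ {x} is uniform among the batches avoiding r and T ∪ {r}
among those containing r. Mixing them with the probability (b + 1)/n that a batch contains r
restores the uniform batch. -/
theorem sum_powersetCard_eq_exchange (hb : b + 1 < n) (F : Finset (Fin n) → ENNReal) :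
    ∑ S ∈ (univ : Finset (Fin n)).powersetCard (b + 1), ((n.choose (b + 1) : ℕ) : ENNReal)⁻¹ * F S =
      ∑ q ∈ exchangeIndex r b, ENNReal.ofReal (((exchangeIndex r b).card : ℝ)⁻¹) *
        (ENNReal.ofReal (1 - ((b + 1 : ℕ) : ℝ) / n) * F (insert q.2 q.1) +
          ENNReal.ofReal (((b + 1 : ℕ) : ℝ) / n) * F (insert r q.1)) := by
  obtain ⟨k, rfl⟩ : ∃ k, n = b + 1 + (k + 1) := ⟨n - (b + 1) - 1, by omega⟩
  have hn : (0 : ℝ) < (b + 1 + (k + 1) : ℕ) := by positivity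
  set c : ℝ := ((exchangeIndex r b).card : ℝ)⁻¹ with hc
  have hcard : (exchangeIndex r b).card = (b + 1 + k).choose b * (k + 1) := by
    rw [card_exchangeIndex]; congr 1; omega
  have hch : 0 < (b + 1 + k).choose b := Nat.choose_pos (by omega)
  have hch' : 0 < (b + 1 + (k + 1)).choose (b + 1) := Nat.choose_pos (by omega)
  have hid : (b + 1 + (k + 1)) * (b + 1 + k).choose b = (b + 1 + (k + 1)).choose (b + 1) * (b + 1) :=
    Nat.add_one_mul_choose_eq (b + 1 + k) b
  have hidR : ((b + 1 + (k + 1) : ℕ) : ℝ) * (b + 1 + k).choose b =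
      (b + 1 + (k + 1)).choose (b + 1) * ((b + 1 : ℕ) : ℝ) := by exact_mod_cast hid
  have hC : ((((b + 1 + (k + 1)).choose (b + 1) : ℕ) : ENNReal))⁻¹ =
      ENNReal.ofReal ((((b + 1 + (k + 1)).choose (b + 1) : ℕ) : ℝ)⁻¹) := by
    rw [ENNReal.ofReal_inv_of_pos (by exact_mod_cast hch'), ENNReal.ofReal_natCast]
  have hp1 : ((b + 1 : ℕ) : ℝ) / (b + 1 + (k + 1) : ℕ) ≤ 1 := by
    rw [div_le_one hn]; exact_mod_cast (by omega)
  have hq : 1 - ((b + 1 : ℕ) : ℝ) / (b + 1 + (k + 1) : ℕ) = ((k + 1 : ℕ) : ℝ) /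
      (b + 1 + (k + 1) : ℕ) := by
    rw [eq_div_iff hn.ne', sub_mul, div_mul_cancel₀ _ hn.ne']; push_cast; ring
  have hchR : (0 : ℝ) < (b + 1 + k).choose b := by exact_mod_cast hch
  have hchR' : (0 : ℝ) < (b + 1 + (k + 1)).choose (b + 1) := by exact_mod_cast hch'
  have hkR : (0 : ℝ) < (k + 1 : ℕ) := by positivity
  have hbR : (0 : ℝ) < (b + 1 : ℕ) := by positivity
  -- Every batch of either kind gets this one weight. The multiplicity of a batch avoiding r is b +
  -- 1, of one containing r it is k + 1 = n - (b + 1), and in each case the missing factor is the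
  -- numerator of its mixing probability. The value follows from n·C(n-1, b) = C(n, b+1)·(b+1).
  have e0 : c * ((k + 1 : ℕ) : ℝ) * ((b + 1 : ℕ) : ℝ) / (b + 1 + (k + 1) : ℕ) =
      (((b + 1 + (k + 1)).choose (b + 1) : ℕ) : ℝ)⁻¹ := by
    rw [hc, hcard]
    push_cast at hidR hkR hbR hn ⊢
    field_simp
    linear_combination -hidR
  have h1 : ENNReal.ofReal c * ENNReal.ofReal (1 - ((b + 1 : ℕ) : ℝ) / (b + 1 + (k + 1) : ℕ)) *
      ((b + 1 : ℕ) : ENNReal) = (((b + 1 + (k + 1)).choose (b + 1) : ℕ) : ENNReal)⁻¹ := by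
    rw [hC, hq, ← ENNReal.ofReal_natCast, ← ENNReal.ofReal_mul (by positivity),
      ← ENNReal.ofReal_mul (by positivity), ← e0]
    congr 1; ring
  have h2 : ENNReal.ofReal c * ENNReal.ofReal (((b + 1 : ℕ) : ℝ) / (b + 1 + (k + 1) : ℕ)) *
      ((k + 1 : ℕ) : ENNReal) = (((b + 1 + (k + 1)).choose (b + 1) : ℕ) : ENNReal)⁻¹ := by
    rw [hC, ← ENNReal.ofReal_natCast, ← ENNReal.ofReal_mul (by positivity),
      ← ENNReal.ofReal_mul (by positivity), ← e0]
    congr 1; ring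
  rw [← mul_sum, ← mul_sum, sum_add_distrib, ← mul_sum, ← mul_sum,
    sum_exchangeIndex_insert, sum_exchangeIndex_insert_fixed, sum_powersetCard_succ_univ (r := r),
    mul_add, mul_add, nsmul_eq_mul, nsmul_eq_mul]
  have hk : b + 1 + (k + 1) - 1 - b = k + 1 := by omega
  rw [hk, ← mul_assoc, ← mul_assoc, ← mul_assoc, ← mul_assoc, h1, h2]

end subsets

/-! ### Gradient steps of strongly convex and smooth functions -/

section gradientStep

variable {d : ℕ}

local notation "𝔼" => EuclideanSpace ℝ (Fin d)

theorem hasDerivAt_comp_line {f : 𝔼 → ℝ} (hf : Differentiable ℝ f) (x v : 𝔼) (t : ℝ) :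
    HasDerivAt (fun t : ℝ => f (x + t • v)) (inner ℝ (gradient f (x + t • v)) v) t := by
  have h1 : HasDerivAt (fun t : ℝ => x + t • v) v t := by
    simpa using ((hasDerivAt_id t).smul_const v).const_add x
  have h2 := (hf (x + t • v)).hasGradientAt.hasFDerivAt.comp_hasDerivAt t h1
  exact h2.congr_deriv rfl

theorem le_of_lipschitz_gradient {M : ℝ} {f : 𝔼 → ℝ} (hf : IsSmoothLoss M f) (x v : 𝔼) :
    f (x + v) ≤ f x + inner ℝ (gradient f x) v + M / 2 * ‖v‖ ^ 2 := by
  set φ : ℝ → ℝ := fun t => f (x + t • v) - t * inner ℝ (gradient f x) v - M / 2 * ‖v‖ ^ 2 * t ^ 2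
  have hd : ∀ t, HasDerivAt φ (inner ℝ (gradient f (x + t • v)) v - inner ℝ (gradient f x) v
      - M * ‖v‖ ^ 2 * t) t := by
    intro t
    have := ((hasDerivAt_comp_line hf.1 x v t).sub ((hasDerivAt_id t).mul_const
      (inner ℝ (gradient f x) v))).sub (((hasDerivAt_id t).pow 2).const_mul (M / 2 * ‖v‖ ^ 2))
    refine this.congr_deriv ?_
    simp; ring
  have hanti : AntitoneOn φ (Set.Icc 0 1) := by
    refine antitoneOn_of_deriv_nonpos (convex_Icc _ _)
      (fun t _ => (hd t).continuousAt.continuousWithinAt)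
      (fun t _ => (hd t).differentiableAt.differentiableWithinAt) fun t ht => ?_
    rw [interior_Icc] at ht
    rw [(hd t).deriv, ← inner_sub_left]
    have h1 := real_inner_le_norm (gradient f (x + t • v) - gradient f x) v
    have h2 := hf.2 (x + t • v) x
    rw [add_sub_cancel_left, norm_smul, Real.norm_eq_abs, abs_of_pos ht.1] at h2
    have h3 := mul_le_mul_of_nonneg_right h2 (norm_nonneg v)
    nlinarith
  have := hanti (Set.left_mem_Icc.2 zero_le_one) (Set.right_mem_Icc.2 zero_le_one) zero_le_one
  simp only [φ, one_smul, zero_smul, add_zero] at this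
  linarith

theorem le_of_strongConvexOn {m : ℝ} {f : 𝔼 → ℝ} (hf : Differentiable ℝ f)
    (hs : StrongConvexOn Set.univ m f) (x v : 𝔼) :
    f x + inner ℝ (gradient f x) v + m / 2 * ‖v‖ ^ 2 ≤ f (x + v) := by
  rw [strongConvexOn_iff_convex] at hs
  set φ : ℝ → ℝ := fun t => f (x + t • v) - (m / 2 * ‖x‖ ^ 2 + t * (m * inner ℝ x v)
    + t ^ 2 * (m / 2 * ‖v‖ ^ 2)) with hφ
  have hn : ∀ t : ℝ, ‖x + t • v‖ ^ 2 = ‖x‖ ^ 2 + 2 * t * inner ℝ x v + t ^ 2 * ‖v‖ ^ 2 := by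
    intro t
    rw [norm_add_sq_real, inner_smul_right, norm_smul, mul_pow, Real.norm_eq_abs, sq_abs]; ring
  have hc : ConvexOn ℝ Set.univ φ := by
    have := hs.comp_affineMap (AffineMap.lineMap x (x + v))
    rw [Set.preimage_univ] at this
    refine this.congr fun t _ => ?_
    have hl : (AffineMap.lineMap x (x + v) : ℝ →ᵃ[ℝ] 𝔼) t = x + t • v := by
      rw [AffineMap.lineMap_apply]; simp [add_comm]
    simp only [Function.comp, hl, hn, hφ]; ring
  have hd : HasDerivAt φ (inner ℝ (gradient f x) v - m * inner ℝ x v) 0 := by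
    have := (hasDerivAt_comp_line hf x v 0).sub ((((hasDerivAt_id (0 : ℝ)).mul_const
      (m * inner ℝ x v)).const_add (m / 2 * ‖x‖ ^ 2)).add
      (((hasDerivAt_id (0 : ℝ)).pow 2).mul_const (m / 2 * ‖v‖ ^ 2)))
    refine this.congr_deriv ?_
    simp
  have := hc.le_slope_of_hasDerivAt (Set.mem_univ 0) (Set.mem_univ 1) zero_lt_one hd
  rw [slope_def_field] at this
  simp only [hφ, one_smul, zero_smul, add_zero, zero_mul, one_mul, one_pow, sub_zero, div_one,
    ne_eq, OfNat.ofNat_ne_zero, not_false_eq_true, zero_pow] at this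
  linarith

theorem abs_sub_add_le (a b : ℝ) : |a - b| + b ≤ max |a| |a - 2 * b| := by
  rcases le_total b a with h | h
  · rw [abs_of_nonneg (sub_nonneg.2 h)]
    exact le_max_of_le_left (by linarith [le_abs_self a])
  · rw [abs_of_nonpos (sub_nonpos.2 h)]
    exact le_max_of_le_right (by linarith [neg_abs_le (a - 2 * b)])

/-- Cocoercivity of the gradient of f - (m/2)‖·‖² puts w in the ball of center (L/2)u and radius
(L/2)‖u‖. The step difference is then (1 - ηm - ηL/2)u plus an error of norm at most (ηL/2)‖u‖, and
`abs_sub_add_le` produces the maximum over the two extreme curvatures. -/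
theorem norm_gradientStep_sub_le {m M η : ℝ} (hη : 0 ≤ η) {f : 𝔼 → ℝ} (hf : IsSmoothLoss M f)
    (hs : StrongConvexOn Set.univ m f) (x y : 𝔼) :
    ‖(x - η • gradient f x) - (y - η • gradient f y)‖ ≤
      max |1 - η * m| |1 - η * M| * ‖x - y‖ := by
  set u := x - y with hu
  set w := gradient f x - gradient f y - m • u with hw
  set L := M - m with hL
  have key : ∀ τ : ℝ, (2 * τ - L * τ ^ 2) * ‖w‖ ^ 2 ≤ inner ℝ w u := by
    -- The quadratic lower bound at y and upper bound at x are compared at the common point x - τw,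
    -- and those at x and y, with roles exchanged, at y + τw. Adding the two eliminates the values
    -- of f.
    intro τ
    have a1 := le_of_strongConvexOn hf.1 hs y (u - τ • w)
    have a2 := le_of_lipschitz_gradient hf x (-(τ • w))
    have a3 := le_of_strongConvexOn hf.1 hs x (-u + τ • w)
    have a4 := le_of_lipschitz_gradient hf y (τ • w)
    have e1 : y + (u - τ • w) = x + -(τ • w) := by rw [hu]; abel
    have e2 : x + (-u + τ • w) = y + τ • w := by rw [hu]; abel
    rw [e1] at a1
    rw [e2] at a3
    have b1 := a1.trans a2
    have b3 := a3.trans a4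
    have n1 : ‖u - τ • w‖ ^ 2 = ‖u‖ ^ 2 - 2 * τ * inner ℝ w u + τ ^ 2 * ‖w‖ ^ 2 := by
      rw [norm_sub_sq_real, inner_smul_right, norm_smul, mul_pow, Real.norm_eq_abs, sq_abs,
        real_inner_comm]; ring
    have n2 : ‖-u + τ • w‖ ^ 2 = ‖u - τ • w‖ ^ 2 := by
      rw [← norm_neg]; congr 2; abel
    have n3 : ‖τ • w‖ ^ 2 = τ ^ 2 * ‖w‖ ^ 2 := by
      rw [norm_smul, mul_pow, Real.norm_eq_abs, sq_abs]
    have i1 : inner ℝ (gradient f x) u - inner ℝ (gradient f y) u = inner ℝ w u + m * ‖u‖ ^ 2 := by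
      rw [← inner_sub_left, hw, inner_sub_left _ (m • u), inner_smul_left, real_inner_self_eq_norm_sq]
      simp
    have i2 : inner ℝ (gradient f x) w - inner ℝ (gradient f y) w = ‖w‖ ^ 2 + m * inner ℝ w u := by
      have : gradient f x - gradient f y = w + m • u := by rw [hw]; abel
      rw [← inner_sub_left, this, inner_add_left, inner_smul_left, real_inner_self_eq_norm_sq,
        real_inner_comm w u]
      simp
    rw [n2] at b3
    simp only [n1, norm_neg, n3, inner_sub_right, inner_add_right, inner_neg_right,
      inner_smul_right] at b1 b3
    have i2' := congrArg (fun z => τ * z) i2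
    rw [hL]
    nlinarith
  have hdec : (x - η • gradient f x) - (y - η • gradient f y) =
      (1 - η * m - η * L / 2) • u - η • (w - (L / 2) • u) := by
    rw [hw, hu]; module
  rcases le_or_gt L 0 with hL0 | hL0
  · have hw0 : w = 0 := by
      by_contra hne
      have hpos : 0 < ‖w‖ ^ 2 := by positivity
      -- For L ≤ 0 the left side of `key` grows without bound in τ unless w = 0; this τ already
      -- exceeds the right side.
      have := key ((|inner ℝ w u| + 1) / ‖w‖ ^ 2)
      set τ := (|inner ℝ w u| + 1) / ‖w‖ ^ 2 with hτ
      have e : τ * ‖w‖ ^ 2 = |inner ℝ w u| + 1 := div_mul_cancel₀ _ hpos.ne'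
      have e' : L * τ ^ 2 * ‖w‖ ^ 2 ≤ 0 :=
        mul_nonpos_of_nonpos_of_nonneg (mul_nonpos_of_nonpos_of_nonneg hL0 (sq_nonneg _)) hpos.le
      linarith [le_abs_self (inner ℝ w u), abs_nonneg (inner ℝ w u)]
    have : (x - η • gradient f x) - (y - η • gradient f y) = (1 - η * m) • u := by
      rw [hdec, hw0]; module
    rw [this, norm_smul, Real.norm_eq_abs]
    exact mul_le_mul_of_nonneg_right (le_max_left _ _) (norm_nonneg _)
  · have hk := key L⁻¹
    have e : 2 * L⁻¹ - L * L⁻¹ ^ 2 = L⁻¹ := by field_simp; ring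
    rw [e, inv_mul_le_iff₀ hL0] at hk
    have hball : ‖w - (L / 2) • u‖ ≤ L / 2 * ‖u‖ := by
      refine le_of_sq_le_sq ?_ (by positivity)
      rw [norm_sub_sq_real, inner_smul_right, norm_smul, Real.norm_eq_abs, abs_of_pos (half_pos hL0)]
      nlinarith
    rw [hdec]
    refine (norm_sub_le _ _).trans ?_
    rw [norm_smul, norm_smul, Real.norm_eq_abs, Real.norm_eq_abs, abs_of_nonneg hη]
    have h1 := abs_sub_add_le (1 - η * m) (η * L / 2)
    have e2 : 1 - η * m - 2 * (η * L / 2) = 1 - η * M := by rw [hL]; ring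
    rw [e2] at h1
    have h2 := mul_le_mul_of_nonneg_right h1 (norm_nonneg u)
    have h3 := mul_le_mul_of_nonneg_left hball hη
    linarith

end gradientStep

/-- The finite form of convexity: the supporting-line inequalities are averaged with the weights. It
serves for random mini-batches and random paths. -/
theorem gaussianTradeOff_sum_le {ι : Type*} {s : Finset ι} {μ : ℝ} (hμ : 0 ≤ μ) {w α β : ι → ℝ}
    (hw : ∀ i ∈ s, 0 ≤ w i) (hw1 : ∑ i ∈ s, w i = 1) (hα : ∀ i ∈ s, α i ∈ Set.Icc (0 : ℝ) 1)
    (hβ : ∀ i ∈ s, β i ≤ 1) (h : ∀ i ∈ s, gaussianTradeOff μ (α i) ≤ 1 - β i) :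
    gaussianTradeOff μ (∑ i ∈ s, w i * α i) ≤ 1 - ∑ i ∈ s, w i * β i := by
  refine GaussianDom.le_one_sub (fun z => ?_)
    (Finset.sum_nonneg fun i hi => mul_nonneg (hw i hi) (hα i hi).1) ?_
  · have := Finset.sum_le_sum fun i hi => mul_le_mul_of_nonneg_left
      (gaussianDom_of_le hμ (hα i hi).1 (hα i hi).2 (h i hi) z) (hw i hi)
    rw [← Finset.sum_mul, hw1, one_mul] at this
    refine le_trans (le_of_eq ?_) this
    rw [Finset.mul_sum, ← Finset.sum_sub_distrib]
    exact Finset.sum_congr rfl fun i _ => by ring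
  · rw [← hw1]
    exact Finset.sum_le_sum fun i hi => mul_le_of_le_one_right (hw i hi) (hβ i hi)

namespace DecSGD

variable {V Z : Type*} [Fintype V] [DecidableEq V] {d : ℕ} (A : DecSGD V Z d)

local notation "𝔼" => EuclideanSpace ℝ (Fin d)

/-! ### The projection and the noise -/

theorem inner_sub_proj_le (x : 𝔼) {y : 𝔼} (hy : y ∈ A.constr) :
    inner ℝ (x - A.proj x) (y - A.proj x) ≤ 0 := by
  refine (norm_eq_iInf_iff_real_inner_le_zero A.constr_convex (A.proj_mem x)).1 ?_ y hy
  have : Nonempty A.constr := ⟨⟨_, A.proj_mem x⟩⟩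
  refine le_antisymm (le_ciInf fun w => ?_) ?_
  · have := A.proj_le x w w.2
    rwa [dist_eq_norm, dist_eq_norm] at this
  · exact ciInf_le ⟨0, by rintro _ ⟨w, rfl⟩; exact norm_nonneg _⟩
      (⟨_, A.proj_mem x⟩ : A.constr)

theorem norm_proj_sub_le (x y : 𝔼) : ‖A.proj x - A.proj y‖ ≤ ‖x - y‖ := by
  have h1 := A.inner_sub_proj_le x (A.proj_mem y)
  have h2 := A.inner_sub_proj_le y (A.proj_mem x)
  have h3 : ‖A.proj x - A.proj y‖ ^ 2 ≤ inner ℝ (x - y) (A.proj x - A.proj y) := by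
    rw [← real_inner_self_eq_norm_sq]
    have e1 : inner ℝ (x - A.proj x) (A.proj y - A.proj x) =
        -inner ℝ (x - A.proj x) (A.proj x - A.proj y) := by
      rw [← inner_neg_right, neg_sub]
    rw [e1] at h1
    have e2 : inner ℝ (x - y) (A.proj x - A.proj y) = inner ℝ (x - A.proj x) (A.proj x - A.proj y)
        - inner ℝ (y - A.proj y) (A.proj x - A.proj y) +
          inner ℝ (A.proj x - A.proj y) (A.proj x - A.proj y) := by
      rw [← inner_sub_left, ← inner_add_left]; congr 1; abel
    linarith
  have h4 := real_inner_le_norm (x - y) (A.proj x - A.proj y)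
  by_contra hlt
  push Not at hlt
  have h5 : 0 < ‖A.proj x - A.proj y‖ := (norm_nonneg _).trans_lt hlt
  nlinarith

theorem measurable_proj : Measurable A.proj :=
  (LipschitzWith.of_dist_le_mul (K := 1) fun x y => by
    simpa [dist_eq_norm] using A.norm_proj_sub_le x y).continuous.measurable

theorem noise_pos : 0 < A.η * A.σ := mul_pos A.η_pos A.σ_pos

/-- The law of the projected Gaussian perturbation of `u`. -/
noncomputable def noiseLaw (u : 𝔼) : Measure 𝔼 :=
  (stdGaussian 𝔼).map fun N => A.proj (u - (A.η * A.σ) • N)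

theorem measurable_noise : Measurable fun q : 𝔼 × 𝔼 => A.proj (q.1 - (A.η * A.σ) • q.2) :=
  A.measurable_proj.comp (by fun_prop)

theorem measurable_noise_right (u : 𝔼) : Measurable fun N : 𝔼 => A.proj (u - (A.η * A.σ) • N) :=
  A.measurable_proj.comp (by fun_prop)

instance isProbabilityMeasure_noiseLaw (u : 𝔼) : IsProbabilityMeasure (A.noiseLaw u) :=
  Measure.isProbabilityMeasure_map (A.measurable_noise_right u).aemeasurable

theorem measurable_noiseLaw : Measurable A.noiseLaw :=
  measurable_map_prodMk (f := fun u N => A.proj (u - (A.η * A.σ) • N)) A.measurable_noise _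

theorem integral_noiseLaw (u : 𝔼) {φ : 𝔼 → ℝ} (hφ : IsTest φ) :
    ∫ x, φ x ∂A.noiseLaw u = ∫ N, φ (A.proj (u - (A.η * A.σ) • N)) ∂stdGaussian 𝔼 :=
  integral_map (A.measurable_noise_right u).aemeasurable hφ.measurable.aestronglyMeasurable

theorem gaussianTradeOff_noiseLaw {u u' : 𝔼} {r : ℝ} (hu : ‖u - u'‖ ≤ A.η * A.σ * r) {φ : 𝔼 → ℝ}
    (hφ : IsTest φ) :
    gaussianTradeOff r (∫ x, φ x ∂A.noiseLaw u) ≤ 1 - ∫ x, φ x ∂A.noiseLaw u' := by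
  rw [A.integral_noiseLaw u hφ, A.integral_noiseLaw u' hφ]
  exact gaussianTradeOff_le_of_dist A.noise_pos hu (hφ.comp A.measurable_proj)

/-! ### Local steps -/

/-- The gradient step with a fixed mini-batch. -/
noncomputable def gradMap (v : V) (data : Fin (A.sz v) → Z) (S : Finset (Fin (A.sz v))) (θ : 𝔼) : 𝔼 :=
  θ - A.η • A.batchGrad v data S θ

theorem measurable_gradient (f : 𝔼 → ℝ) : Measurable (gradient f) :=
  (InnerProductSpace.toDual ℝ 𝔼).symm.continuous.measurable.comp (measurable_fderiv ℝ f)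

theorem measurable_gradMap (v : V) (data : Fin (A.sz v) → Z) (S : Finset (Fin (A.sz v))) :
    Measurable (A.gradMap v data S) := by
  unfold gradMap batchGrad
  have := fun r => measurable_gradient (A.loss v (data r))
  fun_prop

theorem stepLaw_eq (v : V) (data : Fin (A.sz v) → Z) (θ : 𝔼) :
    A.stepLaw v data θ = ∑ S ∈ (Finset.univ : Finset (Fin (A.sz v))).powersetCard A.b,
      (((A.sz v).choose A.b : ℕ) : ENNReal)⁻¹ • A.noiseLaw (A.gradMap v data S θ) := by
  unfold stepLaw noiseLaw gradMap
  simp only [smul_add, smul_smul, sub_sub]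

theorem choose_pos (v : V) : 0 < (A.sz v).choose A.b := Nat.choose_pos (A.b_le v)

instance isProbabilityMeasure_stepLaw (v : V) (data : Fin (A.sz v) → Z) (θ : 𝔼) :
    IsProbabilityMeasure (A.stepLaw v data θ) := by
  constructor
  rw [stepLaw_eq, Measure.finsetSum_apply]
  simp only [Measure.smul_apply, measure_univ, smul_eq_mul, mul_one, Finset.sum_const,
    Finset.card_powersetCard, Finset.card_univ, Fintype.card_fin, nsmul_eq_mul]
  exact ENNReal.mul_inv_cancel (by exact_mod_cast (A.choose_pos v).ne') (ENNReal.natCast_ne_top _)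

theorem measurable_stepLaw (v : V) (data : Fin (A.sz v) → Z) : Measurable (A.stepLaw v data) := by
  refine Measure.measurable_of_measurable_coe _ fun s hs => ?_
  simp only [stepLaw_eq, Measure.finsetSum_apply, Measure.smul_apply, smul_eq_mul]
  exact Finset.measurable_sum _ fun S _ => ((Measure.measurable_coe hs).comp
    (A.measurable_noiseLaw.comp (A.measurable_gradMap v data S))).const_mul _

theorem integral_stepLaw (v : V) (data : Fin (A.sz v) → Z) (θ : 𝔼) {φ : 𝔼 → ℝ} (hφ : IsTest φ) :
    ∫ x, φ x ∂A.stepLaw v data θ = ∑ S ∈ (Finset.univ : Finset (Fin (A.sz v))).powersetCard A.b,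
      (((A.sz v).choose A.b : ℕ) : ℝ)⁻¹ * ∫ x, φ x ∂A.noiseLaw (A.gradMap v data S θ) := by
  have hne : (((A.sz v).choose A.b : ℕ) : ENNReal)⁻¹ ≠ ⊤ :=
    ENNReal.inv_ne_top.2 (by exact_mod_cast (A.choose_pos v).ne')
  rw [stepLaw_eq, integral_finsetSum_measure fun S _ => (hφ.integrable _).smul_measure hne]
  simp [integral_smul_measure]

/-- Iterated local steps keep probability laws. -/
theorem isProbabilityMeasure_iterate (v : V) (data : Fin (A.sz v) → Z) (k : ℕ) (μ : Measure 𝔼)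
    [IsProbabilityMeasure μ] :
    IsProbabilityMeasure ((fun ρ : Measure 𝔼 => ρ.bind (A.stepLaw v data))^[k] μ) := by
  induction k with
  | zero => simpa
  | succ k ih =>
    rw [Function.iterate_succ_apply']
    exact isProbabilityMeasure_bind (A.measurable_stepLaw v data) _

instance isProbabilityMeasure_roundLaw (v : V) (data : Fin (A.sz v) → Z) (μ : Measure 𝔼)
    [IsProbabilityMeasure μ] : IsProbabilityMeasure (A.roundLaw v data μ) :=
  A.isProbabilityMeasure_iterate v data A.K μ

/-! ### Tests applied after further steps -/

/-- The test `φ` applied after one more local step. -/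
noncomputable def stepTest (v : V) (data : Fin (A.sz v) → Z) (φ : 𝔼 → ℝ) (θ : 𝔼) : ℝ :=
  ∫ x, φ x ∂A.stepLaw v data θ

theorem isTest_stepTest (v : V) (data : Fin (A.sz v) → Z) {φ : 𝔼 → ℝ} (hφ : IsTest φ) :
    IsTest (A.stepTest v data φ) := hφ.integral_kernel' (A.measurable_stepLaw v data)

theorem isTest_stepTest_iterate (v : V) (data : Fin (A.sz v) → Z) {φ : 𝔼 → ℝ} (hφ : IsTest φ)
    (k : ℕ) : IsTest ((A.stepTest v data)^[k] φ) := by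
  induction k with
  | zero => exact hφ
  | succ k ih =>
    rw [Function.iterate_succ_apply']
    exact A.isTest_stepTest v data ih

theorem integral_iterate (v : V) (data : Fin (A.sz v) → Z) (k : ℕ) {φ : 𝔼 → ℝ} (hφ : IsTest φ)
    (μ : Measure 𝔼) [IsProbabilityMeasure μ] :
    ∫ x, φ x ∂((fun ρ : Measure 𝔼 => ρ.bind (A.stepLaw v data))^[k] μ) =
      ∫ x, (A.stepTest v data)^[k] φ x ∂μ := by
  induction k generalizing φ with
  | zero => rfl
  | succ k ih =>
    have := A.isProbabilityMeasure_iterate v data k μ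
    rw [Function.iterate_succ_apply', hφ.integral_bind (A.measurable_stepLaw v data),
      Function.iterate_succ_apply]
    exact ih (A.isTest_stepTest v data hφ)

/-- The values of `g` at points at distance at most `ρ` satisfy the trade-off `G_{rρ}`. -/
def SmoothTest (r : ℝ) (g : 𝔼 → ℝ) : Prop :=
  ∀ (ρ : ℝ) (x y : 𝔼), ‖x - y‖ ≤ ρ → gaussianTradeOff (r * ρ) (g x) ≤ 1 - g y

/-- All gradient steps are `c`-Lipschitz. -/
def Contracting (c : ℝ) : Prop :=
  ∀ (v : V) (data : Fin (A.sz v) → Z) (S : Finset (Fin (A.sz v))), S.card = A.b →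
    ∀ x y, ‖A.gradMap v data S x - A.gradMap v data S y‖ ≤ c * ‖x - y‖

variable {A}

/-- Noise as smoothing: for each common batch the centers are at most cρ apart, which noise of scale
ησ turns into a Gaussian trade-off whatever the test. -/
theorem Contracting.smoothTest_stepTest {c : ℝ} (h : A.Contracting c) (hc : 0 ≤ c) (v : V)
    (data : Fin (A.sz v) → Z) {φ : 𝔼 → ℝ} (hφ : IsTest φ) :
    SmoothTest (c / (A.η * A.σ)) (A.stepTest v data φ) := by
  intro ρ x x' hx
  have hρ : 0 ≤ ρ := (norm_nonneg _).trans hx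
  have hC : (0 : ℝ) < (A.sz v).choose A.b := by exact_mod_cast A.choose_pos v
  rw [stepTest, stepTest, A.integral_stepLaw v data x hφ, A.integral_stepLaw v data x' hφ]
  refine gaussianTradeOff_sum_le (mul_nonneg (div_nonneg hc A.noise_pos.le) hρ)
    (fun _ _ => (inv_pos.2 hC).le) ?_ (fun S _ => ⟨hφ.integral_nonneg _, hφ.integral_le_one _⟩)
    (fun S _ => hφ.integral_le_one _) fun S hS => A.gaussianTradeOff_noiseLaw ?_ hφ
  · simp [Finset.card_powersetCard, hC.ne']
  · rw [← mul_assoc, mul_div_cancel₀ _ A.noise_pos.ne']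
    exact (h v data S (Finset.mem_powersetCard.1 hS).2 x x').trans (mul_le_mul_of_nonneg_left hx hc)

/-- Noise as coupling: with the same batch and the same noise, a displacement is only shrunk by c
before the smooth test is applied, and convexity averages over the noise. -/
theorem Contracting.smoothTest_stepTest_of_smoothTest {c : ℝ} (h : A.Contracting c) (hc : 0 ≤ c)
    (v : V) (data : Fin (A.sz v) → Z) {φ : 𝔼 → ℝ} (hφ : IsTest φ) {r : ℝ} (hr : 0 ≤ r)
    (hs : SmoothTest r φ) : SmoothTest (c * r) (A.stepTest v data φ) := by
  intro ρ x x' hx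
  have hρ : 0 ≤ ρ := (norm_nonneg _).trans hx
  have hC : (0 : ℝ) < (A.sz v).choose A.b := by exact_mod_cast A.choose_pos v
  have hμ : 0 ≤ c * r * ρ := by positivity
  rw [stepTest, stepTest, A.integral_stepLaw v data x hφ, A.integral_stepLaw v data x' hφ]
  refine gaussianTradeOff_sum_le hμ
    (fun _ _ => (inv_pos.2 hC).le) ?_ (fun S _ => ⟨hφ.integral_nonneg _, hφ.integral_le_one _⟩)
    (fun S _ => hφ.integral_le_one _) fun S hS => ?_
  · simp [Finset.card_powersetCard, hC.ne']
  · rw [A.integral_noiseLaw _ hφ, A.integral_noiseLaw _ hφ]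
    refine gaussianTradeOff_integral_le _ hμ (hφ.comp (A.measurable_noise_right _))
      (hφ.comp (A.measurable_noise_right _)) fun N => ?_
    have e : c * r * ρ = r * (c * ρ) := by ring
    rw [e]
    refine hs _ _ _ ((A.norm_proj_sub_le _ _).trans ?_)
    rw [sub_sub_sub_cancel_right]
    exact (h v data S (Finset.mem_powersetCard.1 hS).2 x x').trans (mul_le_mul_of_nonneg_left hx hc)

theorem Contracting.smoothTest_iterate_of_smoothTest {c : ℝ} (h : A.Contracting c) (hc : 0 ≤ c)
    (v : V) (data : Fin (A.sz v) → Z) {φ : 𝔼 → ℝ} (hφ : IsTest φ) {r : ℝ} (hr : 0 ≤ r)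
    (hs : SmoothTest r φ) (k : ℕ) : SmoothTest (c ^ k * r) ((A.stepTest v data)^[k] φ) := by
  induction k with
  | zero => simpa using hs
  | succ k ih =>
    rw [Function.iterate_succ_apply', pow_succ', mul_assoc]
    exact h.smoothTest_stepTest_of_smoothTest hc v data (A.isTest_stepTest_iterate v data hφ k)
      (by positivity) ih

theorem Contracting.smoothTest_iterate {c : ℝ} (h : A.Contracting c) (hc : 0 ≤ c)
    (v : V) (data : Fin (A.sz v) → Z) {φ : 𝔼 → ℝ} (hφ : IsTest φ) {k : ℕ} (hk : 1 ≤ k) :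
    SmoothTest (c ^ k / (A.η * A.σ)) ((A.stepTest v data)^[k] φ) := by
  obtain ⟨k, rfl⟩ : ∃ l, k = l + 1 := ⟨k - 1, by omega⟩
  rw [Function.iterate_succ_apply, pow_succ, mul_div_assoc]
  exact h.smoothTest_iterate_of_smoothTest hc v data (A.isTest_stepTest v data hφ)
    (div_nonneg hc A.noise_pos.le) (h.smoothTest_stepTest hc v data hφ) k

variable (A)

/-- The law of the model after further rounds of the users `u s` with the given data. -/
noncomputable def roundsLaw {n : ℕ} (u : Fin n → Σ v : V, (Fin (A.sz v) → Z)) (μ : Measure 𝔼) :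
    Measure 𝔼 :=
  Fin.foldl n (fun μ s => A.roundLaw (u s).1 (u s).2 μ) μ

theorem roundsLaw_succ {n : ℕ} (u : Fin (n + 1) → Σ v : V, (Fin (A.sz v) → Z)) (μ : Measure 𝔼) :
    A.roundsLaw u μ = A.roundLaw (u (Fin.last n)).1 (u (Fin.last n)).2
      (A.roundsLaw (fun s => u s.castSucc) μ) := by
  rw [roundsLaw, Fin.foldl_succ_last]; rfl

instance isProbabilityMeasure_roundsLaw {n : ℕ} (u : Fin n → Σ v : V, (Fin (A.sz v) → Z))
    (μ : Measure 𝔼) [IsProbabilityMeasure μ] : IsProbabilityMeasure (A.roundsLaw u μ) := by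
  induction n with
  | zero => simpa [roundsLaw]
  | succ n ih =>
    have := ih fun s => u s.castSucc
    rw [roundsLaw_succ]
    infer_instance

/-- The rounds are pulled back onto the test, last one first. The final local step creates the
smoothness and each earlier one contributes another factor c. -/
theorem exists_test_roundsLaw {n : ℕ} (u : Fin n → Σ v : V, (Fin (A.sz v) → Z)) {φ : 𝔼 → ℝ}
    (hφ : IsTest φ) : ∃ g : 𝔼 → ℝ, IsTest g ∧
      (∀ (μ : Measure 𝔼) [IsProbabilityMeasure μ], ∫ x, φ x ∂A.roundsLaw u μ = ∫ x, g x ∂μ) ∧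
      ∀ c, A.Contracting c → 0 ≤ c →
        (∀ r, 0 ≤ r → SmoothTest r φ → SmoothTest (c ^ (n * A.K) * r) g) ∧
        (1 ≤ n → SmoothTest (c ^ (n * A.K) / (A.η * A.σ)) g) := by
  induction n generalizing φ with
  | zero =>
    refine ⟨φ, hφ, fun μ _ => by simp [roundsLaw], fun c _ _ => ⟨fun r _ h => by simpa using h, ?_⟩⟩
    intro h; omega
  | succ n ih =>
    set v := (u (Fin.last n)).1
    set data := (u (Fin.last n)).2
    obtain ⟨g, hg, hint, hsm⟩ := ih (fun s => u s.castSucc) (A.isTest_stepTest_iterate v data hφ A.K)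
    refine ⟨g, hg, fun μ _ => ?_, fun c hcon hc => ⟨fun r hr hs => ?_, fun _ => ?_⟩⟩
    · rw [roundsLaw_succ, ← hint μ]
      exact A.integral_iterate v data A.K hφ _
    · have := (hsm c hcon hc).1 _ (by positivity)
        (hcon.smoothTest_iterate_of_smoothTest hc v data hφ hr hs A.K)
      rwa [← mul_assoc, ← pow_add, ← Nat.succ_mul] at this
    · have := (hsm c hcon hc).1 _ (div_nonneg (pow_nonneg hc _) A.noise_pos.le)
        (hcon.smoothTest_iterate hc v data hφ A.K_pos)
      rwa [← mul_div_assoc, ← pow_add, ← Nat.succ_mul] at this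

/-- Every admissible path begins at i and only its round 0 depends on D. The remaining rounds,
averaged over paths with the conditional path weights, form one and the same test for both runs. -/
theorem exists_test_viewLaw (i j : V) (n : ℕ) (hhit : 0 < A.hitProb i j (n + 1)) (E : A.Dataset)
    {φ : 𝔼 → ℝ} (hφ : IsTest φ) : ∃ g : 𝔼 → ℝ, IsTest g ∧
      (∀ D : A.Dataset, ∫ x, φ x ∂A.viewLaw i j (n + 1) (A.singlePass D E) =
        ∫ x, g x ∂A.roundLaw i (D i) A.init) ∧
      ∀ c, A.Contracting c → 0 ≤ c → 1 ≤ n → SmoothTest (c ^ (n * A.K) / (A.η * A.σ)) g := by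
  have := A.init_prob
  choose g hg hint hsm using fun p : Fin (n + 1 + 1) → V =>
    A.exists_test_roundsLaw (n := n) (fun s => ⟨p s.succ.castSucc, E (p s.succ.castSucc)⟩) hφ
  set w : (Fin (n + 1 + 1) → V) → ℝ := fun p => A.pathWeight p / A.hitProb i j (n + 1)
  have hw : ∀ p ∈ firstHitPaths i j (n + 1), 0 ≤ w p := fun p _ =>
    div_nonneg (Finset.prod_nonneg fun s _ => A.W_stoch.1 _ _) hhit.le
  have hw1 : ∑ p ∈ firstHitPaths i j (n + 1), w p = 1 := by
    rw [← Finset.sum_div]; exact div_self hhit.ne'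
  have hpath : ∀ (D : A.Dataset), ∀ p ∈ firstHitPaths i j (n + 1),
      A.pathLaw (A.singlePass D E) p =
        A.roundsLaw (n := n) (fun s => ⟨p s.succ.castSucc, E (p s.succ.castSucc)⟩)
          (A.roundLaw i (D i) A.init) := by
    intro D p hp
    have hp0 : p 0 = i := by
      simp only [firstHitPaths, Finset.mem_filter] at hp; exact hp.2.1
    subst hp0
    rw [pathLaw, Fin.foldl_succ]
    rfl
  refine ⟨fun x => ∑ p ∈ firstHitPaths i j (n + 1), w p * g p x, ⟨?_, fun x => ?_, fun x => ?_⟩,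
    fun D => ?_, fun c hcon hc hn ρ x x' hx => ?_⟩
  · exact Finset.measurable_sum _ fun p _ => (hg p).measurable.const_mul _
  · exact Finset.sum_nonneg fun p hp => mul_nonneg (hw p hp) ((hg p).nonneg x)
  · rw [← hw1]
    exact Finset.sum_le_sum fun p hp => mul_le_of_le_one_right (hw p hp) ((hg p).le_one x)
  · have hprob : ∀ p ∈ firstHitPaths i j (n + 1),
        IsProbabilityMeasure (A.pathLaw (A.singlePass D E) p) := fun p hp => by
      rw [hpath D p hp]; infer_instance
    rw [viewLaw, integral_finsetSum_measure fun p hp => by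
      have := hprob p hp
      exact (hφ.integrable _).smul_measure ENNReal.ofReal_ne_top,
      integral_finsetSum _ fun p _ => ((hg p).integrable _).const_mul _]
    refine Finset.sum_congr rfl fun p hp => ?_
    rw [integral_smul_measure, ENNReal.toReal_ofReal (hw p hp), smul_eq_mul, hpath D p hp, hint,
      integral_const_mul]
  · have hρ : 0 ≤ ρ := (norm_nonneg _).trans hx
    have := A.noise_pos
    exact gaussianTradeOff_sum_le (by positivity) hw hw1
      (fun p _ => ⟨(hg p).nonneg x, (hg p).le_one x⟩) (fun p _ => (hg p).le_one x')
      fun p _ => (hsm p c hcon hc).2 hn ρ x x' hx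

end DecSGD

theorem sum_powersetCard_eq_exchange' {n b : ℕ} (r : Fin n) (hb : 1 ≤ b) (hbn : b < n)
    (F : Finset (Fin n) → ENNReal) :
    ∑ S ∈ (Finset.univ : Finset (Fin n)).powersetCard b, ((n.choose b : ℕ) : ENNReal)⁻¹ * F S =
      ∑ q ∈ exchangeIndex r (b - 1), ENNReal.ofReal (((exchangeIndex r (b - 1)).card : ℝ)⁻¹) *
        (ENNReal.ofReal (1 - (b : ℝ) / n) * F (insert q.2 q.1) +
          ENNReal.ofReal ((b : ℝ) / n) * F (insert r q.1)) := by
  obtain ⟨b, rfl⟩ : ∃ c, b = c + 1 := ⟨b - 1, by omega⟩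
  exact sum_powersetCard_eq_exchange hbn F

namespace DecSGD

variable {V Z : Type*} [Fintype V] [DecidableEq V] {d : ℕ} (A : DecSGD V Z d)

local notation "𝔼" => EuclideanSpace ℝ (Fin d)

/-! ### Steps with and without the changed record -/

variable {A} in
theorem GradSensitivity.norm_sub_le {Δ : ℝ} (h : A.GradSensitivity Δ) (v : V) (z z' : Z) (θ : 𝔼) :
    ‖(A.b : ℝ)⁻¹ • (gradient (A.loss v z) θ - gradient (A.loss v z') θ)‖ ≤ Δ := by
  let k₀ : Fin A.b := ⟨0, A.b_pos⟩
  -- The sensitivity is applied to a batch consisting of copies of z with one copy replaced by z';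
  -- all other terms cancel, so a single exchange is bounded whatever the rest of the batch.
  have := h v (fun _ => z) (Function.update (fun _ => z) k₀ z') k₀
    (fun k hk => by simp [Function.update_of_ne hk]) θ
  rw [← smul_sub, ← Finset.sum_sub_distrib, Finset.sum_eq_single k₀] at this
  · simpa using this
  · intro k _ hk; simp [Function.update_of_ne hk]
  · intro hk; exact absurd (Finset.mem_univ _) hk

variable {A} in
theorem GradSensitivity.norm_gradMap_sub_le {Δ : ℝ} (h : A.GradSensitivity Δ) (v : V)
    {data data' : Fin (A.sz v) → Z} {T : Finset (Fin (A.sz v))} {x x' : Fin (A.sz v)} (hx : x ∉ T)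
    (hx' : x' ∉ T) (hT : ∀ y ∈ T, data y = data' y) (θ : 𝔼) :
    ‖A.gradMap v data (insert x T) θ - A.gradMap v data' (insert x' T) θ‖ ≤ A.η * Δ := by
  have hsum : ∑ y ∈ T, gradient (A.loss v (data y)) θ = ∑ y ∈ T, gradient (A.loss v (data' y)) θ :=
    Finset.sum_congr rfl fun y hy => by rw [hT y hy]
  have e : A.gradMap v data (insert x T) θ - A.gradMap v data' (insert x' T) θ =
      A.η • ((A.b : ℝ)⁻¹ • (gradient (A.loss v (data' x')) θ - gradient (A.loss v (data x)) θ)) := by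
    rw [gradMap, gradMap, batchGrad, batchGrad, Finset.sum_insert hx, Finset.sum_insert hx', hsum]
    module
  rw [e, norm_smul, Real.norm_eq_abs, abs_of_pos A.η_pos]
  exact mul_le_mul_of_nonneg_left (h.norm_sub_le v _ _ θ) A.η_pos.le

/-- `ψ` is a gradient step with some mini-batch. -/
def IsGradMap (ψ : 𝔼 → 𝔼) : Prop :=
  ∃ (v : V) (data : Fin (A.sz v) → Z) (S : Finset (Fin (A.sz v))), S.card = A.b ∧
    ψ = A.gradMap v data S

variable {A} in
theorem IsGradMap.measurable {ψ : 𝔼 → 𝔼} (h : A.IsGradMap ψ) : Measurable ψ := by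
  obtain ⟨v, data, S, -, rfl⟩ := h
  exact A.measurable_gradMap v data S

variable {A} in
theorem IsGradMap.norm_sub_le {ψ : 𝔼 → 𝔼} (h : A.IsGradMap ψ) {c : ℝ} (hc : A.Contracting c)
    (x y : 𝔼) : ‖ψ x - ψ y‖ ≤ c * ‖x - y‖ := by
  obtain ⟨v, data, S, hS, rfl⟩ := h
  exact hc v data S hS x y

/-- The sampling rate of user `v`. -/
noncomputable def rate (v : V) : ℝ := (A.b : ℝ) / A.sz v

theorem sz_pos (v : V) : 0 < A.sz v := lt_of_lt_of_le A.b_pos (A.b_le v)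

theorem rate_nonneg (v : V) : 0 ≤ A.rate v := div_nonneg (Nat.cast_nonneg _) (Nat.cast_nonneg _)

theorem rate_le_one (v : V) : A.rate v ≤ 1 := by
  rw [rate, div_le_one (by exact_mod_cast A.sz_pos v)]
  exact_mod_cast A.b_le v

/-- The steps of a user on two datasets as averages over a common index set: with probability
`1 - p` both make the step `ψ₀`, otherwise they make the steps `ψ₁` and `ψ₁'`. All three are at
distance at most `δ`. -/
structure StepSplit (v : V) (data data' : Fin (A.sz v) → Z) (δ : ℝ) where
  ι : Type
  I : Finset ι
  w : ι → ℝ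
  ψ₀ : ι → 𝔼 → 𝔼
  ψ₁ : ι → 𝔼 → 𝔼
  ψ₁' : ι → 𝔼 → 𝔼
  w_nonneg : ∀ q, 0 ≤ w q
  sum_w : ∑ q ∈ I, w q = 1
  grad₀ : ∀ q ∈ I, A.IsGradMap (ψ₀ q)
  grad₁ : ∀ q ∈ I, A.IsGradMap (ψ₁ q)
  grad₁' : ∀ q ∈ I, A.IsGradMap (ψ₁' q)
  dist₀₁ : ∀ q ∈ I, ∀ θ, ‖ψ₀ q θ - ψ₁ q θ‖ ≤ δ
  dist₀₁' : ∀ q ∈ I, ∀ θ, ‖ψ₀ q θ - ψ₁' q θ‖ ≤ δ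
  dist₁₁' : ∀ q ∈ I, ∀ θ, ‖ψ₁ q θ - ψ₁' q θ‖ ≤ δ
  law : ∀ θ, A.stepLaw v data θ = ∑ q ∈ I, ENNReal.ofReal (w q) •
    (ENNReal.ofReal (1 - A.rate v) • A.noiseLaw (ψ₀ q θ) +
      ENNReal.ofReal (A.rate v) • A.noiseLaw (ψ₁ q θ))
  law' : ∀ θ, A.stepLaw v data' θ = ∑ q ∈ I, ENNReal.ofReal (w q) •
    (ENNReal.ofReal (1 - A.rate v) • A.noiseLaw (ψ₀ q θ) +
      ENNReal.ofReal (A.rate v) • A.noiseLaw (ψ₁' q θ))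

/-- A batch that avoids r has the same gradient under `data` and `data₀`. Choosing one `data₀` for
both runs makes their common steps literally equal. -/
theorem stepLaw_eq_exchange {v : V} (r : Fin (A.sz v)) (hb : A.b < A.sz v)
    (data data₀ : Fin (A.sz v) → Z) (h : ∀ r', r' ≠ r → data r' = data₀ r') (θ : 𝔼) :
    A.stepLaw v data θ = ∑ q ∈ exchangeIndex r (A.b - 1),
      ENNReal.ofReal (((exchangeIndex r (A.b - 1)).card : ℝ)⁻¹) •
      (ENNReal.ofReal (1 - A.rate v) • A.noiseLaw (A.gradMap v data₀ (insert q.2 q.1) θ) +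
        ENNReal.ofReal (A.rate v) • A.noiseLaw (A.gradMap v data (insert r q.1) θ)) := by
  ext s hs
  rw [stepLaw_eq]
  simp only [Measure.finsetSum_apply, Measure.smul_apply, Measure.add_apply, smul_eq_mul]
  rw [sum_powersetCard_eq_exchange' r A.b_pos hb
    fun S => A.noiseLaw (A.gradMap v data S θ) s]
  refine Finset.sum_congr rfl fun q hq => ?_
  rw [mem_exchangeIndex] at hq
  have : A.gradMap v data (insert q.2 q.1) θ = A.gradMap v data₀ (insert q.2 q.1) θ := by
    rw [gradMap, gradMap, batchGrad, batchGrad]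
    congr 3
    refine Finset.sum_congr rfl fun y hy => ?_
    rw [h y]
    rintro rfl
    rcases Finset.mem_insert.1 hy with rfl | hy
    · exact hq.2.1 rfl
    · exact hq.1.1 hy
  rw [this]; rfl

theorem stepLaw_eq_of_full {v : V} (hb : A.b = A.sz v) (data : Fin (A.sz v) → Z) (θ : 𝔼) :
    A.stepLaw v data θ = A.noiseLaw (A.gradMap v data Finset.univ θ) := by
  rw [stepLaw_eq, hb]
  have : (Finset.univ : Finset (Fin (A.sz v))).powersetCard (A.sz v) = {Finset.univ} := by
    have h := Finset.powersetCard_self (Finset.univ : Finset (Fin (A.sz v)))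
    rwa [Finset.card_fin] at h
  rw [this]
  simp

theorem nonempty_stepSplit {Δ : ℝ} (hΔ : A.GradSensitivity Δ) {i : V} {D D' : A.Dataset}
    (h : A.RecordNeighbours i D D') : Nonempty (A.StepSplit i (D i) (D' i) (A.η * Δ)) := by
  obtain ⟨-, r, hr⟩ := h
  rcases (A.b_le i).lt_or_eq with hb | hb
  · have hcard : 0 < (exchangeIndex r (A.b - 1)).card := by
      have := A.b_pos
      rw [card_exchangeIndex]
      exact Nat.mul_pos (Nat.choose_pos (by omega)) (by omega)
    have hcardR : ((exchangeIndex r (A.b - 1)).card : ℝ) ≠ 0 := by exact_mod_cast hcard.ne'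
    have hins : ∀ q ∈ exchangeIndex r (A.b - 1), (insert r q.1).card = A.b ∧
        (insert q.2 q.1).card = A.b := fun q hq => by
      rw [mem_exchangeIndex] at hq
      have := A.b_pos
      rw [Finset.card_insert_of_notMem hq.1.1, Finset.card_insert_of_notMem hq.2.2, hq.1.2]
      omega
    refine ⟨⟨_, exchangeIndex r (A.b - 1), fun _ => ((exchangeIndex r (A.b - 1)).card : ℝ)⁻¹,
      fun q => A.gradMap i (D i) (insert q.2 q.1), fun q => A.gradMap i (D i) (insert r q.1),
      fun q => A.gradMap i (D' i) (insert r q.1), fun _ => by positivity, by simp [hcardR],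
      fun q hq => ⟨i, D i, _, (hins q hq).2, rfl⟩, fun q hq => ⟨i, D i, _, (hins q hq).1, rfl⟩,
      fun q hq => ⟨i, D' i, _, (hins q hq).1, rfl⟩, fun q hq θ => ?_, fun q hq θ => ?_,
      fun q hq θ => ?_, A.stepLaw_eq_exchange r hb (D i) (D i) fun _ _ => rfl,
      A.stepLaw_eq_exchange r hb (D' i) (D i) fun r' hr' => (hr r' hr').symm⟩⟩
    all_goals rw [mem_exchangeIndex] at hq
    · exact hΔ.norm_gradMap_sub_le i hq.2.2 hq.1.1 (fun _ _ => rfl) θ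
    · exact hΔ.norm_gradMap_sub_le i hq.2.2 hq.1.1
        (fun y hy => hr y fun h => hq.1.1 (h ▸ hy)) θ
    · exact hΔ.norm_gradMap_sub_le i hq.1.1 hq.1.1
        (fun y hy => hr y fun h => hq.1.1 (h ▸ hy)) θ
  -- With full batches there is no record to exchange with. A single index of sampling rate 1 is
  -- used; the step ψ₀ then has probability 0 and is set to that of the first dataset.
  · have hu : insert r (Finset.univ.erase r) = Finset.univ := Finset.insert_erase (Finset.mem_univ r)
    have hcard : (Finset.univ : Finset (Fin (A.sz i))).card = A.b := by simp [hb]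
    have hrate : A.rate i = 1 := by
      rw [rate, hb]; exact div_self (by exact_mod_cast (A.sz_pos i).ne')
    have hdist : ∀ θ, ‖A.gradMap i (D i) Finset.univ θ - A.gradMap i (D' i) Finset.univ θ‖ ≤
        A.η * Δ := fun θ => by
      rw [← hu]
      exact hΔ.norm_gradMap_sub_le i (Finset.notMem_erase r _) (Finset.notMem_erase r _)
        (fun y hy => hr y (Finset.ne_of_mem_erase hy)) θ
    have h0 : 0 ≤ A.η * Δ := (norm_nonneg _).trans (hdist 0)
    refine ⟨⟨Unit, Finset.univ, fun _ => 1, fun _ => A.gradMap i (D i) Finset.univ,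
      fun _ => A.gradMap i (D i) Finset.univ, fun _ => A.gradMap i (D' i) Finset.univ,
      fun _ => zero_le_one, by simp, fun _ _ => ⟨i, D i, _, hcard, rfl⟩,
      fun _ _ => ⟨i, D i, _, hcard, rfl⟩, fun _ _ => ⟨i, D' i, _, hcard, rfl⟩,
      fun _ _ θ => by simpa using h0, fun _ _ => hdist, fun _ _ => hdist, fun θ => ?_, fun θ => ?_⟩⟩
    · rw [A.stepLaw_eq_of_full hb]; simp [hrate]
    · rw [A.stepLaw_eq_of_full hb]; simp [hrate]

theorem delta_nonneg {Δ : ℝ} (hΔ : A.GradSensitivity Δ) {i : V} {D D' : A.Dataset}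
    (h : A.RecordNeighbours i D D') : 0 ≤ Δ := by
  obtain ⟨-, r, -⟩ := h
  exact (norm_nonneg _).trans (hΔ.norm_sub_le i (D i r) (D i r) 0)

variable {A}

theorem integral_mixture {ι : Type*} {I : Finset ι} {w : ι → ℝ} (hw : ∀ q, 0 ≤ w q) {p : ℝ}
    (hp0 : 0 ≤ p) (hp1 : p ≤ 1) {Ω : Type*} [MeasurableSpace Ω] {μ ν : ι → Measure Ω}
    (hμ : ∀ q ∈ I, IsProbabilityMeasure (μ q)) (hν : ∀ q ∈ I, IsProbabilityMeasure (ν q))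
    {φ : Ω → ℝ} (hφ : IsTest φ) :
    ∫ x, φ x ∂(∑ q ∈ I, ENNReal.ofReal (w q) •
      (ENNReal.ofReal (1 - p) • μ q + ENNReal.ofReal p • ν q)) =
    ∑ q ∈ I, w q * ((1 - p) * (∫ x, φ x ∂μ q) + p * ∫ x, φ x ∂ν q) := by
  have h1 : ∀ q ∈ I, Integrable φ (ENNReal.ofReal (1 - p) • μ q) := fun q hq => by
    have := hμ q hq
    exact (hφ.integrable _).smul_measure ENNReal.ofReal_ne_top
  have h2 : ∀ q ∈ I, Integrable φ (ENNReal.ofReal p • ν q) := fun q hq => by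
    have := hν q hq
    exact (hφ.integrable _).smul_measure ENNReal.ofReal_ne_top
  rw [integral_finsetSum_measure fun q hq =>
    ((h1 q hq).add_measure (h2 q hq)).smul_measure ENNReal.ofReal_ne_top]
  refine Finset.sum_congr rfl fun q hq => ?_
  rw [integral_smul_measure, integral_add_measure (h1 q hq) (h2 q hq), integral_smul_measure,
    integral_smul_measure, ENNReal.toReal_ofReal (hw q), ENNReal.toReal_ofReal (sub_nonneg.2 hp1),
    ENNReal.toReal_ofReal hp0]
  simp

theorem gaussianTradeOff_icc {μ : ℝ} (hμ : 0 ≤ μ) :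
    (∀ x ∈ Set.Icc (0 : ℝ) 1, 0 ≤ gaussianTradeOff μ x) ∧
      ∀ x ∈ Set.Icc (0 : ℝ) 1, gaussianTradeOff μ x ≤ 1 - x :=
  ⟨fun _ _ => gaussianTradeOff_nonneg _ _, fun _ hx => gaussianTradeOff_le_one_sub hμ hx.2 hx.1⟩

theorem exists_isTradeOffPair_sampling_gaussian (v : V) {μ : ℝ} (hμ : 0 ≤ μ) :
    ∃ P Q : ProbabilityMeasure ℝ,
      IsTradeOffPair (samplingOp (A.rate v) (gaussianTradeOff μ)) P Q :=
  exists_isTradeOffPair_samplingOp (A.rate_nonneg v) (A.rate_le_one v) (gaussianTradeOff_icc hμ).1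
    (gaussianTradeOff_icc hμ).2

/-- One step of the two runs from the same model is a subsampled Gaussian mechanism. -/
theorem StepSplit.samplingOp_le {v : V} {data data' : Fin (A.sz v) → Z} {δ : ℝ}
    (S : A.StepSplit v data data' δ) {μ : ℝ} (hμ : 0 ≤ μ) (hδ : δ ≤ A.η * A.σ * μ) (θ : 𝔼)
    {φ : 𝔼 → ℝ} (hφ : IsTest φ) :
    samplingOp (A.rate v) (gaussianTradeOff μ) (∫ x, φ x ∂A.stepLaw v data θ) ≤
      1 - ∫ x, φ x ∂A.stepLaw v data' θ := by
  rw [S.law, S.law', integral_mixture S.w_nonneg (A.rate_nonneg v) (A.rate_le_one v)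
    (fun _ _ => inferInstance) (fun _ _ => inferInstance) hφ,
    integral_mixture S.w_nonneg (A.rate_nonneg v) (A.rate_le_one v)
    (fun _ _ => inferInstance) (fun _ _ => inferInstance) hφ]
  refine (SamplingDom.sum (fun q _ => S.w_nonneg q) S.sum_w fun q hq => ?_).le_one_sub
  have hm : ∀ u, (∫ x, φ x ∂A.noiseLaw u) ∈ Set.Icc (0 : ℝ) 1 := fun u =>
    ⟨hφ.integral_nonneg _, hφ.integral_le_one _⟩
  have hcompl : ∀ u u', ‖u - u'‖ ≤ A.η * A.σ * μ →
      gaussianTradeOff μ (1 - ∫ x, φ x ∂A.noiseLaw u) ≤ ∫ x, φ x ∂A.noiseLaw u' := fun u u' h => by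
    have := A.gaussianTradeOff_noiseLaw h hφ.one_sub
    rw [hφ.integral_one_sub, hφ.integral_one_sub] at this
    linarith
  refine samplingDom_mix (A.rate_nonneg v) (A.rate_le_one v) (gaussianTradeOff_icc hμ).1
    (gaussianTradeOff_icc hμ).2 (hm _) (hm _) (hm _)
    (A.gaussianTradeOff_noiseLaw ((S.dist₀₁' q hq θ).trans hδ) hφ)
    (A.gaussianTradeOff_noiseLaw ((S.dist₁₁' q hq θ).trans hδ) hφ)
    (hcompl _ _ ((S.dist₀₁ q hq θ).trans hδ)) (hcompl _ _ ?_)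
  rw [norm_sub_rev]
  exact (S.dist₁₁' q hq θ).trans hδ

/-- Adaptive composition: the one-step bound holds from every model θ, so each further step
contributes one independent copy of the pair (P, Q). -/
theorem StepSplit.dominated_iterate {v : V} {data data' : Fin (A.sz v) → Z} {δ : ℝ}
    (S : A.StepSplit v data data' δ) {μ : ℝ} (hμ : 0 ≤ μ) (hδ : δ ≤ A.η * A.σ * μ)
    {P Q : ProbabilityMeasure ℝ}
    (hPQ : IsTradeOffPair (samplingOp (A.rate v) (gaussianTradeOff μ)) P Q) (ρ : Measure 𝔼)
    [IsProbabilityMeasure ρ] (k : ℕ) :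
    Dominated ((fun ρ : Measure 𝔼 => ρ.bind (A.stepLaw v data))^[k] ρ)
      ((fun ρ : Measure 𝔼 => ρ.bind (A.stepLaw v data'))^[k] ρ)
      (Measure.pi fun _ : Fin k => (P : Measure ℝ)) (Measure.pi fun _ : Fin k => (Q : Measure ℝ)) := by
  induction k with
  | zero => exact Dominated.refl (ρ := ρ) _ _
  | succ k ih =>
    have i1 := A.isProbabilityMeasure_iterate v data k ρ
    have i2 := A.isProbabilityMeasure_iterate v data' k ρ
    refine Dominated.pi_of_forall (P := fun _ => P) (Q := fun _ => Q) (Fin.last k) ih hPQ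
      fun Y _ φ hφ => ⟨_, _, hφ.integral_kernel (A.measurable_stepLaw v data),
        hφ.integral_kernel (A.measurable_stepLaw v data'), fun p => ?_, fun y => ?_⟩
    · exact S.samplingOp_le hμ hδ p.1 (hφ.comp (g := fun x => (x, p.2)) (by fun_prop))
    · rw [Function.iterate_succ_apply', Function.iterate_succ_apply']
      have hφy : IsTest fun x => φ (x, y) := hφ.comp (g := fun x => (x, y)) (by fun_prop)
      exact ⟨hφy.integral_bind (A.measurable_stepLaw v data) _,
        hφy.integral_bind (A.measurable_stepLaw v data') _⟩

/-- Without convexity: the steps of the pass compose as subsampled Gaussian mechanisms. -/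
theorem exists_tensor_of_stepSplit {i j : V} {t : ℕ} (ht : 1 ≤ t) (hhit : 0 < A.hitProb i j t)
    {D D' : A.Dataset} (E : A.Dataset) {δ : ℝ} (S : A.StepSplit i (D i) (D' i) δ) {μ : ℝ}
    (hμ : 0 ≤ μ) (hδ : δ ≤ A.η * A.σ * μ) :
    ∃ h : ℝ → ℝ,
      IsTradeOffTensor (fun _ : Fin A.K => samplingOp (A.rate i) (gaussianTradeOff μ)) h ∧
      ∀ α ∈ Set.Icc (0 : ℝ) 1, h α ≤ tradeOff (A.viewLaw i j t (A.singlePass D E))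
        (A.viewLaw i j t (A.singlePass D' E)) α := by
  obtain ⟨n, rfl⟩ : ∃ n, t = n + 1 := ⟨t - 1, by omega⟩
  have := A.init_prob
  obtain ⟨P, Q, hPQ⟩ := exists_isTradeOffPair_sampling_gaussian (A := A) i hμ
  refine ⟨_, ⟨fun _ => P, fun _ => Q, fun _ => hPQ.1, fun _ _ => rfl⟩, fun α hα => ?_⟩
  refine tradeOff_le_tradeOff (fun φ hφ => ?_) hα.1
  obtain ⟨g, hg, hint, -⟩ := A.exists_test_viewLaw i j n hhit E hφ
  obtain ⟨φ₀, hφ₀, h⟩ := S.dominated_iterate hμ hδ hPQ A.init A.K Unit (fun q => g q.1)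
    (hg.comp measurable_fst)
  refine ⟨fun x => φ₀ (x, ()), hφ₀.comp (by fun_prop), ?_⟩
  rw [hint, hint]
  exact h ()

end DecSGD

/-! ### Tools for comparing displaced models -/

/-- Mixtures with independent mixing laws keep a trade-off that holds for all pairs. -/
theorem gaussianTradeOff_integral_le_of_forall {Ω : Type*} [MeasurableSpace Ω] (ν ν' : Measure Ω)
    [IsProbabilityMeasure ν] [IsProbabilityMeasure ν'] {μ : ℝ} {a a' : Ω → ℝ} (ha : IsTest a)
    (ha' : IsTest a') (h : ∀ x x', gaussianTradeOff μ (a x) ≤ 1 - a' x') :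
    gaussianTradeOff μ (∫ x, a x ∂ν) ≤ 1 - ∫ x, a' x ∂ν' := by
  -- At some point a is at most its mean. Monotonicity reduces to this point, and the bound against
  -- all x' is then averaged over ν'.
  obtain ⟨x, hx⟩ := exists_le_integral (ha.integrable ν)
  refine (gaussianTradeOff_antitone μ hx).trans ?_
  have := integral_mono (integrable_const (gaussianTradeOff μ (a x)))
    (ha'.one_sub.integrable ν') (h x)
  rw [ha'.integral_one_sub] at this
  simpa using this

theorem IsTest.integral_condKernel {Ω Ω' : Type*} [MeasurableSpace Ω] [MeasurableSpace Ω']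
    [StandardBorelSpace Ω'] [Nonempty Ω'] (ρ : Measure (Ω × Ω')) [IsFiniteMeasure ρ]
    {φ : Ω × Ω' → ℝ} (hφ : IsTest φ) :
    ∫ x, ∫ y, φ (x, y) ∂ρ.condKernel x ∂ρ.fst = ∫ z, φ z ∂ρ :=
  Measure.integral_condKernel (hφ.integrable ρ)

/-- The identity on the closed ball of radius `a`, and zero outside. -/
noncomputable def clip {d : ℕ} (a : ℝ) (u : EuclideanSpace ℝ (Fin d)) : EuclideanSpace ℝ (Fin d) :=
  if ‖u‖ ≤ a then u else 0

theorem clip_of_le {d : ℕ} {a : ℝ} {u : EuclideanSpace ℝ (Fin d)} (h : ‖u‖ ≤ a) : clip a u = u :=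
  if_pos h

/-- The bound holds for every u. Thus the displacement bounds hold for every pair of models and need
no exceptional sets, although clipping is inactive almost surely for the coupled runs. -/
theorem norm_clip_le {d : ℕ} {a : ℝ} (ha : 0 ≤ a) (u : EuclideanSpace ℝ (Fin d)) :
    ‖clip a u‖ ≤ a := by
  unfold clip
  split_ifs with h
  · exact h
  · simpa using ha

theorem measurable_clip {d : ℕ} (a : ℝ) :
    Measurable (clip a : EuclideanSpace ℝ (Fin d) → EuclideanSpace ℝ (Fin d)) :=
  Measurable.ite (measurableSet_le measurable_norm measurable_const) measurable_id measurable_const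

theorem shiftB_nonneg {c s : ℝ} (hc : 0 ≤ c) (γ : ℕ → ℝ) (k : ℕ) : 0 ≤ shiftB c s γ k := by
  induction k with
  | zero => exact le_rfl
  | succ k ih => exact (mul_nonneg hc ih).trans (le_max_left _ _)

theorem shiftASucc_nonneg {c s : ℝ} (hc : 0 ≤ c) (hs : 0 ≤ s) {γ : ℕ → ℝ}
    (hγ : ∀ k, 0 < γ k ∧ γ k < 1) (k : ℕ) : 0 ≤ shiftASucc c s γ k :=
  mul_nonneg (hγ _).1.le (add_nonneg (mul_nonneg hc (shiftB_nonneg hc γ k)) hs)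

namespace DecSGD

variable {V Z : Type*} [Fintype V] [DecidableEq V] {d : ℕ} (A : DecSGD V Z d)

local notation "𝔼" => EuclideanSpace ℝ (Fin d)

/-! ### Runs together with a reference run -/

/-- The joint law of two models that are perturbed by the same noise. -/
noncomputable def pairNoise (u u' : 𝔼) : Measure (𝔼 × 𝔼) :=
  (stdGaussian 𝔼).map fun N => (A.proj (u - (A.η * A.σ) • N), A.proj (u' - (A.η * A.σ) • N))

theorem measurable_pairNoise_right (u u' : 𝔼) : Measurable fun N : 𝔼 =>
    (A.proj (u - (A.η * A.σ) • N), A.proj (u' - (A.η * A.σ) • N)) :=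
  (A.measurable_noise_right u).prodMk (A.measurable_noise_right u')

instance isProbabilityMeasure_pairNoise (u u' : 𝔼) : IsProbabilityMeasure (A.pairNoise u u') :=
  Measure.isProbabilityMeasure_map (A.measurable_pairNoise_right u u').aemeasurable

theorem measurable_pairNoise : Measurable fun q : 𝔼 × 𝔼 => A.pairNoise q.1 q.2 := by
  refine measurable_map_prodMk (f := fun (q : 𝔼 × 𝔼) N =>
    (A.proj (q.1 - (A.η * A.σ) • N), A.proj (q.2 - (A.η * A.σ) • N))) ?_ _
  exact (A.measurable_proj.comp (by fun_prop)).prodMk (A.measurable_proj.comp (by fun_prop))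

theorem integral_pairNoise_fst (u u' : 𝔼) {φ : 𝔼 → ℝ} (hφ : IsTest φ) :
    ∫ z, φ z.1 ∂A.pairNoise u u' = ∫ x, φ x ∂A.noiseLaw u := by
  rw [pairNoise, integral_map (A.measurable_pairNoise_right u u').aemeasurable
    (hφ.comp measurable_fst).measurable.aestronglyMeasurable, A.integral_noiseLaw u hφ]

theorem integral_pairNoise_snd (u u' : 𝔼) {φ : 𝔼 → ℝ} (hφ : IsTest φ) :
    ∫ z, φ z.2 ∂A.pairNoise u u' = ∫ x, φ x ∂A.noiseLaw u' := by
  rw [pairNoise, integral_map (A.measurable_pairNoise_right u u').aemeasurable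
    (hφ.comp measurable_snd).measurable.aestronglyMeasurable, A.integral_noiseLaw u' hφ]

/-- The pairs of models at distance greater than `b`. -/
def farPairs (d : ℕ) (b : ℝ) : Set (EuclideanSpace ℝ (Fin d) × EuclideanSpace ℝ (Fin d)) :=
  {z | b < ‖z.2 - z.1‖}

theorem measurableSet_farPairs (b : ℝ) : MeasurableSet (farPairs d b) :=
  measurableSet_lt measurable_const (by fun_prop)

theorem pairNoise_farPairs {u u' : 𝔼} {b : ℝ} (h : ‖u' - u‖ ≤ b) :
    A.pairNoise u u' (farPairs d b) = 0 := by
  rw [pairNoise, Measure.map_apply (A.measurable_pairNoise_right u u') (measurableSet_farPairs b)]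
  refine (congrArg _ (Set.eq_empty_of_forall_notMem fun N hN => ?_)).trans measure_empty
  have hN' : b < ‖A.proj (u' - (A.η * A.σ) • N) - A.proj (u - (A.η * A.σ) • N)‖ := hN
  have := A.norm_proj_sub_le (u' - (A.η * A.σ) • N) (u - (A.η * A.σ) • N)
  rw [sub_sub_sub_cancel_right] at this
  linarith

/-- The step of user `v` with the given data as a mixture of gradient steps `ψ₀ q` and `ψ q` at
distance at most `δ`. -/
structure Mixture (v : V) (data : Fin (A.sz v) → Z) (δ : ℝ) where
  ι : Type
  I : Finset ι
  w : ι → ℝ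
  ψ₀ : ι → 𝔼 → 𝔼
  ψ : ι → 𝔼 → 𝔼
  w_nonneg : ∀ q, 0 ≤ w q
  sum_w : ∑ q ∈ I, w q = 1
  grad₀ : ∀ q ∈ I, A.IsGradMap (ψ₀ q)
  grad : ∀ q ∈ I, A.IsGradMap (ψ q)
  dist : ∀ q ∈ I, ∀ θ, ‖ψ₀ q θ - ψ q θ‖ ≤ δ
  law : ∀ θ, A.stepLaw v data θ = ∑ q ∈ I, ENNReal.ofReal (w q) •
    (ENNReal.ofReal (1 - A.rate v) • A.noiseLaw (ψ₀ q θ) +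
      ENNReal.ofReal (A.rate v) • A.noiseLaw (ψ q θ))

variable {A}

/-- The mixture for the first dataset. -/
@[reducible] def StepSplit.left {v : V} {data data' : Fin (A.sz v) → Z} {δ : ℝ}
    (S : A.StepSplit v data data' δ) : A.Mixture v data δ :=
  ⟨S.ι, S.I, S.w, S.ψ₀, S.ψ₁, S.w_nonneg, S.sum_w, S.grad₀, S.grad₁, S.dist₀₁, S.law⟩

/-- The mixture for the second dataset. -/
@[reducible] def StepSplit.right {v : V} {data data' : Fin (A.sz v) → Z} {δ : ℝ}
    (S : A.StepSplit v data data' δ) : A.Mixture v data' δ :=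
  ⟨S.ι, S.I, S.w, S.ψ₀, S.ψ₁', S.w_nonneg, S.sum_w, S.grad₀, S.grad₁', S.dist₀₁', S.law'⟩

/-- The center of the step of the reference model `z.1` when the model `z.2` makes the step `f`:
a fraction `γ` of the displacement is compensated, up to the size `a`. -/
noncomputable def refCenter (γ a : ℝ) (f₀ f : 𝔼 → 𝔼) (z : 𝔼 × 𝔼) : 𝔼 :=
  f₀ z.1 + clip a (γ • (f z.2 - f₀ z.1))

theorem measurable_refCenter {f₀ f : 𝔼 → 𝔼} (h₀ : Measurable f₀) (h : Measurable f) (γ a : ℝ) :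
    Measurable (refCenter γ a f₀ f) := by
  have := measurable_clip (d := d) a
  unfold refCenter
  fun_prop

theorem norm_refCenter_sub_le {a : ℝ} (ha : 0 ≤ a) (γ : ℝ) (f₀ f : 𝔼 → 𝔼) (z : 𝔼 × 𝔼) :
    ‖refCenter γ a f₀ f z - f₀ z.1‖ ≤ a := by
  rw [refCenter, add_sub_cancel_left]
  exact norm_clip_le ha _

namespace Mixture

variable {v : V} {data : Fin (A.sz v) → Z} {δ : ℝ} (H : A.Mixture v data δ)

/-- One step of a reference model (first component) and of the model (second component). -/
noncomputable def pairStep (γ a : ℝ) (z : 𝔼 × 𝔼) : Measure (𝔼 × 𝔼) :=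
  ∑ q ∈ H.I, ENNReal.ofReal (H.w q) •
    (ENNReal.ofReal (1 - A.rate v) • A.pairNoise (H.ψ₀ q z.1) (H.ψ₀ q z.2) +
      ENNReal.ofReal (A.rate v) • A.pairNoise (refCenter γ a (H.ψ₀ q) (H.ψ q) z) (H.ψ q z.2))

/-- The joint law of the reference model and the model after `k` steps. -/
noncomputable def pairLaw (γ a : ℕ → ℝ) : ℕ → Measure (𝔼 × 𝔼)
  | 0 => A.init.map fun x => (x, x)
  | k + 1 => (pairLaw γ a k).bind (H.pairStep (γ (k + 1)) (a k))

theorem measurable_pairStep (γ a : ℝ) : Measurable (H.pairStep γ a) := by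
  refine Measure.measurable_of_measurable_coe _ fun s hs => ?_
  simp only [pairStep, Measure.finsetSum_apply, Measure.smul_apply, smul_eq_mul, Measure.add_apply]
  refine Finset.measurable_sum _ fun q hq => ?_
  have h₀ := (H.grad₀ q hq).measurable
  have h₁ := (H.grad q hq).measurable
  have m := (Measure.measurable_coe hs).comp A.measurable_pairNoise
  have m1 : Measurable fun z : 𝔼 × 𝔼 => A.pairNoise (H.ψ₀ q z.1) (H.ψ₀ q z.2) s :=
    m.comp (g := fun r : 𝔼 × 𝔼 => A.pairNoise r.1 r.2 s)
      ((h₀.comp measurable_fst).prodMk (h₀.comp measurable_snd))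
  have m2 : Measurable fun z : 𝔼 × 𝔼 =>
      A.pairNoise (refCenter γ a (H.ψ₀ q) (H.ψ q) z) (H.ψ q z.2) s :=
    m.comp (g := fun r : 𝔼 × 𝔼 => A.pairNoise r.1 r.2 s)
      ((measurable_refCenter h₀ h₁ γ a).prodMk (h₁.comp measurable_snd))
  exact ((m1.const_mul _).add (m2.const_mul _)).const_mul _

theorem isProbabilityMeasure_pairStep (γ a : ℝ) (z : 𝔼 × 𝔼) :
    IsProbabilityMeasure (H.pairStep γ a z) := by
  constructor
  simp only [pairStep, Measure.finsetSum_apply, Measure.smul_apply, smul_eq_mul, Measure.add_apply,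
    measure_univ, mul_one]
  rw [← ENNReal.ofReal_add (sub_nonneg.2 (A.rate_le_one v)) (A.rate_nonneg v), sub_add_cancel,
    ENNReal.ofReal_one]
  simp only [mul_one]
  rw [← ENNReal.ofReal_sum_of_nonneg fun q _ => H.w_nonneg q, H.sum_w, ENNReal.ofReal_one]

theorem isProbabilityMeasure_pairLaw (γ a : ℕ → ℝ) (k : ℕ) :
    IsProbabilityMeasure (H.pairLaw γ a k) := by
  induction k with
  | zero =>
    have := A.init_prob
    exact Measure.isProbabilityMeasure_map (by fun_prop)
  | succ k ih =>
    have := H.isProbabilityMeasure_pairStep (γ (k + 1)) (a k)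
    exact isProbabilityMeasure_bind (H.measurable_pairStep _ _) _

theorem integral_pairStep_fst (γ a : ℝ) (z : 𝔼 × 𝔼) {φ : 𝔼 → ℝ} (hφ : IsTest φ) :
    ∫ z', φ z'.1 ∂H.pairStep γ a z =
      ∑ q ∈ H.I, H.w q * ((1 - A.rate v) * (∫ x, φ x ∂A.noiseLaw (H.ψ₀ q z.1)) +
        A.rate v * ∫ x, φ x ∂A.noiseLaw (refCenter γ a (H.ψ₀ q) (H.ψ q) z)) := by
  rw [pairStep, integral_mixture H.w_nonneg (A.rate_nonneg v) (A.rate_le_one v)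
    (fun _ _ => inferInstance) (fun _ _ => inferInstance) (hφ.comp measurable_fst)]
  simp only [A.integral_pairNoise_fst _ _ hφ]

theorem integral_pairStep_snd (γ a : ℝ) (z : 𝔼 × 𝔼) {φ : 𝔼 → ℝ} (hφ : IsTest φ) :
    ∫ z', φ z'.2 ∂H.pairStep γ a z = A.stepTest v data φ z.2 := by
  rw [pairStep, integral_mixture H.w_nonneg (A.rate_nonneg v) (A.rate_le_one v)
    (fun _ _ => inferInstance) (fun _ _ => inferInstance) (hφ.comp measurable_snd), stepTest, H.law,
    integral_mixture H.w_nonneg (A.rate_nonneg v) (A.rate_le_one v)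
    (fun _ _ => inferInstance) (fun _ _ => inferInstance) hφ]
  simp only [A.integral_pairNoise_snd _ _ hφ]

theorem integral_pairLaw_succ (γ a : ℕ → ℝ) (k : ℕ) {φ : 𝔼 × 𝔼 → ℝ} (hφ : IsTest φ) :
    ∫ z, φ z ∂H.pairLaw γ a (k + 1) =
      ∫ z, ∫ z', φ z' ∂H.pairStep (γ (k + 1)) (a k) z ∂H.pairLaw γ a k := by
  have := H.isProbabilityMeasure_pairStep (γ (k + 1)) (a k)
  have := H.isProbabilityMeasure_pairLaw γ a k
  exact hφ.integral_bind (H.measurable_pairStep _ _) _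

/-- The second component evolves by itself with the true step law, so the coupling does not alter
the run. -/
theorem integral_pairLaw_snd (γ a : ℕ → ℝ) (k : ℕ) {φ : 𝔼 → ℝ} (hφ : IsTest φ) :
    ∫ z, φ z.2 ∂H.pairLaw γ a k =
      ∫ x, φ x ∂((fun ρ : Measure 𝔼 => ρ.bind (A.stepLaw v data))^[k] A.init) := by
  have := A.init_prob
  induction k generalizing φ with
  | zero =>
    rw [pairLaw, integral_map (by fun_prop)
      (hφ.comp measurable_snd).measurable.aestronglyMeasurable]
    rfl
  | succ k ih =>
    have := A.isProbabilityMeasure_iterate v data k A.init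
    rw [H.integral_pairLaw_succ γ a k (hφ.comp measurable_snd)]
    simp only [H.integral_pairStep_snd _ _ _ hφ]
    rw [ih (A.isTest_stepTest v data hφ), Function.iterate_succ_apply',
      hφ.integral_bind (A.measurable_stepLaw v data)]
    rfl

/-- The reference model stays within distance `b_k` of the model. -/
theorem pairLaw_farPairs {c : ℝ} (hc : A.Contracting c) (hc0 : 0 ≤ c) {γ : ℕ → ℝ}
    (hγ : ∀ k, 0 < γ k ∧ γ k < 1) (k : ℕ) :
    H.pairLaw γ (shiftASucc c δ γ) k (farPairs d (shiftB c δ γ k)) = 0 := by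
  induction k with
  | zero =>
    rw [pairLaw, Measure.map_apply (by fun_prop) (measurableSet_farPairs _)]
    refine (congrArg _ (Set.eq_empty_of_forall_notMem fun x hx => ?_)).trans measure_empty
    have : shiftB c δ γ 0 < ‖x - x‖ := hx
    simp [shiftB] at this
  | succ k ih =>
    rw [pairLaw, Measure.bind_apply (measurableSet_farPairs _)
      (H.measurable_pairStep _ _).aemeasurable]
    refine (lintegral_congr_ae (g := 0) ?_).trans lintegral_zero
    have hae : ∀ᵐ z ∂H.pairLaw γ (shiftASucc c δ γ) k,
        ‖z.2 - z.1‖ ≤ shiftB c δ γ k := by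
      rw [ae_iff]
      convert ih using 2
      ext z; simp [farPairs]
    filter_upwards [hae] with z hz
    simp only [pairStep, Measure.finsetSum_apply, Measure.smul_apply, smul_eq_mul,
      Measure.add_apply, Pi.zero_apply]
    refine Finset.sum_eq_zero fun q hq => ?_
    have e0 : ‖H.ψ₀ q z.2 - H.ψ₀ q z.1‖ ≤ c * shiftB c δ γ k :=
      ((H.grad₀ q hq).norm_sub_le hc _ _).trans (mul_le_mul_of_nonneg_left hz hc0)
    have e1 : ‖H.ψ q z.2 - H.ψ₀ q z.1‖ ≤ c * shiftB c δ γ k + δ := by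
      have e2 : ‖H.ψ q z.2 - H.ψ q z.1‖ ≤ c * shiftB c δ γ k :=
        ((H.grad q hq).norm_sub_le hc _ _).trans (mul_le_mul_of_nonneg_left hz hc0)
      have e3 := H.dist q hq z.1
      rw [norm_sub_rev] at e3
      have e4 := norm_add_le (H.ψ q z.2 - H.ψ q z.1) (H.ψ q z.1 - H.ψ₀ q z.1)
      rw [sub_add_sub_cancel] at e4
      linarith
    have hg := hγ (k + 1)
    have e6 : A.pairNoise (H.ψ₀ q z.1) (H.ψ₀ q z.2) (farPairs d (shiftB c δ γ (k + 1))) = 0 :=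
      A.pairNoise_farPairs (e0.trans (le_max_left _ _))
    rw [e6, A.pairNoise_farPairs]
    · simp
    -- The displacement before compensation is at most c·b_k + δ, and a_{k+1} is γ_{k+1} times this
    -- bound, so clipping is inactive and the fraction 1 - γ_{k+1} remains.
    · have hcl : clip (shiftASucc c δ γ k) (γ (k + 1) • (H.ψ q z.2 - H.ψ₀ q z.1)) =
          γ (k + 1) • (H.ψ q z.2 - H.ψ₀ q z.1) := by
        refine clip_of_le ?_
        rw [norm_smul, Real.norm_eq_abs, abs_of_pos hg.1]
        exact mul_le_mul_of_nonneg_left e1 hg.1.le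
      have e5 : H.ψ q z.2 - refCenter (γ (k + 1)) (shiftASucc c δ γ k) (H.ψ₀ q) (H.ψ q) z =
          (1 - γ (k + 1)) • (H.ψ q z.2 - H.ψ₀ q z.1) := by
        rw [refCenter, hcl]; module
      rw [e5, norm_smul, Real.norm_eq_abs, abs_of_pos (sub_pos.2 hg.2)]
      exact (mul_le_mul_of_nonneg_left e1 (sub_pos.2 hg.2).le).trans (le_max_right _ _)

end Mixture

end DecSGD

/-! ### Composition along the reference runs and the bound for contracting steps -/

namespace DecSGD

variable {V Z : Type*} [Fintype V] [DecidableEq V] {d : ℕ} {A : DecSGD V Z d}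

local notation "𝔼" => EuclideanSpace ℝ (Fin d)

namespace Mixture

variable {v : V} {data : Fin (A.sz v) → Z} {δ : ℝ} (H : A.Mixture v data δ)

/-- The component for ψ₀ does not depend on the hidden model x. It therefore stays common to both
runs after averaging over their different conditional laws of x. -/
theorem integral_pairStep_fst_integral (γ a : ℝ) (x₀ : 𝔼) (ν : Measure 𝔼) [IsProbabilityMeasure ν]
    {φ : 𝔼 → ℝ} (hφ : IsTest φ) :
    ∫ x, ∫ z', φ z'.1 ∂H.pairStep γ a (x₀, x) ∂ν =
      ∑ q ∈ H.I, H.w q * ((1 - A.rate v) * (∫ x, φ x ∂A.noiseLaw (H.ψ₀ q x₀)) +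
        A.rate v * ∫ x, ∫ y, φ y ∂A.noiseLaw (refCenter γ a (H.ψ₀ q) (H.ψ q) (x₀, x)) ∂ν) := by
  have hi : ∀ q ∈ H.I, Integrable
      (fun x => ∫ y, φ y ∂A.noiseLaw (refCenter γ a (H.ψ₀ q) (H.ψ q) (x₀, x))) ν := fun q hq =>
    ((hφ.integral_kernel' A.measurable_noiseLaw).comp
      ((measurable_refCenter (H.grad₀ q hq).measurable (H.grad q hq).measurable γ a).comp
        measurable_prodMk_left)).integrable ν
  simp only [H.integral_pairStep_fst γ a _ hφ]
  have hi' : ∀ q ∈ H.I, Integrable (fun x => H.w q * ((1 - A.rate v) *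
      (∫ x, φ x ∂A.noiseLaw (H.ψ₀ q x₀)) +
        A.rate v * ∫ y, φ y ∂A.noiseLaw (refCenter γ a (H.ψ₀ q) (H.ψ q) (x₀, x)))) ν :=
    fun q hq => ((integrable_const _).add ((hi q hq).const_mul _)).const_mul _
  rw [integral_finsetSum _ hi']
  refine Finset.sum_congr rfl fun q hq => ?_
  rw [integral_const_mul, integral_add (integrable_const _) ((hi q hq).const_mul _),
    integral_const, integral_const_mul, probReal_univ, one_smul]

instance isProbabilityMeasure_pairLaw_fst (γ a : ℕ → ℝ) (k : ℕ) :
    IsProbabilityMeasure (H.pairLaw γ a k).fst := by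
  have := H.isProbabilityMeasure_pairLaw γ a k
  infer_instance

/-- The reference step depends on the model as well as on the reference. Disintegrating the joint
law expresses the next reference law through a kernel acting on the current reference alone, as
composition requires. -/
theorem integral_pairLaw_fst_succ (γ a : ℕ → ℝ) (k : ℕ) [IsFiniteMeasure (H.pairLaw γ a k)]
    {φ : 𝔼 → ℝ} (hφ : IsTest φ) :
    ∫ x, φ x ∂(H.pairLaw γ a (k + 1)).fst =
      ∫ x₀, ∫ x, ∫ z', φ z'.1 ∂H.pairStep (γ (k + 1)) (a k) (x₀, x)
        ∂(H.pairLaw γ a k).condKernel x₀ ∂(H.pairLaw γ a k).fst := by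
  have := H.isProbabilityMeasure_pairLaw γ a k
  have := H.isProbabilityMeasure_pairStep (γ (k + 1)) (a k)
  have hφ' : IsTest fun z : 𝔼 × 𝔼 => φ z.1 := hφ.comp measurable_fst
  rw [Measure.fst, integral_map (by fun_prop) hφ.measurable.aestronglyMeasurable,
    H.integral_pairLaw_succ γ a k hφ',
    ← (hφ'.integral_kernel' (H.measurable_pairStep _ _)).integral_condKernel (H.pairLaw γ a k)]

end Mixture

/-- One step of the two reference models from the same model is a subsampled Gaussian mechanism. -/
theorem StepSplit.samplingOp_reference_le {v : V} {data data' : Fin (A.sz v) → Z} {δ : ℝ}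
    (S : A.StepSplit v data data' δ) {μ : ℝ} (hμ : 0 ≤ μ) {a : ℝ} (ha : 0 ≤ a)
    (haμ : 2 * a ≤ A.η * A.σ * μ) (γ : ℝ) (x₀ : 𝔼) (ν ν' : Measure 𝔼) [IsProbabilityMeasure ν]
    [IsProbabilityMeasure ν'] {φ : 𝔼 → ℝ} (hφ : IsTest φ) :
    samplingOp (A.rate v) (gaussianTradeOff μ)
        (∫ x, ∫ z', φ z'.1 ∂S.left.pairStep γ a (x₀, x) ∂ν) ≤
      1 - ∫ x, ∫ z', φ z'.1 ∂S.right.pairStep γ a (x₀, x) ∂ν' := by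
  rw [S.left.integral_pairStep_fst_integral γ a x₀ ν hφ,
    S.right.integral_pairStep_fst_integral γ a x₀ ν' hφ]
  refine (SamplingDom.sum (fun q _ => S.w_nonneg q) S.sum_w fun q hq => ?_).le_one_sub
  set u₀ := S.ψ₀ q x₀ with hu₀
  set u : 𝔼 → 𝔼 := fun x => refCenter γ a (S.ψ₀ q) (S.ψ₁ q) (x₀, x) with hu
  set u' : 𝔼 → 𝔼 := fun x => refCenter γ a (S.ψ₀ q) (S.ψ₁' q) (x₀, x) with hu'
  have hmu : Measurable u := (measurable_refCenter (S.grad₀ q hq).measurable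
    (S.grad₁ q hq).measurable γ a).comp measurable_prodMk_left
  have hmu' : Measurable u' := (measurable_refCenter (S.grad₀ q hq).measurable
    (S.grad₁' q hq).measurable γ a).comp measurable_prodMk_left
  have hd : ∀ x, ‖u x - u₀‖ ≤ a := fun x => norm_refCenter_sub_le ha γ _ _ (x₀, x)
  have hd' : ∀ x, ‖u' x - u₀‖ ≤ a := fun x => norm_refCenter_sub_le ha γ _ _ (x₀, x)
  -- Both reference centers are within a of the common u₀ for all hidden models x and x'. This gives
  -- the 2a and allows arbitrary mixing laws ν and ν'.
  have hdd : ∀ x x', ‖u x - u' x'‖ ≤ A.η * A.σ * μ := fun x x' => by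
    have := norm_sub_le (u x - u₀) (u' x' - u₀)
    rw [sub_sub_sub_cancel_right] at this
    linarith [hd x, hd' x']
  have hker := hφ.integral_kernel' A.measurable_noiseLaw
  have ht : IsTest fun x => ∫ y, φ y ∂A.noiseLaw (u x) := hker.comp hmu
  have ht' : IsTest fun x => ∫ y, φ y ∂A.noiseLaw (u' x) := hker.comp hmu'
  have ht₀ : IsTest fun _ : 𝔼 => ∫ y, φ y ∂A.noiseLaw u₀ :=
    hker.comp (g := fun _ => u₀) measurable_const
  have hcompl : ∀ w w', ‖w - w'‖ ≤ A.η * A.σ * μ →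
      gaussianTradeOff μ (1 - ∫ x, φ x ∂A.noiseLaw w) ≤
        1 - (1 - ∫ x, φ x ∂A.noiseLaw w') := fun w w' h => by
    have := A.gaussianTradeOff_noiseLaw h hφ.one_sub
    rwa [hφ.integral_one_sub, hφ.integral_one_sub] at this
  refine samplingDom_mix (A.rate_nonneg v) (A.rate_le_one v) (gaussianTradeOff_icc hμ).1
    (gaussianTradeOff_icc hμ).2 ⟨hφ.integral_nonneg _, hφ.integral_le_one _⟩
    ⟨ht.integral_nonneg _, ht.integral_le_one _⟩ ⟨ht'.integral_nonneg _, ht'.integral_le_one _⟩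
    ?_ ?_ ?_ ?_
  · have := gaussianTradeOff_integral_le_of_forall ν ν' (μ := μ) ht₀ ht' fun _ x' =>
      A.gaussianTradeOff_noiseLaw (by rw [norm_sub_rev]; linarith [hd' x']) hφ
    simpa using this
  · exact gaussianTradeOff_integral_le_of_forall ν ν' ht ht' fun x x' =>
      A.gaussianTradeOff_noiseLaw (hdd x x') hφ
  · have := gaussianTradeOff_integral_le_of_forall ν ν (μ := μ) ht₀.one_sub ht.one_sub fun _ x =>
      hcompl _ _ (by rw [norm_sub_rev]; linarith [hd x])
    rw [ht.integral_one_sub] at this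
    simpa using this
  · have := gaussianTradeOff_integral_le_of_forall ν' ν (μ := μ) ht'.one_sub ht.one_sub
      fun x' x => hcompl _ _ (by rw [norm_sub_rev]; exact hdd x x')
    rw [ht.integral_one_sub, ht'.integral_one_sub] at this
    simpa using this

/-- The reference runs compose as subsampled Gaussian mechanisms. -/
theorem StepSplit.dominated_reference {v : V} {data data' : Fin (A.sz v) → Z} {δ : ℝ}
    (S : A.StepSplit v data data' δ) {μ a : ℕ → ℝ} (hμ : ∀ k, 0 ≤ μ k) (ha : ∀ k, 0 ≤ a k)
    (haμ : ∀ k, 2 * a k ≤ A.η * A.σ * μ k) {P Q : ℕ → ProbabilityMeasure ℝ}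
    (hPQ : ∀ k, IsTradeOffPair (samplingOp (A.rate v) (gaussianTradeOff (μ k))) (P k) (Q k))
    (γ : ℕ → ℝ) (k : ℕ) :
    Dominated (S.left.pairLaw γ a k).fst (S.right.pairLaw γ a k).fst
      (Measure.pi fun j : Fin k => (P j : Measure ℝ))
      (Measure.pi fun j : Fin k => (Q j : Measure ℝ)) := by
  induction k with
  | zero => exact Dominated.refl (ρ := (S.left.pairLaw γ a 0).fst) _ _
  | succ k ih =>
    have i1 := S.left.isProbabilityMeasure_pairLaw γ a k
    have i2 := S.right.isProbabilityMeasure_pairLaw γ a k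
    have j1 := S.left.isProbabilityMeasure_pairStep (γ (k + 1)) (a k)
    have j2 := S.right.isProbabilityMeasure_pairStep (γ (k + 1)) (a k)
    refine Dominated.pi_of_forall (P := fun j : Fin (k + 1) => P j)
      (Q := fun j : Fin (k + 1) => Q j) (Fin.last k) (by simpa [Fin.succAbove_last] using ih)
      (by simpa using hPQ k)
      fun Y _ φ hφ => ?_
    have hφ' : IsTest fun q : (𝔼 × 𝔼) × Y => φ (q.1.1, q.2) := hφ.comp (by fun_prop)
    have h1 := hφ'.integral_kernel (S.left.measurable_pairStep (γ (k + 1)) (a k))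
    have h2 := hφ'.integral_kernel (S.right.measurable_pairStep (γ (k + 1)) (a k))
    -- The arguments are reordered so that the conditional kernel integrates the model, while the
    -- reference x₀ is also kept as a parameter; the substitution p ↦ (p.1, p) below then supplies
    -- x₀ twice.
    have h1' : IsTest fun q : 𝔼 × (𝔼 × Y) =>
        ∫ z', φ (z'.1, q.2.2) ∂S.left.pairStep (γ (k + 1)) (a k) (q.2.1, q.1) :=
      h1.comp (g := fun q : 𝔼 × (𝔼 × Y) => ((q.2.1, q.1), q.2.2)) (by fun_prop)
    have h2' : IsTest fun q : 𝔼 × (𝔼 × Y) =>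
        ∫ z', φ (z'.1, q.2.2) ∂S.right.pairStep (γ (k + 1)) (a k) (q.2.1, q.1) :=
      h2.comp (g := fun q : 𝔼 × (𝔼 × Y) => ((q.2.1, q.1), q.2.2)) (by fun_prop)
    have g1 := (h1'.integral_kernel (S.left.pairLaw γ a k).condKernel.measurable).comp
      (g := fun p : 𝔼 × Y => (p.1, p)) (by fun_prop)
    have g2 := (h2'.integral_kernel (S.right.pairLaw γ a k).condKernel.measurable).comp
      (g := fun p : 𝔼 × Y => (p.1, p)) (by fun_prop)
    refine ⟨_, _, g1, g2, fun p => ?_, fun y => ?_⟩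
    · exact S.samplingOp_reference_le (hμ k) (ha k) (haμ k) (γ (k + 1)) p.1 _ _
        (hφ.comp (g := fun x => (x, p.2)) (by fun_prop))
    · have hφy : IsTest fun x => φ (x, y) := hφ.comp (g := fun x => (x, y)) (by fun_prop)
      exact ⟨S.left.integral_pairLaw_fst_succ γ a k hφy, S.right.integral_pairLaw_fst_succ γ a k hφy⟩

/-- For contracting gradient steps, the last iterate can be replaced by the reference model
together with a displacement of size at most `b_k`. -/
theorem Mixture.integral_iterate_eq {v : V} {data : Fin (A.sz v) → Z} {δ : ℝ}
    (H : A.Mixture v data δ) {c : ℝ} (hc : A.Contracting c) (hc0 : 0 ≤ c) {γ : ℕ → ℝ}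
    (hγ : ∀ k, 0 < γ k ∧ γ k < 1) (k : ℕ)
    [IsFiniteMeasure (H.pairLaw γ (shiftASucc c δ γ) k)] {g : 𝔼 → ℝ} (hg : IsTest g) :
    ∫ x, g x ∂((fun ρ : Measure 𝔼 => ρ.bind (A.stepLaw v data))^[k] A.init) =
      ∫ x₀, ∫ x, g (x₀ + clip (shiftB c δ γ k) (x - x₀))
        ∂(H.pairLaw γ (shiftASucc c δ γ) k).condKernel x₀
        ∂(H.pairLaw γ (shiftASucc c δ γ) k).fst := by
  have := H.isProbabilityMeasure_pairLaw γ (shiftASucc c δ γ) k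
  have hm := measurable_clip (d := d) (shiftB c δ γ k)
  have ht : IsTest fun z : 𝔼 × 𝔼 => g (z.1 + clip (shiftB c δ γ k) (z.2 - z.1)) :=
    hg.comp (by fun_prop)
  rw [ht.integral_condKernel (H.pairLaw γ (shiftASucc c δ γ) k),
    ← H.integral_pairLaw_snd γ (shiftASucc c δ γ) k hg]
  refine integral_congr_ae ?_
  have hae : ∀ᵐ z ∂H.pairLaw γ (shiftASucc c δ γ) k, ‖z.2 - z.1‖ ≤ shiftB c δ γ k := by
    rw [ae_iff]
    convert H.pairLaw_farPairs hc hc0 hγ k using 2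
    ext z; simp [farPairs]
  filter_upwards [hae] with z hz
  rw [clip_of_le hz, add_sub_cancel]

/-- Contracting gradient steps: the pass is a Gaussian mechanism for the displacement of the last
iterate composed with subsampled Gaussian mechanisms. -/
theorem exists_tensor_of_contracting {i j : V} {n : ℕ} (hn : 1 ≤ n)
    (hhit : 0 < A.hitProb i j (n + 1)) {D D' : A.Dataset} (E : A.Dataset) {δ : ℝ} (hδ : 0 ≤ δ)
    (S : A.StepSplit i (D i) (D' i) δ) {c : ℝ} (hc : A.Contracting c) (hc0 : 0 ≤ c) {γ : ℕ → ℝ}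
    (hγ : ∀ k, 0 < γ k ∧ γ k < 1) :
    ∃ h : ℝ → ℝ,
      IsTradeOffTensor
        (Fin.cons
          (gaussianTradeOff (2 * √2 * c ^ (n * A.K) * shiftB c δ γ A.K / (A.η * A.σ)))
          (fun k : Fin A.K => samplingOp (A.rate i)
            (gaussianTradeOff (2 * shiftASucc c δ γ k / (A.η * A.σ)))) :
          Fin (A.K + 1) → ℝ → ℝ) h ∧
      ∀ α ∈ Set.Icc (0 : ℝ) 1, h α ≤ tradeOff (A.viewLaw i j (n + 1) (A.singlePass D E))
        (A.viewLaw i j (n + 1) (A.singlePass D' E)) α := by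
  have hs := A.noise_pos
  have hb := shiftB_nonneg (s := δ) hc0 γ A.K
  have ha := shiftASucc_nonneg hc0 hδ hγ
  set μ : ℕ → ℝ := fun k => 2 * shiftASucc c δ γ k / (A.η * A.σ) with hμdef
  have hμ : ∀ k, 0 ≤ μ k := fun k => div_nonneg (mul_nonneg zero_le_two (ha k)) hs.le
  choose P Q hPQ using fun k => exists_isTradeOffPair_sampling_gaussian (A := A) i (hμ k)
  set μ₀ := 2 * √2 * c ^ (n * A.K) * shiftB c δ γ A.K / (A.η * A.σ) with hμ₀def
  have hμ₀ : 0 ≤ μ₀ := by positivity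
  have hG := isTradeOffPair_gaussian hμ₀
  set PG : ProbabilityMeasure ℝ := ⟨gaussianReal 0 1, inferInstance⟩
  set QG : ProbabilityMeasure ℝ := ⟨gaussianReal μ₀ 1, inferInstance⟩
  let P' : Fin (A.K + 1) → ProbabilityMeasure ℝ := Fin.cons PG fun k : Fin A.K => P k
  let Q' : Fin (A.K + 1) → ProbabilityMeasure ℝ := Fin.cons QG fun k : Fin A.K => Q k
  refine ⟨_, ⟨P', Q', fun k => ?_, fun _ _ => rfl⟩, fun α hα => ?_⟩
  · refine Fin.cases ?_ (fun k => ?_) k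
    · exact hG.1
    · exact (hPQ k).1
  refine tradeOff_le_tradeOff (fun φ hφ => ?_) hα.1
  obtain ⟨g, hg, hint, hsm⟩ := A.exists_test_viewLaw i j n hhit E hφ
  have i1 := S.left.isProbabilityMeasure_pairLaw γ (shiftASucc c δ γ) A.K
  have i2 := S.right.isProbabilityMeasure_pairLaw γ (shiftASucc c δ γ) A.K
  have hm := measurable_clip (d := d) (shiftB c δ γ A.K)
  have ht : IsTest fun z : 𝔼 × 𝔼 => g (z.2 + clip (shiftB c δ γ A.K) (z.1 - z.2)) :=
    hg.comp (by fun_prop)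
  have key : ∀ x₀ x x' : 𝔼, gaussianTradeOff μ₀ (g (x₀ + clip (shiftB c δ γ A.K) (x - x₀))) ≤
      1 - g (x₀ + clip (shiftB c δ γ A.K) (x' - x₀)) := fun x₀ x x' => by
    refine le_trans (gaussianTradeOff_antitone_left _ ?_)
      (hsm c hc hc0 hn (2 * shiftB c δ γ A.K) _ _ ?_)
    -- Two displacements of norm at most b_K differ by at most 2b_K, which gives the constant 2.
    -- Enlarging it to 2√2 only lowers the Gaussian trade-off function.
    · have h2 : 1 ≤ √2 := Real.one_le_sqrt.2 one_le_two
      have h3 : 0 ≤ c ^ (n * A.K) * shiftB c δ γ A.K / (A.η * A.σ) := by positivity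
      calc c ^ (n * A.K) / (A.η * A.σ) * (2 * shiftB c δ γ A.K) =
          2 * 1 * (c ^ (n * A.K) * shiftB c δ γ A.K / (A.η * A.σ)) := by ring
        _ ≤ 2 * √2 * (c ^ (n * A.K) * shiftB c δ γ A.K / (A.η * A.σ)) := by gcongr
        _ = μ₀ := by rw [hμ₀def]; ring
    · rw [add_sub_add_left_eq_sub]
      have := norm_sub_le (clip (shiftB c δ γ A.K) (x - x₀)) (clip (shiftB c δ γ A.K) (x' - x₀))
      linarith [norm_clip_le hb (x - x₀), norm_clip_le hb (x' - x₀)]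
  have hdom := S.dominated_reference hμ ha
    (fun k => le_of_eq (mul_div_cancel₀ _ hs.ne').symm) hPQ γ A.K
  have hκ : ∀ ρ : Measure (𝔼 × 𝔼), ∀ [IsFiniteMeasure ρ], IsTest fun q : 𝔼 × Unit =>
      ∫ x, g (q.1 + clip (shiftB c δ γ A.K) (x - q.1)) ∂ρ.condKernel q.1 := fun ρ _ =>
    (ht.integral_kernel ρ.condKernel.measurable).comp (g := fun q : 𝔼 × Unit => (q.1, q.1))
      (by fun_prop)
  -- The Gaussian factor, in coordinate 0, is composed last: given the reference model after K
  -- steps, the remaining comparison is between two laws of bounded displacements, bounded pairwise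
  -- by `key`.
  obtain ⟨Φ, hΦ, hy⟩ := Dominated.pi (P := P') (Q := Q') 0 (by simpa [P', Q'] using hdom) hG
    (hκ (S.left.pairLaw γ (shiftASucc c δ γ) A.K)) (hκ (S.right.pairLaw γ (shiftASucc c δ γ) A.K))
    fun q => gaussianTradeOff_integral_le_of_forall _ _
      (hg.comp (g := fun x => q.1 + clip (shiftB c δ γ A.K) (x - q.1)) (by fun_prop))
      (hg.comp (g := fun x => q.1 + clip (shiftB c δ γ A.K) (x - q.1)) (by fun_prop)) (key q.1)
  refine ⟨fun x => Φ (x, ()), hΦ.comp (by fun_prop), ?_⟩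
  rw [hint, hint, roundLaw, roundLaw, S.left.integral_iterate_eq hc hc0 hγ A.K hg,
    S.right.integral_iterate_eq hc hc0 hγ A.K hg]
  exact hy ()

/-- Averages of contractions are contractions. -/
theorem contracting_of_smooth {m M : ℝ} (h : ∀ v z, StrongConvexOn Set.univ m (A.loss v z) ∧
    IsSmoothLoss M (A.loss v z)) : A.Contracting (max |1 - A.η * m| |1 - A.η * M|) := by
  intro v data S hS x y
  have hb : (A.b : ℝ) ≠ 0 := by exact_mod_cast (lt_of_lt_of_le one_pos A.b_pos).ne'
  have e : ∀ x, A.gradMap v data S x =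
      (A.b : ℝ)⁻¹ • ∑ r ∈ S, (x - A.η • gradient (A.loss v (data r)) x) := fun x => by
    rw [Finset.sum_sub_distrib, Finset.sum_const, hS, smul_sub, ← Nat.cast_smul_eq_nsmul ℝ,
      inv_smul_smul₀ hb, ← Finset.smul_sum, smul_comm, gradMap, batchGrad]
  rw [e, e, ← smul_sub, ← Finset.sum_sub_distrib, norm_smul, norm_inv, Real.norm_natCast]
  have := norm_sum_le_of_le S fun r _ => norm_gradientStep_sub_le A.η_pos.le (h v (data r)).2
    (h v (data r)).1 x y
  rw [Finset.sum_const, hS, nsmul_eq_mul] at this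
  calc _ ≤ (A.b : ℝ)⁻¹ * (A.b * (max |1 - A.η * m| |1 - A.η * M| * ‖x - y‖)) := by gcongr
    _ = _ := by field_simp

end DecSGD

/-! ### The two parts of the lemma -/

theorem lemma4 {V Z : Type*} [Fintype V] [DecidableEq V] {d : ℕ} (A : DecSGD V Z d)
    (Δ : ℝ) (hΔ : A.GradSensitivity Δ)
    (i j : V) (t : ℕ) (ht : 1 ≤ t) (hhit : 0 < A.hitProb i j t)
    (D D' E : A.Dataset) (hDD' : A.RecordNeighbours i D D') :
    -- strongly convex and smooth losses
    (∀ m M : ℝ, 0 < m →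
      (∀ v z, StrongConvexOn Set.univ m (A.loss v z) ∧ IsSmoothLoss M (A.loss v z)) →
      A.η < 2 / M → 1 < t →
      ∀ γ : ℕ → ℝ, (∀ k, 0 < γ k ∧ γ k < 1) →
      ∀ c : ℝ, c = max |1 - A.η * m| |1 - A.η * M| →
      ∃ h : ℝ → ℝ,
        IsTradeOffTensor
          (Fin.cons
            (gaussianTradeOff (2 * √2 * c ^ ((t - 1) * A.K) * shiftB c (A.η * Δ) γ A.K
              / (A.η * A.σ)))
            (fun k : Fin A.K => samplingOp ((A.b : ℝ) / A.sz i)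
              (gaussianTradeOff (2 * shiftASucc c (A.η * Δ) γ k / (A.η * A.σ)))) :
            Fin (A.K + 1) → ℝ → ℝ) h ∧
        ∀ α ∈ Set.Icc (0 : ℝ) 1,
          h α ≤ tradeOff (A.viewLaw i j t (A.singlePass D E))
            (A.viewLaw i j t (A.singlePass D' E)) α) ∧
    -- losses that need not be convex
    ((∀ v z, Differentiable ℝ (A.loss v z)) →
      (∃ h : ℝ → ℝ,
        IsTradeOffTensor
          (fun _ : Fin A.K => samplingOp ((A.b : ℝ) / A.sz i) (gaussianTradeOff (Δ / A.σ))) h ∧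
        ∀ α ∈ Set.Icc (0 : ℝ) 1,
          h α ≤ tradeOff (A.viewLaw i j t (A.singlePass D E))
            (A.viewLaw i j t (A.singlePass D' E)) α) ∧
      (A.η ≤ 1 → ∃ h : ℝ → ℝ,
        IsTradeOffTensor
          (fun _ : Fin A.K =>
            samplingOp ((A.b : ℝ) / A.sz i) (gaussianTradeOff (Δ / (A.η * A.σ)))) h ∧
        ∀ α ∈ Set.Icc (0 : ℝ) 1,
          h α ≤ tradeOff (A.viewLaw i j t (A.singlePass D E))
            (A.viewLaw i j t (A.singlePass D' E)) α)) := by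
  have hΔ0 := A.delta_nonneg hΔ hDD'
  obtain ⟨S⟩ := A.nonempty_stepSplit hΔ hDD'
  have hs := A.noise_pos
  refine ⟨fun m M _ hloss _ ht1 γ hγ c hc => ?_, fun _ => ⟨?_, fun hη => ?_⟩⟩
  · obtain ⟨n, rfl⟩ : ∃ n, t = n + 1 := ⟨t - 1, by omega⟩
    subst hc
    exact DecSGD.exists_tensor_of_contracting (by omega) hhit E (mul_nonneg A.η_pos.le hΔ0) S
      (DecSGD.contracting_of_smooth hloss) ((abs_nonneg _).trans (le_max_left _ _)) hγ
  -- The centers differ by at most ηΔ under noise of scale ησ, so the step size cancels and μ = Δ/σ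
  -- is exact.
  · refine DecSGD.exists_tensor_of_stepSplit ht hhit E S (div_nonneg hΔ0 A.σ_pos.le) (le_of_eq ?_)
    have := A.σ_pos.ne'
    field_simp
  · refine DecSGD.exists_tensor_of_stepSplit ht hhit E S (div_nonneg hΔ0 hs.le) ?_
    -- With μ = Δ/(ησ) the requirement becomes ηΔ ≤ Δ, which is where η ≤ 1 enters.
    rw [mul_div_cancel₀ _ hs.ne']
    exact mul_le_of_le_one_left hΔ0 hη
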